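/- Let $n\ge 0$, and let $C^\infty(\mathbb{R}^n)$ be the algebra of complex-valued smooth functions on $\mathbb{R}^n$. Let $\star$ be a star product on $\mathbb{R}^n$ quantizing a Poisson structure $\{\cdot,\cdot\}$: a $\mathbb{C}[[\lambda]]$-bilinear associative product on $C^\infty(\mathbb{R}^n)[[\lambda]]$ of the form $f\star g = fg+\sum_{r\ge 1}\lambda^r C_r(f,g)$ for $f,g\in C^\infty(\mathbb{R}^n)$ (extended $\lambda$-bilinearly), where each $C_r$ is a bidifferential operator and $C_1(f,g)-C_1(g,f)=\mathrm{i}\{f,g\}$. Let $\mathcal{W}_0=C^\infty(\mathbb{R}^n)[[p_1,\dots,p_n]]$ and $\mathcal{W}=\mathcal{W}_0[[\lambda]]$, with the Weyl-Moyal product $$a\star_{\mathrm{Weyl}} b=\mu\circ \exp\Big(\tfrac{\mathrm{i}\lambda}{2}\sum_{k=1}^n\big(\partial_{q^k}\otimes\partial_{p_k}-\partial_{p_k}\otimes\partial_{q^k}\big)\Big)(a\otimes b),$$ where $\mu$ is the undeformed commutative product of $\mathcal{W}$. Let $\pi^*:C^\infty(\mathbb{R}^n)\to\mathcal{W}_0\subseteq\mathcal{W}$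 be the inclusion as series that are constant in $p$ and $\lambda$, and let $\deg=\sum_i p_i\frac{\partial}{\partial p_i}+\lambda\frac{\partial}{\partial\lambda}$ on $\mathcal{W}$. Then for each $k\ge 1$ there is a differential Hochschild 1-cochain $\tau_k$ of $C^\infty(\mathbb{R}^n)$ with values in $\mathcal{W}$, that is, a $\mathbb{C}$-linear map $\tau_k: C^\infty(\mathbb{R}^n)\to\mathcal{W}$ such that for all $r$ and $\alpha$ the coefficient of $\lambda^r p^\alpha$ in $\tau_k(f)$ is a (finite order) differential operator applied to $f$, with the following properties. Each $\tau_k$ is homogeneous of degree $k$, that is, $\deg(\tau_k(f))=k\,\tau_k(f)$ for all $f\in C^\infty(\mathbb{R}^n)$. The $\lambda$-linear extensions have a sum $$\tau=\pi^*+\sum_{k=1}^\infty\tau_k:\ \big(C^\infty(\mathbb{R}^n)[[\lambda]],\star\big)\longrightarrow\big(\mathcal{W},\star_{\mathrm{Weyl}}\big)$$ (for each $F\in C^\infty(\mathbb{R}^n)[[\lambda]]$, every coefficient of the partial sums applied to $F$ is eventually constant), and $\tau$ is an injective $\mathbb{C}[[\lambda]]$-linear algebra homomorphism: $\tau(F\star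 G)=\tau(F)\star_{\mathrm{Weyl}}\tau(G)$ for all $F,G$, and $\tau$ maps a unit element of $\star$ to $1$. Furthermore, if $\star$ is Hermitian, i.e. $\overline{F\star G}=\overline{G}\star\overline{F}$ for all $F,G$, where the conjugation acts on the coefficients and treats $\lambda$ and the $p_i$ as real, then the $\tau_k$ can be chosen such that in addition $\tau$ is a $*$-homomorphism: $\tau(\overline{F})=\overline{\tau(F)}$ for all $F$. -/

import Mathlib

open scoped ContDiff TensorProduct

noncomputable section

namespace FormalStar

/-! Smooth functions on `ℝⁿ` -/

/-- The smooth functions, as a star subalgebra of all functions `ℝⁿ → ℂ`. -/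
def smoothSubalgebra (n : ℕ) : StarSubalgebra ℂ ((Fin n → ℝ) → ℂ) where
  carrier := {f | ContDiff ℝ ∞ f}
  mul_mem' {f g} hf hg :=
    (ContDiff.mul (𝕜 := ℝ) (n := ∞) hf hg : ContDiff ℝ ∞ fun x => f x * g x)
  add_mem' {f g} hf hg :=
    (ContDiff.add (𝕜 := ℝ) (n := ∞) hf hg : ContDiff ℝ ∞ fun x => f x + g x)
  algebraMap_mem' c := (contDiff_const : ContDiff ℝ ∞ fun _ : Fin n → ℝ => c)
  star_mem' {f} hf := (Complex.conjCLE.contDiff.comp hf : ContDiff ℝ ∞ (Complex.conjCLE ∘ f))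

/-- The algebra `C^∞(ℝⁿ)` of complex-valued smooth functions on `ℝⁿ` with the pointwise operations;
its star operation is the pointwise complex conjugation. -/
def Smooth (n : ℕ) : Type := smoothSubalgebra n

instance (n : ℕ) : CommRing (Smooth n) := inferInstanceAs (CommRing (smoothSubalgebra n))

instance (n : ℕ) : Algebra ℂ (Smooth n) := inferInstanceAs (Algebra ℂ (smoothSubalgebra n))

instance (n : ℕ) : StarRing (Smooth n) := inferInstanceAs (StarRing (smoothSubalgebra n))

variable {n : ℕ}

/-- The function underlying an element of `C^∞(ℝⁿ)`. -/
def Smooth.toFun (f : Smooth n) : (Fin n → ℝ) → ℂ := f.1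

theorem Smooth.contDiff (f : Smooth n) : ContDiff ℝ ∞ f.toFun := f.2

theorem Smooth.ext {f g : Smooth n} (h : ∀ x, f.toFun x = g.toFun x) : f = g :=
  Subtype.ext (funext h)

/-- The partial derivative `∂/∂q^i` on `C^∞(ℝⁿ)`. -/
def dq (i : Fin n) : Module.End ℂ (Smooth n) where
  toFun f := ⟨fun x => fderiv ℝ f.toFun x (Pi.single i 1),
    (f.contDiff.fderiv_right (m := ∞) (by simp)).clm_apply contDiff_const⟩
  map_add' f g := by
    refine Smooth.ext fun x => ?_
    have hf := (f.contDiff.differentiable (by simp)) x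
    have hg := (g.contDiff.differentiable (by simp)) x
    change fderiv ℝ (f.toFun + g.toFun) x (Pi.single i 1) = _
    rw [fderiv_add hf hg]
    rfl
  map_smul' c f := by
    refine Smooth.ext fun x => ?_
    have hf := (f.contDiff.differentiable (by simp)) x
    change fderiv ℝ (c • f.toFun) x (Pi.single i 1) = _
    rw [fderiv_const_smul hf c]
    rfl

/-- The iterated partial derivative `∂^α` for a multi-index `α`. -/
def dqPow (α : Fin n →₀ ℕ) : Module.End ℂ (Smooth n) :=
  (List.ofFn fun i : Fin n => dq i ^ α i).prod

/-- `D f = ∑_α a_α ∂^α f`, a finite sum with smooth coefficients `a_α`. -/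
def IsDiffOp (D : Smooth n → Smooth n) : Prop :=
  ∃ a : (Fin n →₀ ℕ) →₀ Smooth n, ∀ f, D f = a.sum fun α c => c * dqPow α f

/-- `B (f, g) = ∑_{α, β} a_{α, β} ∂^α f ∂^β g`, a finite sum with smooth coefficients. -/
def IsBidiffOp (B : Smooth n → Smooth n → Smooth n) : Prop :=
  ∃ a : ((Fin n →₀ ℕ) × (Fin n →₀ ℕ)) →₀ Smooth n,
    ∀ f g, B f g = a.sum fun γ c => c * dqPow γ.1 f * dqPow γ.2 g

/-! Poisson structures and star products on `ℝⁿ` -/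

variable (n) in
/-- A Poisson structure on `ℝⁿ`: a real Poisson bracket, extended complex bilinearly. -/
structure PoissonStructure where
  bracket : Smooth n →ₗ[ℂ] Smooth n →ₗ[ℂ] Smooth n
  skew : ∀ f g, bracket f g = -bracket g f
  leibniz : ∀ f g h, bracket f (g * h) = bracket f g * h + g * bracket f h
  jacobi : ∀ f g h,
    bracket f (bracket g h) + bracket g (bracket h f) + bracket h (bracket f g) = 0
  real : ∀ f g, bracket (star f) (star g) = star (bracket f g)

/-- The product on `C^∞(ℝⁿ)[[λ]]` given by the `λ`-bilinear extension of `∑_r λ^r C_r`. -/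
def formalMul (C : ℕ → Smooth n →ₗ[ℂ] Smooth n →ₗ[ℂ] Smooth n)
    (F G : PowerSeries (Smooth n)) : PowerSeries (Smooth n) :=
  PowerSeries.mk fun m =>
    ∑ x ∈ Finset.HasAntidiagonal.antidiagonal m, ∑ y ∈ Finset.HasAntidiagonal.antidiagonal x.2,
      C x.1 (PowerSeries.coeff y.1 F) (PowerSeries.coeff y.2 G)

/-- A star product on `ℝⁿ` quantizing the Poisson structure `P`: bidifferential operators `C_r`
such that `f ⋆ g = f g + ∑_{r ≥ 1} λ^r C_r(f, g)` is associative on `C^∞(ℝⁿ)[[λ]]` and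
`C_1(f, g) - C_1(g, f) = i {f, g}`. -/
structure StarProduct (P : PoissonStructure n) where
  C : ℕ → Smooth n →ₗ[ℂ] Smooth n →ₗ[ℂ] Smooth n
  zero : ∀ f g, C 0 f g = f * g
  bidiff : ∀ r, 1 ≤ r → IsBidiffOp fun f g => C r f g
  assoc : ∀ F G H, formalMul C (formalMul C F G) H = formalMul C F (formalMul C G H)
  bracket : ∀ f g, C 1 f g - C 1 g f = Complex.I • P.bracket f g

/-- The star product `F ⋆ G` of two formal series. -/
def StarProduct.mul {P : PoissonStructure n} (S : StarProduct P)
    (F G : PowerSeries (Smooth n)) : PowerSeries (Smooth n) :=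
  formalMul S.C F G

/-- Complex conjugation on `C^∞(ℝⁿ)[[λ]]`, with `λ` real. -/
def conjFormal : PowerSeries (Smooth n) →+* PowerSeries (Smooth n) :=
  PowerSeries.map (starRingEnd (Smooth n))

/-- `⋆` is Hermitian: the conjugate of `F ⋆ G` is `G̅ ⋆ F̅`. -/
def StarProduct.IsHermitian {P : PoissonStructure n} (S : StarProduct P) : Prop :=
  ∀ F G, conjFormal (S.mul F G) = S.mul (conjFormal G) (conjFormal F)

/-! The formal Weyl algebra -/

variable (n) in
/-- `𝒲₀ = C^∞(ℝⁿ)[[p_1, …, p_n]]`. -/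
abbrev W0 : Type := MvPowerSeries (Fin n) (Smooth n)

variable (n) in
/-- `𝒲 = 𝒲₀[[λ]]`. -/
abbrev W : Type := PowerSeries (W0 n)

/-- The coefficient in `C^∞(ℝⁿ)` of `λ^r p^α`. -/
def wcoeff (r : ℕ) (α : Fin n →₀ ℕ) (a : W n) : Smooth n :=
  MvPowerSeries.coeff α (PowerSeries.coeff r a)

/-- A linear map applied to all coefficients of a series in `λ`. -/
def mapLambda {A B : Type} [CommRing A] [CommRing B] [Algebra ℂ A] [Algebra ℂ B] (D : A →ₗ[ℂ] B) :
    PowerSeries A →ₗ[ℂ] PowerSeries B where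
  toFun a := PowerSeries.mk fun r => D (PowerSeries.coeff r a)
  map_add' a b := by
    ext r
    simp
  map_smul' c a := by
    ext r
    simp

/-- A linear map applied to all coefficients of a series in `p_1, …, p_n`. -/
def mapMomenta (D : Module.End ℂ (Smooth n)) : Module.End ℂ (W0 n) where
  toFun a := fun α => D (MvPowerSeries.coeff α a)
  map_add' a b := funext fun α => map_add D (MvPowerSeries.coeff α a) (MvPowerSeries.coeff α b)
  map_smul' c a := funext fun α => map_smul D c (MvPowerSeries.coeff α a)

/-- The derivation `∂/∂q^i` of `𝒲`, acting on every coefficient. -/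
def wdq (i : Fin n) : Module.End ℂ (W n) :=
  mapLambda (mapMomenta (dq i))

/-- The derivation `∂/∂p_i` of `𝒲`. -/
def wdp (i : Fin n) : Module.End ℂ (W n) :=
  mapLambda ((MvPowerSeries.pderiv (Smooth n) i).toLinearMap.restrictScalars ℂ)

variable (n) in
/-- The operator `∑_k (∂_{q^k} ⊗ ∂_{p_k} - ∂_{p_k} ⊗ ∂_{q^k})` on `𝒲 ⊗ 𝒲`. -/
def poissonOp : Module.End ℂ (W n ⊗[ℂ] W n) :=
  ∑ k : Fin n, (TensorProduct.map (wdq k) (wdp k) - TensorProduct.map (wdp k) (wdq k))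

/-- The formal Weyl-Moyal star product `a ⋆ b = ∑_r (iλ/2)^r / r! μ (poissonOp^r (a ⊗ b))`, where
`μ` is the undeformed product of `𝒲`; only the terms with `r ≤ m` contribute to the coefficient
of `λ^m`. -/
def weylMul (a b : W n) : W n :=
  PowerSeries.mk fun m => ∑ r ∈ Finset.range (m + 1),
    ((Complex.I / 2) ^ r / (r.factorial : ℂ)) •
      PowerSeries.coeff (m - r) (LinearMap.mul' ℂ (W n) ((poissonOp n ^ r) (a ⊗ₜ[ℂ] b)))

/-- Complex conjugation on `𝒲`, with `λ` and the `p_i` real. -/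
def conjW : W n →+* W n :=
  PowerSeries.map (MvPowerSeries.map (starRingEnd (Smooth n)))

/-- The degree map `deg = ∑_i p_i ∂/∂p_i + λ ∂/∂λ` on `𝒲`. -/
def degMap (a : W n) : W n :=
  ∑ i : Fin n, PowerSeries.C (MvPowerSeries.X i : W0 n) * wdp i a +
    PowerSeries.X * PowerSeries.derivative (W0 n) a

variable (n) in
/-- The inclusion `π* : C^∞(ℝⁿ) → 𝒲₀ ⊆ 𝒲` as series that are constant in `p` and `λ`. -/
def piStar : Smooth n →ₗ[ℂ] W n where
  toFun f := PowerSeries.C (MvPowerSeries.C f)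
  map_add' f g := by simp
  map_smul' c f := by
    simp only [Algebra.smul_def, map_mul, MvPowerSeries.algebraMap_apply, RingHom.id_apply]
    rfl

/-! Cochains and formal sums -/

/-- A differential Hochschild `1`-cochain of `C^∞(ℝⁿ)` with values in `𝒲`: every coefficient is a
differential operator. -/
def IsDiffCochain (T : Smooth n →ₗ[ℂ] W n) : Prop :=
  ∀ r α, IsDiffOp fun f => wcoeff r α (T f)

/-- The cochain `T` is homogeneous of degree `k` with respect to `deg`. -/
def IsHomogeneousCochain (k : ℕ) (T : Smooth n →ₗ[ℂ] W n) : Prop :=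
  ∀ f, degMap (T f) = k • T f

/-- The `λ`-linear extension `∑_s λ^s F_s ↦ ∑_s λ^s T(F_s)` of `T` to `C^∞(ℝⁿ)[[λ]]`. -/
def lambdaExt (T : Smooth n →ₗ[ℂ] W n) (F : PowerSeries (Smooth n)) : W n :=
  PowerSeries.mk fun r => ∑ x ∈ Finset.HasAntidiagonal.antidiagonal r,
    PowerSeries.coeff x.2 (T (PowerSeries.coeff x.1 F))

/-- `∑_{k ≥ 0} u_k = a` in `𝒲`: every coefficient of the partial sums is eventually that of `a`. -/
def HasFormalSum (u : ℕ → W n) (a : W n) : Prop :=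
  ∀ r α, ∀ᶠ N in Filter.atTop, wcoeff r α (∑ k ∈ Finset.range N, u k) = wcoeff r α a

/-- `τ` is an injective `ℂ[[λ]]`-linear homomorphism of algebras from `(C^∞(ℝⁿ)[[λ]], ⋆)` to
`𝒲` with the Weyl-Moyal product, of the form `τ = π* + ∑_{k ≥ 1} τ_k` with differential cochains
`τ_k` that are homogeneous of degree `k`. The family `t` consists of `π*` and the `τ_k`. -/
structure IsRealization {P : PoissonStructure n} (S : StarProduct P)
    (t : ℕ → Smooth n →ₗ[ℂ] W n)
    (τ : PowerSeries (Smooth n) →ₗ[PowerSeries ℂ] W n) : Prop where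
  zero : t 0 = piStar n
  cochain : ∀ k, 1 ≤ k → IsDiffCochain (t k)
  homogeneous : ∀ k, 1 ≤ k → IsHomogeneousCochain k (t k)
  sum : ∀ F, HasFormalSum (fun k => lambdaExt (t k) F) (τ F)
  injective : Function.Injective τ
  mul : ∀ F G, τ (S.mul F G) = weylMul (τ F) (τ G)
  unit : ∀ E, (∀ F, S.mul E F = F ∧ S.mul F E = F) → τ E = 1

end FormalStar

end

/-! The cochains are built by induction on the degree. Given `τ_0 = π*, …, τ_{k-1}` multiplicative
up to degree `k - 1`, the failure in degree `k`, computed with `τ_k = 0`, is a Hochschild 2-cocycle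
`R` with values in `𝒲`, on which functions act by Weyl multiplication from both sides
(`obst_cocycle`; this uses associativity of both products). Adding `τ_k` changes it by the
Hochschild differential of `τ_k` (`obst_add`), so what is needed is that `R` is exact, with a
homogeneous differential primitive (`exists_hoch_eq`).

With `p_j` acting as `-iλ ∂_j`, the Weyl algebra acts on functions; `symbolZero (weylMul a (π* g))`
is the result of applying `a` to `g`. On homogeneous elements this action is faithful
(`Homog.eq_zero_of_symbolZero`), and `λ^d D` is realized for every differential operator `D` of
order at most `d`. For cochains with values in differential operators there is a contracting
homotopy: `T f` is the operator `g ↦ R(f, g) 1`. Its order need not be bounded by `k`, so it exists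
in `𝒲` only after multiplication by some `λ^N`, which gives a primitive of `λ^N R`
(`exists_hoch_eq_X_pow_mul`).

The factors `λ` are removed one at a time (`exists_hoch_eq_of_X_mul`). If the differential of `T` is
`λ R`, then `T` modulo `λ` is a derivation and a differential operator, hence `f ↦ ∑ T(q^i) ∂_i f`
(`derivation_eq_sum`). If moreover `R` is symmetric modulo `λ`, the one-form `∑ T(q^i) dp_i` is
closed modulo `λ`; the Poincaré lemma in the `p` variables gives `S` with `∂S/∂p_i = T(q^i)` modulo
`λ`. Adding the inner derivation `(i/λ)[·, S]` to `T` does not change its differential and makes it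
divisible by `λ`. The symmetry holds for the obstruction because the Weyl product is commutative
modulo `λ` (`obst_symm`).

In the Hermitian case the primitive is averaged with its conjugate. Homogeneity makes the sum over
`k` finite in each coefficient; injectivity and the statement on units follow from the lowest
component `π*`. -/

noncomputable section

namespace FormalStar

variable {n : ℕ}

section

/-! Formal sums `∑_r λ^r u_r` -/

section FormalSum

variable {A B V : Type} [CommRing A] [CommRing B] [CommRing V]

/-- The formal sum `∑_r λ^r u_r` of a sequence of power series. -/
def xsum (u : ℕ → PowerSeries A) : PowerSeries A :=
  PowerSeries.mk fun m => ∑ x ∈ Finset.HasAntidiagonal.antidiagonal m,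
    PowerSeries.coeff x.2 (u x.1)

theorem coeff_xsum (u : ℕ → PowerSeries A) (m : ℕ) :
    PowerSeries.coeff m (xsum u) = ∑ x ∈ Finset.HasAntidiagonal.antidiagonal m,
      PowerSeries.coeff x.2 (u x.1) :=
  PowerSeries.coeff_mk _ _

theorem xsum_eq_add (u : ℕ → PowerSeries A) :
    xsum u = u 0 + PowerSeries.X * xsum fun r => u (r + 1) := by
  ext (_ | m)
  · simp [coeff_xsum]
  · rw [map_add, PowerSeries.coeff_succ_X_mul, coeff_xsum, coeff_xsum,
      Finset.Nat.sum_antidiagonal_succ]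

theorem xsum_eq_sum_add (u : ℕ → PowerSeries A) (N : ℕ) :
    xsum u = ∑ r ∈ Finset.range N, PowerSeries.X ^ r * u r +
      PowerSeries.X ^ N * xsum fun r => u (r + N) := by
  induction N with
  | zero => simp
  | succ N ih =>
    rw [ih, Finset.sum_range_succ, xsum_eq_add fun r => u (r + N), pow_succ]
    simp only [zero_add, add_assoc, add_comm 1 N]
    ring

theorem coeff_X_pow_mul_of_lt {m N : ℕ} (h : m < N) (a : PowerSeries A) :
    PowerSeries.coeff m (PowerSeries.X ^ N * a) = 0 := by
  rw [PowerSeries.coeff_X_pow_mul', if_neg (by omega)]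

theorem coeff_xsum_eq_coeff_sum (u : ℕ → PowerSeries A) {m N : ℕ} (h : m < N) :
    PowerSeries.coeff m (xsum u) =
      PowerSeries.coeff m (∑ r ∈ Finset.range N, PowerSeries.X ^ r * u r) := by
  rw [xsum_eq_sum_add u N, map_add, coeff_X_pow_mul_of_lt h, add_zero]

theorem map_X_pow_mul {φ : PowerSeries A →+ PowerSeries B}
    (h : ∀ a, φ (PowerSeries.X * a) = PowerSeries.X * φ a) (r : ℕ) (a : PowerSeries A) :
    φ (PowerSeries.X ^ r * a) = PowerSeries.X ^ r * φ a := by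
  induction r with
  | zero => simp
  | succ r ih => rw [pow_succ', mul_assoc, h, ih, pow_succ', mul_assoc]

/-- Commuting with `λ` already forces `λ`-adic continuity: modulo `λ^(m+1)` the sum is finite, and
its tail is sent to a multiple of `λ^(m+1)`. -/
theorem map_xsum {φ : PowerSeries A →+ PowerSeries B}
    (h : ∀ a, φ (PowerSeries.X * a) = PowerSeries.X * φ a) (u : ℕ → PowerSeries A) :
    φ (xsum u) = xsum fun r => φ (u r) := by
  ext m
  rw [xsum_eq_sum_add u (m + 1), coeff_xsum_eq_coeff_sum _ (Nat.lt_succ_self m), map_add,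
    map_add, map_X_pow_mul h, coeff_X_pow_mul_of_lt (Nat.lt_succ_self m), add_zero, map_sum]
  simp only [map_X_pow_mul h]

theorem xsum_add (u v : ℕ → PowerSeries A) :
    xsum (fun r => u r + v r) = xsum u + xsum v := by
  ext m
  simp [coeff_xsum, Finset.sum_add_distrib]

theorem xsum_smul [Algebra ℂ A] (c : ℂ) (u : ℕ → PowerSeries A) :
    xsum (fun r => c • u r) = c • xsum u := by
  ext m
  simp [coeff_xsum, Finset.smul_sum]

theorem xsum_mul_left (c : PowerSeries A) (u : ℕ → PowerSeries A) :
    xsum (fun r => c * u r) = c * xsum u :=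
  (map_xsum (φ := AddMonoidHom.mulLeft c) (fun a => by simp; ring) u).symm

theorem xsum_zero : xsum (fun _ => (0 : PowerSeries A)) = 0 := by
  ext m
  simp [coeff_xsum]

theorem xsum_eq_of_zero (u : ℕ → PowerSeries A) (h : ∀ r, u (r + 1) = 0) : xsum u = u 0 := by
  rw [xsum_eq_add]
  simp [h, xsum_zero]

theorem xsum_X_mul (u : ℕ → PowerSeries A) :
    xsum (fun r => PowerSeries.X * u r) = PowerSeries.X * xsum u :=
  xsum_mul_left _ _

theorem xsum_xsum (u : ℕ → ℕ → PowerSeries A) :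
    xsum (fun r => xsum (u r)) =
      xsum fun m => ∑ x ∈ Finset.HasAntidiagonal.antidiagonal m, u x.1 x.2 := by
  ext m
  simp only [coeff_xsum, map_sum]
  rw [Finset.sum_sigma', Finset.sum_sigma']
  refine Finset.sum_nbij' (fun x => ⟨(x.1.1 + x.2.1, x.2.2), (x.1.1, x.2.1)⟩)
    (fun x => ⟨(x.2.1, x.2.2 + x.1.2), (x.2.2, x.1.2)⟩) ?_ ?_ ?_ ?_ ?_
  all_goals
    rintro ⟨⟨a, b⟩, ⟨c, d⟩⟩ h
    simp only [Finset.mem_sigma, Finset.HasAntidiagonal.mem_antidiagonal] at h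
    obtain ⟨h1, h2⟩ := h
    simp only [Finset.mem_sigma, Finset.HasAntidiagonal.mem_antidiagonal]
  · exact ⟨by omega, trivial⟩
  · exact ⟨by omega, trivial⟩
  · subst h2; rfl
  · subst h2; rfl

theorem eq_xsum_C (F : PowerSeries A) :
    F = xsum fun r => PowerSeries.C (PowerSeries.coeff r F) := by
  ext m
  rw [coeff_xsum, Finset.sum_eq_single (m, 0)]
  · simp
  · rintro ⟨a, b⟩ h hne
    have hb : b ≠ 0 := by
      rintro rfl
      rw [Finset.HasAntidiagonal.mem_antidiagonal] at h
      exact hne (by simp; omega)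
    simp [PowerSeries.coeff_C, hb]
  · intro h
    simp at h

theorem smul_eq_xsum [Algebra ℂ A] (c : PowerSeries ℂ) (F : PowerSeries A) :
    c • F = xsum fun r => PowerSeries.coeff r c • F := by
  ext m
  rw [coeff_xsum, Algebra.smul_def, PowerSeries.coeff_mul]
  refine Finset.sum_congr rfl fun x _ => ?_
  change PowerSeries.coeff x.1 (PowerSeries.map (algebraMap ℂ A) c) * _ = _
  rw [PowerSeries.coeff_map, PowerSeries.coeff_smul, Algebra.smul_def]

theorem map_smul_of_map_X_mul [Algebra ℂ A] [Algebra ℂ B] {φ : PowerSeries A →ₗ[ℂ] PowerSeries B}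
    (h : ∀ a, φ (PowerSeries.X * a) = PowerSeries.X * φ a) (c : PowerSeries ℂ)
    (F : PowerSeries A) : φ (c • F) = c • φ F := by
  rw [smul_eq_xsum, smul_eq_xsum]
  simp only [← map_smul]
  exact map_xsum (φ := φ.toAddMonoidHom) h _

/-- Two maps that are additive and `λ`-linear in both arguments agree if they agree on
constant series. -/
theorem bilin_ext {β γ : PowerSeries A → PowerSeries B → PowerSeries V}
    (hβ₁ : ∀ a b c, β (a + b) c = β a c + β b c) (hβ₂ : ∀ a b c, β a (b + c) = β a b + β a c)
    (hγ₁ : ∀ a b c, γ (a + b) c = γ a c + γ b c) (hγ₂ : ∀ a b c, γ a (b + c) = γ a b + γ a c)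
    (hXβ₁ : ∀ a b, β (PowerSeries.X * a) b = PowerSeries.X * β a b)
    (hXβ₂ : ∀ a b, β a (PowerSeries.X * b) = PowerSeries.X * β a b)
    (hXγ₁ : ∀ a b, γ (PowerSeries.X * a) b = PowerSeries.X * γ a b)
    (hXγ₂ : ∀ a b, γ a (PowerSeries.X * b) = PowerSeries.X * γ a b)
    (h : ∀ f g, β (PowerSeries.C f) (PowerSeries.C g) = γ (PowerSeries.C f) (PowerSeries.C g))
    (F : PowerSeries A) (G : PowerSeries B) : β F G = γ F G := by
  have key : ∀ f G, β (PowerSeries.C f) G = γ (PowerSeries.C f) G := fun f G => by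
    have e1 := map_xsum (φ := AddMonoidHom.mk' (β (PowerSeries.C f)) (hβ₂ _)) (hXβ₂ _)
      fun r => PowerSeries.C (PowerSeries.coeff r G)
    have e2 := map_xsum (φ := AddMonoidHom.mk' (γ (PowerSeries.C f)) (hγ₂ _)) (hXγ₂ _)
      fun r => PowerSeries.C (PowerSeries.coeff r G)
    rw [← eq_xsum_C] at e1 e2
    simp only [AddMonoidHom.mk'_apply] at e1 e2
    rw [e1, e2]
    simp only [h]
  have e1 := map_xsum (φ := AddMonoidHom.mk' (fun F => β F G) fun a b => hβ₁ a b G)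
    (fun a => hXβ₁ a G) fun r => PowerSeries.C (PowerSeries.coeff r F)
  have e2 := map_xsum (φ := AddMonoidHom.mk' (fun F => γ F G) fun a b => hγ₁ a b G)
    (fun a => hXγ₁ a G) fun r => PowerSeries.C (PowerSeries.coeff r F)
  rw [← eq_xsum_C] at e1 e2
  simp only [AddMonoidHom.mk'_apply] at e1 e2
  rw [e1, e2]
  simp only [key]

end FormalSum

/-! Coefficients and derivations of `𝒲` -/

theorem coeff_mapLambda {A B : Type} [CommRing A] [CommRing B] [Algebra ℂ A] [Algebra ℂ B]
    (D : A →ₗ[ℂ] B) (r : ℕ) (a : PowerSeries A) :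
    PowerSeries.coeff r (mapLambda D a) = D (PowerSeries.coeff r a) := by
  simp [mapLambda]

theorem wcoeff_ext {a b : W n} (h : ∀ r α, wcoeff r α a = wcoeff r α b) : a = b :=
  PowerSeries.ext fun r => MvPowerSeries.ext fun α => h r α

@[simp] theorem wcoeff_add (r : ℕ) (α : Fin n →₀ ℕ) (a b : W n) :
    wcoeff r α (a + b) = wcoeff r α a + wcoeff r α b := by
  simp [wcoeff]

@[simp] theorem wcoeff_sub (r : ℕ) (α : Fin n →₀ ℕ) (a b : W n) :
    wcoeff r α (a - b) = wcoeff r α a - wcoeff r α b := by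
  simp [wcoeff]

@[simp] theorem wcoeff_neg (r : ℕ) (α : Fin n →₀ ℕ) (a : W n) :
    wcoeff r α (-a) = -wcoeff r α a := by
  simp [wcoeff]

@[simp] theorem wcoeff_zero (r : ℕ) (α : Fin n →₀ ℕ) : wcoeff r α (0 : W n) = 0 := by
  simp [wcoeff]

@[simp] theorem wcoeff_smul (r : ℕ) (α : Fin n →₀ ℕ) (c : ℂ) (a : W n) :
    wcoeff r α (c • a) = c • wcoeff r α a := by
  simp [wcoeff]

theorem wcoeff_sum {ι : Type*} (r : ℕ) (α : Fin n →₀ ℕ) (s : Finset ι) (a : ι → W n) :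
    wcoeff r α (∑ i ∈ s, a i) = ∑ i ∈ s, wcoeff r α (a i) := by
  simp [wcoeff]

theorem wcoeff_mul (r : ℕ) (α : Fin n →₀ ℕ) (a b : W n) :
    wcoeff r α (a * b) = ∑ x ∈ Finset.HasAntidiagonal.antidiagonal r,
      ∑ y ∈ Finset.HasAntidiagonal.antidiagonal α, wcoeff x.1 y.1 a * wcoeff x.2 y.2 b := by
  classical
  simp only [wcoeff, PowerSeries.coeff_mul, map_sum, MvPowerSeries.coeff_mul]

theorem wcoeff_xsum (r : ℕ) (α : Fin n →₀ ℕ) (u : ℕ → W n) :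
    wcoeff r α (xsum u) = ∑ x ∈ Finset.HasAntidiagonal.antidiagonal r, wcoeff x.2 α (u x.1) := by
  simp only [wcoeff, coeff_xsum, map_sum]

theorem wcoeff_zero_X_mul (α : Fin n →₀ ℕ) (a : W n) :
    wcoeff 0 α (PowerSeries.X * a) = 0 := by
  simp [wcoeff]

theorem wcoeff_succ_X_mul (r : ℕ) (α : Fin n →₀ ℕ) (a : W n) :
    wcoeff (r + 1) α (PowerSeries.X * a) = wcoeff r α a := by
  simp [wcoeff]

theorem wcoeff_X_pow_mul (r k : ℕ) (α : Fin n →₀ ℕ) (a : W n) :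
    wcoeff r α (PowerSeries.X ^ k * a) = if k ≤ r then wcoeff (r - k) α a else 0 := by
  rw [wcoeff, PowerSeries.coeff_X_pow_mul']
  split_ifs <;> simp [wcoeff]

theorem wcoeff_piStar (r : ℕ) (α : Fin n →₀ ℕ) (f : Smooth n) :
    wcoeff r α (piStar n f) = if r = 0 ∧ α = 0 then f else 0 := by
  classical
  change MvPowerSeries.coeff α (PowerSeries.coeff r (PowerSeries.C (MvPowerSeries.C f))) = _
  rw [PowerSeries.coeff_C]
  by_cases h : r = 0 <;> simp [h, MvPowerSeries.coeff_C]

theorem wcoeff_wdq (r : ℕ) (α : Fin n →₀ ℕ) (i : Fin n) (a : W n) :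
    wcoeff r α (wdq i a) = dq i (wcoeff r α a) := by
  have h : PowerSeries.coeff r (wdq i a) = mapMomenta (dq i) (PowerSeries.coeff r a) :=
    coeff_mapLambda _ _ _
  rw [wcoeff, h]
  rfl

theorem wcoeff_wdp (r : ℕ) (α : Fin n →₀ ℕ) (i : Fin n) (a : W n) :
    wcoeff r α (wdp i a) = wcoeff r (α + Finsupp.single i 1) a * (α i + 1) := by
  have h : PowerSeries.coeff r (wdp i a) =
      MvPowerSeries.pderiv (Smooth n) i (PowerSeries.coeff r a) :=
    coeff_mapLambda _ _ _
  rw [wcoeff, h]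
  exact MvPowerSeries.coeff_pderiv _ _

/-- The variable `p_i` of `𝒲`. -/
def wp (i : Fin n) : W n := PowerSeries.C (MvPowerSeries.X i : W0 n)

theorem dq_mul (i : Fin n) (f g : Smooth n) : dq i (f * g) = dq i f * g + f * dq i g := by
  refine Smooth.ext fun x => ?_
  have hf := (f.contDiff.differentiable (by simp)) x
  have hg := (g.contDiff.differentiable (by simp)) x
  change fderiv ℝ (fun y => f.toFun y * g.toFun y) x (Pi.single i 1) =
    fderiv ℝ f.toFun x (Pi.single i 1) * g.toFun x + f.toFun x * fderiv ℝ g.toFun x (Pi.single i 1)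
  rw [fderiv_fun_mul hf hg]
  simp
  ring

theorem dq_comm (i j : Fin n) (f : Smooth n) : dq i (dq j f) = dq j (dq i f) := by
  refine Smooth.ext fun x => ?_
  have h2 : ContDiff ℝ 2 f.toFun := contDiff_infty.1 f.contDiff 2
  have hd : DifferentiableAt ℝ (fderiv ℝ f.toFun) x :=
    ((h2.fderiv_right (m := 1) (by norm_num)).differentiable (by norm_num)) x
  have key : ∀ v w : Fin n → ℝ, fderiv ℝ (fun y => fderiv ℝ f.toFun y v) x w =
      fderiv ℝ (fderiv ℝ f.toFun) x w v := fun v w => by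
    rw [fderiv_clm_apply hd (differentiableAt_const v)]
    simp
  have hs := (h2.contDiffAt (x := x)).isSymmSndFDerivAt (by simp)
  change fderiv ℝ (fun y => fderiv ℝ f.toFun y (Pi.single j 1)) x (Pi.single i 1) =
    fderiv ℝ (fun y => fderiv ℝ f.toFun y (Pi.single i 1)) x (Pi.single j 1)
  rw [key, key]
  exact hs _ _

theorem dq_star (i : Fin n) (f : Smooth n) : dq i (star f) = star (dq i f) := by
  refine Smooth.ext fun x => ?_
  have hf := (f.contDiff.differentiable (by simp)) x
  change fderiv ℝ (fun y => Complex.conjCLE (f.toFun y)) x (Pi.single i 1) =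
    Complex.conjCLE (fderiv ℝ f.toFun x (Pi.single i 1))
  have := (Complex.conjCLE.toContinuousLinearMap.hasFDerivAt.comp x hf.hasFDerivAt).fderiv
  exact congrArg (fun L => L (Pi.single i 1)) this

theorem mapLambda_mul {A : Type} [CommRing A] [Algebra ℂ A] {D : A →ₗ[ℂ] A}
    (h : ∀ a b, D (a * b) = D a * b + a * D b) (a b : PowerSeries A) :
    mapLambda D (a * b) = mapLambda D a * b + a * mapLambda D b := by
  ext r
  simp only [mapLambda, LinearMap.coe_mk, AddHom.coe_mk, PowerSeries.coeff_mk, map_add,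
    PowerSeries.coeff_mul, map_sum, h, Finset.sum_add_distrib]

theorem mapMomenta_mul (i : Fin n) (a b : W0 n) :
    mapMomenta (dq i) (a * b) = mapMomenta (dq i) a * b + a * mapMomenta (dq i) b := by
  classical
  ext α
  change dq i (MvPowerSeries.coeff α (a * b)) = _
  simp only [map_add, MvPowerSeries.coeff_mul, map_sum, dq_mul, Finset.sum_add_distrib]
  rfl

theorem wdq_mul (i : Fin n) (a b : W n) : wdq i (a * b) = wdq i a * b + a * wdq i b :=
  mapLambda_mul (mapMomenta_mul i) a b

theorem wdp_mul (i : Fin n) (a b : W n) : wdp i (a * b) = wdp i a * b + a * wdp i b :=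
  mapLambda_mul (fun a b => by
    change MvPowerSeries.pderiv (Smooth n) i (a * b) = MvPowerSeries.pderiv (Smooth n) i a * b +
      a * MvPowerSeries.pderiv (Smooth n) i b
    rw [Derivation.leibniz, smul_eq_mul, smul_eq_mul]
    ring) a b

theorem mapLambda_X_mul {A B : Type} [CommRing A] [CommRing B] [Algebra ℂ A] [Algebra ℂ B]
    (D : A →ₗ[ℂ] B) (a : PowerSeries A) :
    mapLambda D (PowerSeries.X * a) = PowerSeries.X * mapLambda D a := by
  ext (_ | r) <;> simp [mapLambda]

theorem wdq_X_mul (i : Fin n) (a : W n) : wdq i (PowerSeries.X * a) = PowerSeries.X * wdq i a :=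
  mapLambda_X_mul _ a

theorem wdp_X_mul (i : Fin n) (a : W n) : wdp i (PowerSeries.X * a) = PowerSeries.X * wdp i a :=
  mapLambda_X_mul _ a

theorem wdq_wdq (i j : Fin n) (a : W n) : wdq i (wdq j a) = wdq j (wdq i a) :=
  wcoeff_ext fun r α => by simp only [wcoeff_wdq, dq_comm i j]

theorem dq_mul_natCast (i : Fin n) (f : Smooth n) (k : ℕ) :
    dq i (f * (k + 1)) = dq i f * (k + 1) := by
  have h : f * ((k : Smooth n) + 1) = ((k : ℂ) + 1) • f := by
    rw [Algebra.smul_def, mul_comm]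
    simp
  rw [h, map_smul, Algebra.smul_def, mul_comm]
  simp

theorem wdq_wdp (i j : Fin n) (a : W n) : wdq i (wdp j a) = wdp j (wdq i a) :=
  wcoeff_ext fun r α => by simp only [wcoeff_wdq, wcoeff_wdp, dq_mul_natCast]

theorem wdp_wdp (i j : Fin n) (a : W n) : wdp i (wdp j a) = wdp j (wdp i a) :=
  wcoeff_ext fun r α => by
    by_cases h : i = j
    · rw [h]
    · simp only [wcoeff_wdp, Finsupp.add_apply, Finsupp.single_eq_of_ne h,
        Finsupp.single_eq_of_ne (Ne.symm h), add_zero]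
      rw [add_right_comm α (Finsupp.single i 1)]
      ring

theorem wdq_piStar (i : Fin n) (f : Smooth n) : wdq i (piStar n f) = piStar n (dq i f) :=
  wcoeff_ext fun r α => by
    rw [wcoeff_wdq, wcoeff_piStar, wcoeff_piStar]
    split_ifs <;> simp

theorem wdp_piStar (i : Fin n) (f : Smooth n) : wdp i (piStar n f) = 0 :=
  wcoeff_ext fun r α => by
    rw [wcoeff_wdp, wcoeff_piStar, if_neg, zero_mul, wcoeff_zero]
    rintro ⟨_, h⟩
    have := congrArg (fun β => β i) h
    simp at this

theorem piStar_mul (f g : Smooth n) : piStar n (f * g) = piStar n f * piStar n g := by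
  simp [piStar]

theorem piStar_one : piStar n 1 = 1 := by
  simp [piStar]

theorem dq_one (i : Fin n) : dq i (1 : Smooth n) = 0 := by
  have h := dq_mul i (1 : Smooth n) 1
  simpa using h

theorem wdq_wp (i j : Fin n) : wdq i (wp j : W n) = 0 := by
  classical
  refine wcoeff_ext fun r α => ?_
  rw [wcoeff_wdq, wp, wcoeff, PowerSeries.coeff_C, wcoeff_zero]
  split_ifs
  · rw [MvPowerSeries.coeff_X]
    split_ifs
    · exact dq_one i
    · exact map_zero _
  · simp

theorem wdp_wp (i j : Fin n) : wdp i (wp j : W n) = if i = j then 1 else 0 := by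
  classical
  have h : wdp i (wp j : W n) = PowerSeries.C (MvPowerSeries.pderiv (Smooth n) i
      (MvPowerSeries.X j)) := by
    ext1 r
    have h : PowerSeries.coeff r (wdp i (wp j)) =
        MvPowerSeries.pderiv (Smooth n) i (PowerSeries.coeff r (wp j : W n)) :=
      coeff_mapLambda _ _ _
    rw [h, wp, PowerSeries.coeff_C, PowerSeries.coeff_C]
    split_ifs <;> simp
  rw [h]
  by_cases hij : i = j
  · subst hij
    simp
  · rw [MvPowerSeries.pderiv_X_of_ne (Ne.symm hij)]
    simp [hij]

end

/-! The Weyl-Moyal product -/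

/-- The bilinear map `(a, b) ↦ μ (P^r (a ⊗ b))` on `𝒲`, where `P` is the operator `poissonOp`. -/
def bd : ℕ → W n →ₗ[ℂ] W n →ₗ[ℂ] W n
  | 0 => LinearMap.mul ℂ (W n)
  | r + 1 => ∑ k : Fin n,
      ((bd r).compl₁₂ (wdq k) (wdp k) - (bd r).compl₁₂ (wdp k) (wdq k))

theorem bd_zero (a b : W n) : bd 0 a b = a * b := rfl

theorem bd_succ (r : ℕ) (a b : W n) :
    bd (r + 1) a b = ∑ k : Fin n, (bd r (wdq k a) (wdp k b) - bd r (wdp k a) (wdq k b)) := by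
  simp [bd, LinearMap.sum_apply]

theorem mul'_poissonOp_pow (r : ℕ) (a b : W n) :
    LinearMap.mul' ℂ (W n) ((poissonOp n ^ r) (a ⊗ₜ[ℂ] b)) = bd r a b := by
  induction r generalizing a b with
  | zero => simp [bd_zero]
  | succ r ih =>
    rw [pow_succ, Module.End.mul_apply, poissonOp, LinearMap.sum_apply, ← poissonOp, map_sum,
      map_sum, bd_succ]
    refine Finset.sum_congr rfl fun k _ => ?_
    rw [LinearMap.sub_apply, TensorProduct.map_tmul, TensorProduct.map_tmul, map_sub, map_sub,
      ih, ih]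

theorem bd_X_mul_left (r : ℕ) (a b : W n) :
    bd r (PowerSeries.X * a) b = PowerSeries.X * bd r a b := by
  induction r generalizing a b with
  | zero => simp only [bd_zero, mul_assoc]
  | succ r ih => simp only [bd_succ, wdq_X_mul, wdp_X_mul, ih, Finset.mul_sum, mul_sub]

theorem bd_X_mul_right (r : ℕ) (a b : W n) :
    bd r a (PowerSeries.X * b) = PowerSeries.X * bd r a b := by
  induction r generalizing a b with
  | zero => simp only [bd_zero, mul_left_comm]
  | succ r ih => simp only [bd_succ, wdq_X_mul, wdp_X_mul, ih, Finset.mul_sum, mul_sub]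

/-- Linear maps that are derivations of the undeformed product and commute with all `∂/∂q^k` and
`∂/∂p_k` are derivations of all the maps `bd r`. -/
theorem map_bd {D : W n →ₗ[ℂ] W n} (hD : ∀ a b, D (a * b) = D a * b + a * D b)
    (hq : ∀ k a, D (wdq k a) = wdq k (D a)) (hp : ∀ k a, D (wdp k a) = wdp k (D a))
    (r : ℕ) (a b : W n) : D (bd r a b) = bd r (D a) b + bd r a (D b) := by
  induction r generalizing a b with
  | zero => simp only [bd_zero, hD]
  | succ r ih =>
    simp only [bd_succ, map_sum, map_sub, ih, hq, hp]
    rw [← Finset.sum_add_distrib]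
    exact Finset.sum_congr rfl fun k _ => by abel

theorem wdq_bd (i : Fin n) (r : ℕ) (a b : W n) :
    wdq i (bd r a b) = bd r (wdq i a) b + bd r a (wdq i b) :=
  map_bd (wdq_mul i) (fun k a => wdq_wdq i k a) (fun k a => wdq_wdp i k a) r a b

theorem wdp_bd (i : Fin n) (r : ℕ) (a b : W n) :
    wdp i (bd r a b) = bd r (wdp i a) b + bd r a (wdp i b) :=
  map_bd (wdp_mul i) (fun k a => (wdq_wdp k i a).symm) (fun k a => wdp_wdp i k a) r a b

/-- The `m`-th power of the sum of the three operators `poissonOp` acting on two of three tensor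
factors, followed by the undeformed product. -/
def tri : ℕ → W n → W n → W n → W n
  | 0, a, b, c => a * b * c
  | m + 1, a, b, c => ∑ k : Fin n,
      ((tri m (wdq k a) (wdp k b) c - tri m (wdp k a) (wdq k b) c) +
        (tri m (wdq k a) b (wdp k c) - tri m (wdp k a) b (wdq k c)) +
        (tri m a (wdq k b) (wdp k c) - tri m a (wdp k b) (wdq k c)))

/-- Binomial theorem: since the partial derivatives are derivations of every `bd s`, the outer
operator acts as `P₁₃ + P₂₃`, which commutes with the inner `P₁₂`; the total is the `m`-th power of
`P₁₂ + P₁₃ + P₂₃`. -/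
theorem sum_choose_bd_bd_left (m : ℕ) (a b c : W n) :
    ∑ x ∈ Finset.HasAntidiagonal.antidiagonal m, m.choose x.1 • bd x.1 (bd x.2 a b) c =
      tri m a b c := by
  induction m generalizing a b c with
  | zero => simp [tri, bd_zero]
  | succ m ih =>
    rw [Finset.sum_antidiagonal_choose_succ_nsmul fun r s => bd r (bd s a b) c,
      ← Finset.sum_add_distrib, tri]
    simp only [← ih]
    simp only [← Finset.sum_add_distrib, ← Finset.sum_sub_distrib]
    rw [Finset.sum_comm]
    refine Finset.sum_congr rfl fun x hx => ?_
    rw [Finset.HasAntidiagonal.mem_antidiagonal] at hx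
    -- The two sums from Pascal's rule carry the weights `m.choose x.1` and `m.choose x.2`, which
    -- agree on the antidiagonal.
    rw [Nat.choose_symm_of_eq_add hx.symm, ← smul_add]
    simp only [← smul_add, ← smul_sub, ← Finset.smul_sum]
    congr 1
    simp only [bd_succ, map_sum, map_sub, LinearMap.sum_apply, LinearMap.sub_apply, wdq_bd,
      wdp_bd, map_add, LinearMap.add_apply]
    rw [← Finset.sum_add_distrib]
    exact Finset.sum_congr rfl fun k _ => by abel

theorem sum_choose_bd_bd_right (m : ℕ) (a b c : W n) :
    ∑ x ∈ Finset.HasAntidiagonal.antidiagonal m, m.choose x.1 • bd x.1 a (bd x.2 b c) =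
      tri m a b c := by
  induction m generalizing a b c with
  | zero => simp [tri, bd_zero, mul_assoc]
  | succ m ih =>
    rw [Finset.sum_antidiagonal_choose_succ_nsmul fun r s => bd r a (bd s b c),
      ← Finset.sum_add_distrib, tri]
    simp only [← ih]
    simp only [← Finset.sum_add_distrib, ← Finset.sum_sub_distrib]
    rw [Finset.sum_comm]
    refine Finset.sum_congr rfl fun x hx => ?_
    rw [Finset.HasAntidiagonal.mem_antidiagonal] at hx
    rw [Nat.choose_symm_of_eq_add hx.symm, ← smul_add]
    simp only [← smul_add, ← smul_sub, ← Finset.smul_sum]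
    congr 1
    simp only [bd_succ, map_sum, map_sub, wdq_bd, wdp_bd, map_add]
    rw [← Finset.sum_add_distrib]
    exact Finset.sum_congr rfl fun k _ => by abel

/-- The coefficients `(i/2)^r / r!` of the Weyl-Moyal product. -/
def weylConst (r : ℕ) : ℂ := (Complex.I / 2) ^ r / (r.factorial : ℂ)

theorem weylConst_zero : weylConst 0 = 1 := by simp [weylConst]

theorem weylConst_one : weylConst 1 = Complex.I / 2 := by simp [weylConst]

/-- The coefficients are those of an exponential; this supplies the binomial weights for
associativity. -/
theorem weylConst_mul {r s m : ℕ} (h : r + s = m) :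
    weylConst r * weylConst s = weylConst m * m.choose r := by
  subst h
  have h := Nat.add_choose_mul_factorial_mul_factorial r s
  rw [← Nat.choose_symm_add] at h
  have h' : ((r + s).choose r : ℂ) * r.factorial * s.factorial = (r + s).factorial := by
    exact_mod_cast h
  have hr : (r.factorial : ℂ) ≠ 0 := by exact_mod_cast r.factorial_ne_zero
  have hs : (s.factorial : ℂ) ≠ 0 := by exact_mod_cast s.factorial_ne_zero
  have hrs : ((r + s).factorial : ℂ) ≠ 0 := by exact_mod_cast (r + s).factorial_ne_zero
  rw [weylConst, weylConst, weylConst, pow_add]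
  field_simp
  rw [← h']
  ring

theorem weylMul_eq_xsum (a b : W n) : weylMul a b = xsum fun r => weylConst r • bd r a b := by
  ext1 m
  rw [coeff_xsum, weylMul, PowerSeries.coeff_mk, Finset.Nat.sum_antidiagonal_eq_sum_range_succ
    fun r s => PowerSeries.coeff s (weylConst r • bd r a b)]
  refine Finset.sum_congr rfl fun r _ => ?_
  rw [mul'_poissonOp_pow, PowerSeries.coeff_smul]
  rfl

theorem add_weylMul (a b c : W n) : weylMul (a + b) c = weylMul a c + weylMul b c := by
  simp only [weylMul_eq_xsum, map_add, LinearMap.add_apply, smul_add, xsum_add]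

theorem weylMul_add (a b c : W n) : weylMul a (b + c) = weylMul a b + weylMul a c := by
  simp only [weylMul_eq_xsum, map_add, smul_add, xsum_add]

theorem smul_weylMul (c : ℂ) (a b : W n) : weylMul (c • a) b = c • weylMul a b := by
  simp only [weylMul_eq_xsum, map_smul, LinearMap.smul_apply, ← xsum_smul, smul_comm c]

theorem weylMul_smul (c : ℂ) (a b : W n) : weylMul a (c • b) = c • weylMul a b := by
  simp only [weylMul_eq_xsum, map_smul, ← xsum_smul, smul_comm c]

theorem X_mul_weylMul (a b : W n) :
    weylMul (PowerSeries.X * a) b = PowerSeries.X * weylMul a b := by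
  simp only [weylMul_eq_xsum, bd_X_mul_left, ← mul_smul_comm, xsum_X_mul]

theorem weylMul_X_mul (a b : W n) :
    weylMul a (PowerSeries.X * b) = PowerSeries.X * weylMul a b := by
  simp only [weylMul_eq_xsum, bd_X_mul_right, ← mul_smul_comm, xsum_X_mul]

/-- Both bracketings are `exp((iλ/2)(P₁₂ + P₁₃ + P₂₃))` followed by the undeformed product, compared
here order by order through `tri`. -/
theorem weylMul_assoc (a b c : W n) :
    weylMul (weylMul a b) c = weylMul a (weylMul b c) := by
  have hl : ∀ r, bd r (weylMul a b) c = xsum fun s => weylConst s • bd r (bd s a b) c :=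
    fun r => by
      rw [weylMul_eq_xsum]
      refine (map_xsum (φ := ((bd r).flip c).toAddMonoidHom)
        (fun x => bd_X_mul_left r x c) _).trans ?_
      simp
  have hr : ∀ r, bd r a (weylMul b c) = xsum fun s => weylConst s • bd r a (bd s b c) :=
    fun r => by
      rw [weylMul_eq_xsum]
      refine (map_xsum (φ := (bd r a).toAddMonoidHom)
        (fun x => bd_X_mul_right r a x) _).trans ?_
      simp
  rw [weylMul_eq_xsum (weylMul a b), weylMul_eq_xsum a (weylMul b c)]
  simp only [hl, hr, ← xsum_smul, smul_smul]
  rw [xsum_xsum, xsum_xsum]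
  congr 1
  funext m
  trans weylConst m • tri m a b c
  · rw [← sum_choose_bd_bd_left, Finset.smul_sum]
    refine Finset.sum_congr rfl fun x hx => ?_
    rw [weylConst_mul (Finset.HasAntidiagonal.mem_antidiagonal.1 hx), mul_smul, Nat.cast_smul_eq_nsmul]
  · rw [← sum_choose_bd_bd_right, Finset.smul_sum]
    refine Finset.sum_congr rfl fun x hx => ?_
    rw [weylConst_mul (Finset.HasAntidiagonal.mem_antidiagonal.1 hx), mul_smul, Nat.cast_smul_eq_nsmul]

/-! ### Weyl-Moyal products whose expansion terminates, and commutators -/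

theorem weylMul_eq_of_bd_succ {a b : W n} (h : ∀ r, bd (r + 1) a b = 0) : weylMul a b = a * b := by
  rw [weylMul_eq_xsum, xsum_eq_of_zero _ fun r => by rw [h, smul_zero], weylConst_zero, one_smul,
    bd_zero]

theorem bd_piStar_piStar (r : ℕ) (f g : Smooth n) : bd (r + 1) (piStar n f) (piStar n g) = 0 := by
  rw [bd_succ]
  refine Finset.sum_eq_zero fun k _ => ?_
  rw [wdp_piStar, wdp_piStar, map_zero, map_zero, LinearMap.zero_apply, sub_zero]

theorem wdq_one (i : Fin n) : wdq i (1 : W n) = 0 := by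
  rw [← piStar_one, wdq_piStar, dq_one, map_zero]

theorem wdp_one (i : Fin n) : wdp i (1 : W n) = 0 := by
  rw [← piStar_one, wdp_piStar]

theorem bd_one_left (r : ℕ) (a : W n) : bd (r + 1) 1 a = 0 := by
  simp [bd_succ, wdq_one, wdp_one]

theorem bd_one_right (r : ℕ) (a : W n) : bd (r + 1) a 1 = 0 := by
  simp [bd_succ, wdq_one, wdp_one]

theorem piStar_weylMul_piStar (f g : Smooth n) :
    weylMul (piStar n f) (piStar n g) = piStar n (f * g) := by
  rw [weylMul_eq_of_bd_succ fun r => bd_piStar_piStar r f g, piStar_mul]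

theorem one_weylMul (a : W n) : weylMul 1 a = a := by
  rw [weylMul_eq_of_bd_succ fun r => bd_one_left r a, one_mul]

theorem weylMul_one (a : W n) : weylMul a 1 = a := by
  rw [weylMul_eq_of_bd_succ fun r => bd_one_right r a, mul_one]

theorem weylMul_eq_of_bd_succ_succ {a b : W n} (h : ∀ r, bd (r + 2) a b = 0) :
    weylMul a b = a * b + PowerSeries.X * ((Complex.I / 2) • bd 1 a b) := by
  rw [weylMul_eq_xsum, xsum_eq_add, xsum_eq_of_zero _ fun r => by rw [h, smul_zero],
    weylConst_zero, one_smul, bd_zero, zero_add, weylConst_one]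

theorem bd_one_wp (a : W n) (j : Fin n) : bd 1 a (wp j) = wdq j a := by
  classical
  rw [bd_succ, Finset.sum_eq_single j]
  · simp [wdp_wp, wdq_wp, bd_zero]
  · intro k _ hk
    simp [wdp_wp, wdq_wp, hk]
  · simp

theorem bd_wp (r : ℕ) (a : W n) (j : Fin n) : bd (r + 2) a (wp j) = 0 := by
  rw [bd_succ]
  refine Finset.sum_eq_zero fun k _ => ?_
  rw [wdp_wp, wdq_wp]
  split_ifs <;> simp [bd_one_right]

theorem weylMul_wp (a : W n) (j : Fin n) :
    weylMul a (wp j) = a * wp j + PowerSeries.X * ((Complex.I / 2) • wdq j a) := by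
  rw [weylMul_eq_of_bd_succ_succ fun r => bd_wp r a j, bd_one_wp]

theorem bd_swap (r : ℕ) (a b : W n) : bd r b a = (-1 : ℂ) ^ r • bd r a b := by
  induction r generalizing a b with
  | zero => simp [bd_zero, mul_comm]
  | succ r ih =>
    rw [bd_succ, bd_succ, Finset.smul_sum]
    refine Finset.sum_congr rfl fun k _ => ?_
    rw [ih (wdp k a), ih (wdq k a), pow_succ, mul_smul, neg_smul, one_smul, ← smul_sub, neg_sub]

theorem weylMul_swap_eq (a b : W n) :
    weylMul b a = xsum fun r => ((-1) ^ r * weylConst r) • bd r a b := by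
  rw [weylMul_eq_xsum]
  congr 1
  funext r
  rw [bd_swap, smul_smul, mul_comm]

theorem weylMul_sub_swap_eq (a b : W n) (h : ∀ r, bd (r + 2) a b = 0) :
    weylMul a b - weylMul b a = PowerSeries.X * (Complex.I • bd 1 a b) := by
  rw [weylMul_eq_of_bd_succ_succ h, weylMul_eq_of_bd_succ_succ fun r => by rw [bd_swap, h, smul_zero],
    bd_swap 1 a b, mul_comm b a, pow_one, add_sub_add_left_eq_sub, ← mul_sub, ← smul_sub, neg_smul,
    one_smul, sub_neg_eq_add, smul_add, ← add_smul, add_halves]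

/-! Conjugation -/

theorem wcoeff_conjW (r : ℕ) (α : Fin n →₀ ℕ) (a : W n) :
    wcoeff r α (conjW a) = star (wcoeff r α a) := by
  simp only [wcoeff, conjW, PowerSeries.coeff_map, MvPowerSeries.coeff_map]
  rfl

theorem star_smul_smooth (c : ℂ) (f : Smooth n) : star (c • f) = star c • star f := by
  refine Smooth.ext fun x => ?_
  change star (c * f.toFun x) = star c * star (f.toFun x)
  rw [star_mul, mul_comm]

theorem conjW_smul (c : ℂ) (a : W n) : conjW (c • a) = star c • conjW a :=
  wcoeff_ext fun r α => by
    rw [wcoeff_conjW, wcoeff_smul, wcoeff_smul, wcoeff_conjW, star_smul_smooth]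

theorem conjW_X : conjW (PowerSeries.X : W n) = PowerSeries.X := by
  simp [conjW]

theorem conjW_wdq (i : Fin n) (a : W n) : conjW (wdq i a) = wdq i (conjW a) :=
  wcoeff_ext fun r α => by
    rw [wcoeff_conjW, wcoeff_wdq, wcoeff_wdq, wcoeff_conjW, dq_star]

theorem conjW_wdp (i : Fin n) (a : W n) : conjW (wdp i a) = wdp i (conjW a) :=
  wcoeff_ext fun r α => by
    rw [wcoeff_conjW, wcoeff_wdp, wcoeff_wdp, wcoeff_conjW, star_mul, mul_comm]
    simp

theorem conjW_conjW (a : W n) : conjW (conjW a) = a :=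
  wcoeff_ext fun r α => by rw [wcoeff_conjW, wcoeff_conjW, star_star]

theorem conjW_piStar (f : Smooth n) : conjW (piStar n f) = piStar n (star f) :=
  wcoeff_ext fun r α => by
    rw [wcoeff_conjW, wcoeff_piStar, wcoeff_piStar]
    split_ifs <;> simp

theorem conjW_bd (r : ℕ) (a b : W n) : conjW (bd r a b) = bd r (conjW a) (conjW b) := by
  induction r generalizing a b with
  | zero => simp [bd_zero]
  | succ r ih => simp only [bd_succ, map_sum, map_sub, ih, conjW_wdq, conjW_wdp]

theorem star_weylConst (r : ℕ) : star (weylConst r) = (-1) ^ r * weylConst r := by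
  simp only [weylConst, Complex.star_def, map_div₀, map_pow, Complex.conj_I, Complex.conj_ofNat,
    Complex.conj_natCast]
  rw [neg_div, neg_pow]
  ring

/-- Conjugating `(i/2)^r` gives the sign `(-1)^r`, exactly the sign that the antisymmetric `P^r`
picks up when its arguments are exchanged. -/
theorem conjW_weylMul (a b : W n) : conjW (weylMul a b) = weylMul (conjW b) (conjW a) := by
  rw [weylMul_swap_eq (conjW a), weylMul_eq_xsum a]
  refine (map_xsum (φ := (conjW : W n →+* W n).toAddMonoidHom) (fun x => ?_) _).trans ?_
  · change conjW (PowerSeries.X * x) = PowerSeries.X * conjW x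
    rw [map_mul, conjW_X]
  · congr 1
    funext r
    change conjW _ = _
    rw [conjW_smul, conjW_bd, star_weylConst]

/-! The ring structure -/

variable (n) in
/-- The formal Weyl algebra: `𝒲` with the Weyl-Moyal product. -/
def Weyl : Type := W n

instance : AddCommGroup (Weyl n) := inferInstanceAs (AddCommGroup (W n))

instance : Module (PowerSeries ℂ) (Weyl n) := inferInstanceAs (Module (PowerSeries ℂ) (W n))

theorem zero_weylMul (a : W n) : weylMul 0 a = 0 := by
  have h := smul_weylMul 0 a a
  rwa [zero_smul, zero_smul] at h

theorem weylMul_zero (a : W n) : weylMul a 0 = 0 := by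
  have h := weylMul_smul 0 a a
  rwa [zero_smul, zero_smul] at h

/-- The synonym keeps this product apart from the commutative ring structure of `W n`; the cocycle
identity below then becomes a computation in an associative ring. -/
instance : Ring (Weyl n) where
  __ := (inferInstance : AddCommGroup (Weyl n))
  mul := weylMul (n := n)
  one := (1 : W n)
  left_distrib := weylMul_add
  right_distrib := add_weylMul
  zero_mul := zero_weylMul
  mul_zero := weylMul_zero
  mul_assoc := weylMul_assoc
  one_mul := one_weylMul
  mul_one := weylMul_one

theorem psmul_weylMul (c : PowerSeries ℂ) (a b : W n) : weylMul (c • a) b = c • weylMul a b :=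
  map_smul_of_map_X_mul (φ := (LinearMap.mk₂ ℂ weylMul add_weylMul smul_weylMul weylMul_add
    weylMul_smul).flip b) (fun a => X_mul_weylMul a b) c a

theorem weylMul_psmul (c : PowerSeries ℂ) (a b : W n) : weylMul a (c • b) = c • weylMul a b :=
  map_smul_of_map_X_mul (φ := LinearMap.mk₂ ℂ weylMul add_weylMul smul_weylMul weylMul_add
    weylMul_smul a) (fun b => weylMul_X_mul a b) c b

instance : Algebra (PowerSeries ℂ) (Weyl n) :=
  Algebra.ofModule psmul_weylMul weylMul_psmul

theorem X_pow_psmul (r : ℕ) (a : W n) :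
    (PowerSeries.X : PowerSeries ℂ) ^ r • a = PowerSeries.X ^ r * a := by
  rw [Algebra.smul_def, map_pow]
  change (PowerSeries.map (algebraMap ℂ (W0 n)) PowerSeries.X) ^ r * a = _
  rw [PowerSeries.map_X]

section

/-! Iterated partial derivatives -/

theorem prod_ofFn_pow_add {M : Type*} [Monoid M] {m : ℕ} (a : Fin m → M)
    (h : ∀ i j, Commute (a i) (a j)) (α β : Fin m → ℕ) :
    (List.ofFn fun i => a i ^ (α i + β i)).prod =
      (List.ofFn fun i => a i ^ α i).prod * (List.ofFn fun i => a i ^ β i).prod := by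
  induction m with
  | zero => simp
  | succ m ih =>
    simp only [List.ofFn_succ, List.prod_cons]
    rw [ih (fun i => a i.succ) (fun i j => h _ _) (fun i => α i.succ) fun i => β i.succ, pow_add]
    have hc : Commute (a 0 ^ β 0) (List.ofFn fun i : Fin m => a i.succ ^ α i.succ).prod := by
      refine Commute.list_prod_right _ _ fun x hx => ?_
      obtain ⟨i, rfl⟩ := (List.mem_ofFn' _ _).1 hx
      exact (h _ _).pow_pow _ _
    rw [mul_assoc, mul_assoc, ← mul_assoc (a 0 ^ β 0), hc.eq, mul_assoc]

theorem prod_ofFn_pow_single {M : Type*} [Monoid M] {m : ℕ} (a : Fin m → M) (i : Fin m) :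
    (List.ofFn fun j => a j ^ (Finsupp.single i 1 : Fin m →₀ ℕ) j).prod = a i := by
  classical
  induction m with
  | zero => exact i.elim0
  | succ m ih =>
    rw [List.ofFn_succ, List.prod_cons]
    refine Fin.cases ?_ (fun i => ?_) i
    · have : (fun j : Fin m => a j.succ ^ (Finsupp.single 0 1 : Fin (m + 1) →₀ ℕ) j.succ) =
          fun _ => 1 := by
        funext j
        rw [Finsupp.single_eq_of_ne (Fin.succ_ne_zero j), pow_zero]
      rw [this]
      simp
    · have := ih (fun j => a j.succ) i
      rw [Finsupp.single_eq_of_ne (Fin.succ_ne_zero i).symm, pow_zero, one_mul]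
      simpa only [Finsupp.single_apply, Fin.succ_inj] using this

theorem dqPow_add (α β : Fin n →₀ ℕ) : dqPow (α + β) = dqPow α * dqPow β :=
  prod_ofFn_pow_add dq (fun i j => LinearMap.ext fun f => dq_comm i j f) α β

theorem dqPow_single (i : Fin n) : dqPow (Finsupp.single i 1) = dq i :=
  prod_ofFn_pow_single dq i

theorem dqPow_zero : dqPow (0 : Fin n →₀ ℕ) = 1 := by
  simp [dqPow]

theorem dq_dqPow (i : Fin n) (α : Fin n →₀ ℕ) (f : Smooth n) :
    dq i (dqPow α f) = dqPow (α + Finsupp.single i 1) f := by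
  rw [add_comm, dqPow_add, dqPow_single]
  rfl

theorem dqPow_mem {P : Module.End ℂ (Smooth n) → Prop} (one : P 1)
    (mul : ∀ φ ψ, P φ → P ψ → P (φ * ψ)) (hdq : ∀ i, P (dq i)) (α : Fin n →₀ ℕ) :
    P (dqPow α) := by
  let s : Submonoid (Module.End ℂ (Smooth n)) :=
    { carrier := {φ | P φ}, mul_mem' := fun h h' => mul _ _ h h', one_mem' := one }
  refine Submonoid.list_prod_mem s fun x hx => ?_
  obtain ⟨i, rfl⟩ := (List.mem_ofFn' _ _).1 hx
  exact s.pow_mem (hdq i) _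

theorem dqPow_star (α : Fin n →₀ ℕ) : ∀ f, dqPow α (star f) = star (dqPow α f) :=
  dqPow_mem (P := fun φ => ∀ f, φ (star f) = star (φ f)) (fun _ => rfl)
    (fun φ ψ h h' f => by rw [Module.End.mul_apply, h', h, Module.End.mul_apply]) dq_star α

/-! Differential operators -/

variable (n) in
/-- The `C^∞(ℝⁿ)`-module of differential operators. -/
def diffOps : Submodule (Smooth n) (Smooth n → Smooth n) :=
  Submodule.span (Smooth n) (Set.range fun α f => dqPow α f)

variable (n) in
/-- The `C^∞(ℝⁿ)`-module of bidifferential operators. -/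
def bidiffOps : Submodule (Smooth n) (Smooth n × Smooth n → Smooth n) :=
  Submodule.span (Smooth n) (Set.range fun (γ : (Fin n →₀ ℕ) × (Fin n →₀ ℕ)) p =>
    dqPow γ.1 p.1 * dqPow γ.2 p.2)

/-- Passing to a span replaces explicit coefficient families by span induction in all closure
properties. -/
theorem mem_diffOps {D : Smooth n → Smooth n} : D ∈ diffOps n ↔ IsDiffOp D := by
  rw [diffOps, Finsupp.mem_span_range_iff_exists_finsupp, IsDiffOp]
  refine exists_congr fun a => ?_
  rw [eq_comm, funext_iff]
  refine forall_congr' fun f => ?_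
  simp [Finsupp.sum, Finset.sum_apply]

theorem mem_bidiffOps {B : Smooth n → Smooth n → Smooth n} :
    (fun p => B p.1 p.2) ∈ bidiffOps n ↔ IsBidiffOp B := by
  rw [bidiffOps, Finsupp.mem_span_range_iff_exists_finsupp, IsBidiffOp]
  refine exists_congr fun a => ?_
  rw [eq_comm, funext_iff, Prod.forall]
  refine forall_congr' fun f => forall_congr' fun g => ?_
  simp [Finsupp.sum, Finset.sum_apply, mul_assoc]

section Closure

variable {Z : Type}

/-- A module of maps into `C^∞(ℝⁿ)` that is closed under partial derivatives of the values. -/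
def DqClosed (F : Submodule (Smooth n) (Z → Smooth n)) : Prop :=
  ∀ i, ∀ D ∈ F, (fun z => dq i (D z)) ∈ F

theorem DqClosed.span {s : Set (Z → Smooth n)}
    (h : ∀ i, ∀ D ∈ s, (fun z => dq i (D z)) ∈ Submodule.span (Smooth n) s) :
    DqClosed (Submodule.span (Smooth n) s) := by
  intro i D hD
  induction hD using Submodule.span_induction with
  | mem D hD => exact h i D hD
  | zero =>
    convert Submodule.zero_mem _ using 1
    funext z
    exact map_zero _
  | add D E _ _ h h' =>
    convert Submodule.add_mem _ h h' using 1
    funext z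
    exact map_add _ _ _
  | smul c D hD h =>
    convert Submodule.add_mem _ (Submodule.smul_mem _ (dq i c) hD) (Submodule.smul_mem _ c h) using 1
    funext z
    exact dq_mul i c (D z)

theorem dqClosed_diffOps : DqClosed (diffOps n) := by
  refine DqClosed.span ?_
  rintro i _ ⟨α, rfl⟩
  refine Submodule.subset_span ⟨α + Finsupp.single i 1, ?_⟩
  funext f
  exact (dq_dqPow i α f).symm

theorem dqClosed_bidiffOps : DqClosed (bidiffOps n) := by
  refine DqClosed.span ?_
  rintro i _ ⟨γ, rfl⟩
  have h₁ : (fun p : Smooth n × Smooth n =>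
      dqPow (γ.1 + Finsupp.single i 1) p.1 * dqPow γ.2 p.2) ∈ bidiffOps n :=
    Submodule.subset_span ⟨(γ.1 + Finsupp.single i 1, γ.2), rfl⟩
  have h₂ : (fun p : Smooth n × Smooth n =>
      dqPow γ.1 p.1 * dqPow (γ.2 + Finsupp.single i 1) p.2) ∈ bidiffOps n :=
    Submodule.subset_span ⟨(γ.1, γ.2 + Finsupp.single i 1), rfl⟩
  change _ ∈ bidiffOps n
  convert Submodule.add_mem _ h₁ h₂ using 1
  funext p
  simp only [dq_mul, dq_dqPow, Pi.add_apply]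

/-- Needed for the terms `t_j(C_r(f, g))` of the obstruction: a differential operator after a
bidifferential one is bidifferential. -/
theorem DqClosed.comp {F : Submodule (Smooth n) (Z → Smooth n)} (hF : DqClosed F)
    {D : Smooth n → Smooth n} (hD : D ∈ diffOps n) {E : Z → Smooth n} (hE : E ∈ F) :
    (fun z => D (E z)) ∈ F := by
  induction hD using Submodule.span_induction with
  | mem D hD =>
    obtain ⟨α, rfl⟩ := hD
    exact dqPow_mem (P := fun φ => ∀ E ∈ F, (fun z => φ (E z)) ∈ F) (fun E hE => hE)
      (fun φ ψ h h' E hE => h _ (h' E hE)) hF α E hE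
  | zero => exact Submodule.zero_mem _
  | add D D' _ _ h h' => exact Submodule.add_mem _ h h'
  | smul c D _ h => exact Submodule.smul_mem _ c h

variable (n Z) in
/-- The constant maps into `C^∞(ℝⁿ)`. -/
def constMaps : Submodule (Smooth n) (Z → Smooth n) where
  carrier := {D | ∃ c, ∀ z, D z = c}
  add_mem' := by
    rintro D E ⟨c, hc⟩ ⟨d, hd⟩
    exact ⟨c + d, fun z => by rw [Pi.add_apply, hc, hd]⟩
  zero_mem' := ⟨0, fun _ => rfl⟩
  smul_mem' := by
    rintro a D ⟨c, hc⟩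
    exact ⟨a * c, fun z => by rw [Pi.smul_apply, hc, smul_eq_mul]⟩

theorem dqClosed_constMaps : DqClosed (constMaps n Z) := by
  rintro i D ⟨c, hc⟩
  exact ⟨dq i c, fun z => congrArg _ (hc z)⟩

/-- The maps of the form `z ↦ D (φ z)` with `D` in a given module. -/
def pullMaps (φ : Z → Smooth n) (F : Submodule (Smooth n) (Smooth n → Smooth n)) :
    Submodule (Smooth n) (Z → Smooth n) :=
  F.map (LinearMap.funLeft (Smooth n) (Smooth n) φ)

theorem DqClosed.pullMaps {F : Submodule (Smooth n) (Smooth n → Smooth n)} (hF : DqClosed F)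
    (φ : Z → Smooth n) : DqClosed (pullMaps φ F) := by
  rintro i _ ⟨D, hD, rfl⟩
  exact ⟨_, hF i D hD, rfl⟩

/-- All coefficients of a map into `𝒲` belong to a given module of maps. -/
def CoeffIn (F : Submodule (Smooth n) (Z → Smooth n)) (a : Z → W n) : Prop :=
  ∀ r α, (fun z => wcoeff r α (a z)) ∈ F

namespace CoeffIn

variable {F G H : Submodule (Smooth n) (Z → Smooth n)} {a b : Z → W n}

theorem add (ha : CoeffIn F a) (hb : CoeffIn F b) : CoeffIn F fun z => a z + b z := fun r α => by
  simp only [wcoeff_add]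
  exact Submodule.add_mem _ (ha r α) (hb r α)

theorem complex_smul_mem (c : ℂ) {D : Z → Smooth n} (hD : D ∈ F) : (fun z => c • D z) ∈ F := by
  have h := F.smul_mem (algebraMap ℂ (Smooth n) c) hD
  convert h using 1
  funext z
  rw [Pi.smul_apply, smul_eq_mul, Algebra.smul_def]

theorem smul (c : ℂ) (ha : CoeffIn F a) : CoeffIn F fun z => c • a z := fun r α => by
  simp only [wcoeff_smul]
  exact complex_smul_mem c (ha r α)

theorem neg (ha : CoeffIn F a) : CoeffIn F fun z => -a z := by
  simpa only [neg_smul, one_smul] using ha.smul (-1)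

theorem sub (ha : CoeffIn F a) (hb : CoeffIn F b) : CoeffIn F fun z => a z - b z := by
  simpa only [sub_eq_add_neg] using ha.add hb.neg

theorem zero : CoeffIn F fun _ => (0 : W n) := fun r α => by
  simp only [wcoeff_zero]
  exact F.zero_mem

theorem sum {ι : Type*} {s : Finset ι} {u : ι → Z → W n} (h : ∀ i ∈ s, CoeffIn F (u i)) :
    CoeffIn F fun z => ∑ i ∈ s, u i z := fun r α => by
  simp only [wcoeff_sum]
  convert F.sum_mem fun i hi => h i hi r α using 1
  funext z
  simp

theorem X_pow_mul (k : ℕ) (ha : CoeffIn F a) : CoeffIn F fun z => PowerSeries.X ^ k * a z :=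
  fun r α => by
    simp only [wcoeff_X_pow_mul]
    split_ifs
    · exact ha _ _
    · exact F.zero_mem

theorem wdq (hF : DqClosed F) (i : Fin n) (ha : CoeffIn F a) : CoeffIn F fun z => wdq i (a z) :=
  fun r α => by
    simp only [wcoeff_wdq]
    exact hF i _ (ha r α)

theorem wdp (i : Fin n) (ha : CoeffIn F a) : CoeffIn F fun z => wdp i (a z) := fun r α => by
  simp only [wcoeff_wdp]
  convert F.smul_mem ((α i : Smooth n) + 1) (ha r (α + Finsupp.single i 1)) using 1
  funext z
  rw [Pi.smul_apply, smul_eq_mul, mul_comm]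

/-- Three modules are kept separate so that operators in `f` times operators in `g` can land in the
bidifferential operators, and operators times constants in the operators. -/
theorem mul (h : ∀ D ∈ F, ∀ E ∈ G, (fun z => D z * E z) ∈ H) (ha : CoeffIn F a)
    (hb : CoeffIn G b) : CoeffIn H fun z => a z * b z := fun r α => by
  simp only [wcoeff_mul]
  have := H.sum_mem (t := Finset.HasAntidiagonal.antidiagonal r) fun x _ =>
    H.sum_mem (t := Finset.HasAntidiagonal.antidiagonal α) fun y _ =>
      h _ (ha x.1 y.1) _ (hb x.2 y.2)
  convert this using 1
  funext z
  simp

theorem bd (hF : DqClosed F) (hG : DqClosed G) (h : ∀ D ∈ F, ∀ E ∈ G, (fun z => D z * E z) ∈ H)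
    (ha : CoeffIn F a) (hb : CoeffIn G b) (r : ℕ) : CoeffIn H fun z => bd r (a z) (b z) := by
  induction r generalizing a b with
  | zero => exact mul h ha hb
  | succ r ih =>
    simp only [bd_succ]
    exact sum fun k _ => (ih (ha.wdq hF k) (hb.wdp k)).sub (ih (ha.wdp k) (hb.wdq hG k))

theorem xsum {u : ℕ → Z → W n} (h : ∀ r, CoeffIn F (u r)) :
    CoeffIn F fun z => xsum fun r => u r z := fun r α => by
  simp only [wcoeff_xsum]
  convert F.sum_mem (t := Finset.HasAntidiagonal.antidiagonal r) fun x _ => h x.1 x.2 α using 1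
  funext z
  simp

theorem weylMul (hF : DqClosed F) (hG : DqClosed G)
    (h : ∀ D ∈ F, ∀ E ∈ G, (fun z => D z * E z) ∈ H) (ha : CoeffIn F a) (hb : CoeffIn G b) :
    CoeffIn H fun z => weylMul (a z) (b z) := by
  simp only [weylMul_eq_xsum]
  exact xsum fun r => (bd hF hG h ha hb r).smul _

theorem const (c : W n) : CoeffIn (constMaps n Z) fun _ => c := fun _ _ => ⟨_, fun _ => rfl⟩

theorem weylMul_const (hF : DqClosed F) (ha : CoeffIn F a) (c : W n) :
    CoeffIn F fun z => FormalStar.weylMul (a z) c := by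
  refine weylMul hF dqClosed_constMaps ?_ ha (const c)
  rintro D hD E ⟨c, hc⟩
  convert F.smul_mem c hD using 1
  funext z
  rw [hc, Pi.smul_apply, smul_eq_mul, mul_comm]

theorem const_weylMul (hF : DqClosed F) (ha : CoeffIn F a) (c : W n) :
    CoeffIn F fun z => FormalStar.weylMul c (a z) := by
  refine weylMul dqClosed_constMaps hF ?_ (const c) ha
  rintro D ⟨c, hc⟩ E hE
  convert F.smul_mem c hE using 1
  funext z
  rw [hc, Pi.smul_apply, smul_eq_mul]

theorem piStar {D : Z → Smooth n} (hD : D ∈ F) : CoeffIn F fun z => piStar n (D z) := fun r α => by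
  simp only [wcoeff_piStar]
  split_ifs
  · exact hD
  · exact F.zero_mem

end CoeffIn

end Closure

theorem id_mem_diffOps : (fun f : Smooth n => f) ∈ diffOps n :=
  Submodule.subset_span ⟨0, by simp [dqPow_zero]⟩

theorem mul_mem_bidiffOps {D E : Smooth n → Smooth n} (hD : D ∈ diffOps n) (hE : E ∈ diffOps n) :
    (fun p : Smooth n × Smooth n => D p.1 * E p.2) ∈ bidiffOps n := by
  induction hD using Submodule.span_induction with
  | mem D hD =>
    obtain ⟨α, rfl⟩ := hD
    induction hE using Submodule.span_induction with
    | mem E hE =>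
      obtain ⟨β, rfl⟩ := hE
      exact Submodule.subset_span ⟨(α, β), rfl⟩
    | zero =>
      convert Submodule.zero_mem _ using 1
      funext p
      simp
    | add E E' _ _ h h' =>
      convert Submodule.add_mem _ h h' using 1
      funext p
      simp [mul_add]
    | smul c E _ h =>
      convert Submodule.smul_mem _ c h using 1
      funext p
      simp [mul_left_comm]
  | zero =>
    convert Submodule.zero_mem _ using 1
    funext p
    simp
  | add D D' _ _ h h' =>
    convert Submodule.add_mem _ h h' using 1
    funext p
    simp [add_mul]
  | smul c D _ h =>
    convert Submodule.smul_mem _ c h using 1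
    funext p
    simp [mul_assoc]

theorem mul_mem_bidiffOps_of_mem_pullMaps :
    ∀ D ∈ pullMaps Prod.fst (diffOps n), ∀ E ∈ pullMaps Prod.snd (diffOps n),
      (fun p : Smooth n × Smooth n => D p * E p) ∈ bidiffOps n := by
  rintro _ ⟨D, hD, rfl⟩ _ ⟨E, hE, rfl⟩
  exact mul_mem_bidiffOps hD hE

theorem coeffIn_bidiffOps_weylMul {T U : Smooth n → W n} (hT : CoeffIn (diffOps n) T)
    (hU : CoeffIn (diffOps n) U) :
    CoeffIn (bidiffOps n) fun p => weylMul (T p.1) (U p.2) :=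
  CoeffIn.weylMul (dqClosed_diffOps.pullMaps _) (dqClosed_diffOps.pullMaps _)
    mul_mem_bidiffOps_of_mem_pullMaps (a := fun p : Smooth n × Smooth n => T p.1)
    (b := fun p : Smooth n × Smooth n => U p.2) (fun r α => ⟨_, hT r α, rfl⟩)
    fun r α => ⟨_, hU r α, rfl⟩

theorem star_mem_diffOps {D : Smooth n → Smooth n} (hD : D ∈ diffOps n) :
    (fun f => star (D (star f))) ∈ diffOps n := by
  induction hD using Submodule.span_induction with
  | mem D hD =>
    obtain ⟨α, rfl⟩ := hD
    refine Submodule.subset_span ⟨α, ?_⟩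
    funext f
    simp only [dqPow_star, star_star]
  | zero =>
    convert Submodule.zero_mem _ using 1
    funext f
    exact star_zero _
  | add D E _ _ h h' =>
    convert Submodule.add_mem _ h h' using 1
    funext f
    exact star_add _ _
  | smul c D _ h =>
    convert Submodule.smul_mem _ (star c) h using 1
    funext f
    simp

theorem isDiffCochain_iff {T : Smooth n →ₗ[ℂ] W n} :
    IsDiffCochain T ↔ CoeffIn (diffOps n) T := by
  simp only [IsDiffCochain, CoeffIn, mem_diffOps]

end

section

/-! The grading of `𝒲` -/

/-- Only the coefficients of `λ^r p^α` with `r + |α|` in the set `I` are nonzero. -/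
def DegIn (I : Set ℤ) (a : W n) : Prop :=
  ∀ (r : ℕ) (α : Fin n →₀ ℕ), ((r : ℤ) + α.degree) ∉ I → wcoeff r α a = 0

namespace DegIn

variable {I J K : Set ℤ} {a b : W n}

theorem add (ha : DegIn I a) (hb : DegIn I b) : DegIn I (a + b) := fun r α h => by
  rw [wcoeff_add, ha r α h, hb r α h, add_zero]

theorem smul (c : ℂ) (ha : DegIn I a) : DegIn I (c • a) := fun r α h => by
  rw [wcoeff_smul, ha r α h, smul_zero]

theorem sub (ha : DegIn I a) (hb : DegIn I b) : DegIn I (a - b) := fun r α h => by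
  rw [wcoeff_sub, ha r α h, hb r α h, sub_zero]

theorem neg (ha : DegIn I a) : DegIn I (-a) := fun r α h => by
  rw [wcoeff_neg, ha r α h, neg_zero]

theorem zero : DegIn I (0 : W n) := fun _ _ _ => wcoeff_zero _ _

theorem sum {ι : Type*} {s : Finset ι} {u : ι → W n} (h : ∀ i ∈ s, DegIn I (u i)) :
    DegIn I (∑ i ∈ s, u i) := fun r α hr => by
  rw [wcoeff_sum]
  exact Finset.sum_eq_zero fun i hi => h i hi r α hr

theorem mono (h : I ⊆ J) (ha : DegIn I a) : DegIn J a := fun r α hr =>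
  ha r α fun h' => hr (h h')

theorem wdq (i : Fin n) (ha : DegIn I a) : DegIn I (wdq i a) := fun r α h => by
  rw [wcoeff_wdq, ha r α h, map_zero]

theorem wdp (i : Fin n) (ha : DegIn I a) : DegIn {z | z + 1 ∈ I} (wdp i a) := fun r α h => by
  rw [wcoeff_wdp, ha, zero_mul]
  rw [map_add, Finsupp.degree_single]
  push_cast
  rwa [← add_assoc]

theorem mul (h : ∀ i ∈ I, ∀ j ∈ J, i + j ∈ K) (ha : DegIn I a) (hb : DegIn J b) :
    DegIn K (a * b) := fun r α hr => by
  rw [wcoeff_mul]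
  refine Finset.sum_eq_zero fun x hx => Finset.sum_eq_zero fun y hy => ?_
  rw [Finset.HasAntidiagonal.mem_antidiagonal] at hx hy
  by_cases h1 : ((x.1 : ℤ) + y.1.degree) ∈ I
  · by_cases h2 : ((x.2 : ℤ) + y.2.degree) ∈ J
    · refine absurd (h _ h1 _ h2) ?_
      rw [← hx, ← hy, map_add] at hr
      push_cast at hr
      convert hr using 2
      ring
    · rw [hb _ _ h2, mul_zero]
  · rw [ha _ _ h1, zero_mul]

/-- Each factor of `P` contains one `∂/∂p` and lowers the degree by one. In the Weyl-Moyal product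
the accompanying `λ` restores it, so that product is graded. Integer degrees avoid truncated
subtraction. -/
theorem bd (r : ℕ) (h : ∀ i ∈ I, ∀ j ∈ J, i + j - r ∈ K) (ha : DegIn I a) (hb : DegIn J b) :
    DegIn K (bd r a b) := by
  induction r generalizing a b I J with
  | zero => exact mul (fun i hi j hj => by simpa using h i hi j hj) ha hb
  | succ r ih =>
    rw [bd_succ]
    refine sum fun k _ => (ih (fun i hi j hj => ?_) (ha.wdq k) (hb.wdp k)).sub
      (ih (fun i hi j hj => ?_) (ha.wdp k) (hb.wdq k))
    · have := h i hi _ hj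
      push_cast at this
      convert this using 1
      ring
    · have := h _ hi j hj
      push_cast at this
      convert this using 1
      ring

theorem weylMul (h : ∀ i ∈ I, ∀ j ∈ J, i + j ∈ K) (ha : DegIn I a) (hb : DegIn J b) :
    DegIn K (weylMul a b) := fun r α hr => by
  rw [weylMul_eq_xsum, wcoeff_xsum]
  refine Finset.sum_eq_zero fun x hx => ?_
  rw [Finset.HasAntidiagonal.mem_antidiagonal] at hx
  refine (bd (K := {z | z + x.1 ∈ K}) x.1 (fun i hi j hj => ?_) ha hb).smul _ x.2 α fun h' => ?_
  · simpa using h i hi j hj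
  · refine hr ?_
    rw [← hx]
    rw [Set.mem_ofPred_eq] at h'
    push_cast
    convert h' using 1
    ring

end DegIn

/-- The element `a` of `𝒲` is homogeneous of degree `k`. -/
def Homog (k : ℕ) (a : W n) : Prop := DegIn {(k : ℤ)} a

theorem homog_iff {k : ℕ} {a : W n} :
    Homog k a ↔ ∀ r α, r + α.degree ≠ k → wcoeff r α a = 0 := by
  refine forall_congr' fun r => forall_congr' fun α => imp_congr_left ?_
  rw [Set.mem_singleton_iff, not_iff_not]
  norm_cast

theorem Homog.weylMul {k l : ℕ} {a b : W n} (ha : Homog k a) (hb : Homog l b) :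
    Homog (k + l) (weylMul a b) :=
  DegIn.weylMul (by simp) ha hb

theorem Homog.wdp {k : ℕ} {a : W n} (i : Fin n) (ha : Homog (k + 1) a) : Homog k (wdp i a) :=
  (DegIn.wdp i ha).mono fun z hz => by
    have h : z + 1 = ((k + 1 : ℕ) : ℤ) := hz
    push_cast at h
    exact add_right_cancel h

theorem Homog.X_mul {k : ℕ} {a : W n} (ha : Homog k a) : Homog (k + 1) (PowerSeries.X * a) := by
  rw [homog_iff] at ha ⊢
  rintro (_ | r) α h
  · exact wcoeff_zero_X_mul α a
  · rw [wcoeff_succ_X_mul]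
    exact ha r α (by omega)

theorem Homog.X_pow_mul {k : ℕ} {a : W n} (ha : Homog k a) (r : ℕ) :
    Homog (k + r) (PowerSeries.X ^ r * a) := by
  induction r with
  | zero => simpa using ha
  | succ r ih =>
    rw [pow_succ', mul_assoc]
    exact ih.X_mul

theorem Homog.of_X_mul {k : ℕ} {a : W n} (ha : Homog (k + 1) (PowerSeries.X * a)) : Homog k a := by
  rw [homog_iff] at ha ⊢
  intro r α h
  rw [← wcoeff_succ_X_mul]
  exact ha _ _ (by omega)

theorem homog_piStar (f : Smooth n) : Homog 0 (piStar n f) := by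
  rw [homog_iff]
  intro r α h
  rw [wcoeff_piStar, if_neg]
  rintro ⟨rfl, rfl⟩
  simp at h

theorem Homog.eq_piStar {a : W n} (ha : Homog 0 a) : a = piStar n (wcoeff 0 0 a) := by
  rw [homog_iff] at ha
  refine wcoeff_ext fun r α => ?_
  rw [wcoeff_piStar]
  split_ifs with h
  · rw [h.1, h.2]
  · refine ha r α fun h' => h ?_
    rw [Nat.add_eq_zero_iff] at h'
    exact ⟨h'.1, (Finsupp.degree_eq_zero_iff α).1 h'.2⟩

theorem wcoeff_wp_mul (i : Fin n) (r : ℕ) (α : Fin n →₀ ℕ) (b : W n) :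
    wcoeff r α (wp i * b) =
      if Finsupp.single i 1 ≤ α then wcoeff r (α - Finsupp.single i 1) b else 0 := by
  classical
  rw [wcoeff, wp, PowerSeries.coeff_C_mul, MvPowerSeries.X, MvPowerSeries.coeff_monomial_mul]
  split_ifs <;> simp [wcoeff]

theorem wcoeff_wp (i : Fin n) (r : ℕ) (α : Fin n →₀ ℕ) :
    wcoeff r α (wp i : W n) = if r = 0 ∧ α = Finsupp.single i 1 then 1 else 0 := by
  classical
  rw [wcoeff, wp, PowerSeries.coeff_C]
  by_cases h : r = 0 <;> simp [h, MvPowerSeries.coeff_X]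

theorem homog_wp (i : Fin n) : Homog 1 (wp i : W n) := by
  rw [homog_iff]
  intro r α h
  rw [wcoeff_wp, if_neg]
  rintro ⟨rfl, rfl⟩
  simp at h

/-- The derivation `∂/∂λ` of `𝒲`. -/
def wdl (a : W n) : W n := PowerSeries.derivative (W0 n) a

theorem wcoeff_wdl (r : ℕ) (α : Fin n →₀ ℕ) (a : W n) :
    wcoeff r α (wdl a) = ((r + 1 : ℕ) : ℂ) • wcoeff (r + 1) α a := by
  have h : PowerSeries.coeff (r + 1) a * ((r : W0 n) + 1) =
      ((r + 1 : ℕ) : ℂ) • PowerSeries.coeff (r + 1) a := by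
    rw [Algebra.smul_def, mul_comm]
    simp
  rw [wcoeff, wdl, PowerSeries.coeff_derivative, h]
  simp [wcoeff]

theorem Homog.wdl {k : ℕ} {a : W n} (ha : Homog (k + 1) a) : Homog k (wdl a) := by
  rw [homog_iff] at ha ⊢
  intro r α h
  rw [wcoeff_wdl, ha _ _ (by omega), smul_zero]

theorem degMap_eq (a : W n) :
    degMap a = ∑ i : Fin n, wp i * wdp i a + PowerSeries.X * wdl a := rfl

theorem natCast_smul_smooth (k : ℕ) (f : Smooth n) : f * (k : Smooth n) = (k : ℂ) • f := by
  rw [Algebra.smul_def, mul_comm]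
  simp

theorem wcoeff_degMap (r : ℕ) (α : Fin n →₀ ℕ) (a : W n) :
    wcoeff r α (degMap a) = ((r + α.degree : ℕ) : ℂ) • wcoeff r α a := by
  have h1 : ∀ i, wcoeff r α (wp i * wdp i a) = (α i : ℂ) • wcoeff r α a := fun i => by
    rw [wcoeff_wp_mul]
    split_ifs with h
    · rw [wcoeff_wdp, tsub_add_cancel_of_le h, ← natCast_smul_smooth]
      have h' : 1 ≤ α i := by simpa using h i
      obtain ⟨m, hm⟩ := Nat.exists_eq_add_of_le h'
      simp [hm, add_comm]
    · have h' : α i = 0 := by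
        by_contra h'
        exact h (Finsupp.single_le_iff.2 (Nat.one_le_iff_ne_zero.2 h'))
      rw [h', Nat.cast_zero, zero_smul]
  have h2 : wcoeff r α (PowerSeries.X * wdl a) = (r : ℂ) • wcoeff r α a := by
    cases r with
    | zero => rw [wcoeff_zero_X_mul, Nat.cast_zero, zero_smul]
    | succ r => rw [wcoeff_succ_X_mul, wcoeff_wdl]
  rw [degMap_eq, wcoeff_add, wcoeff_sum, h2]
  simp only [h1]
  rw [← Finset.sum_smul, ← add_smul, Finsupp.degree_eq_sum, add_comm]
  push_cast
  rfl

theorem Homog.degMap_eq_smul {k : ℕ} {a : W n} (ha : Homog k a) : degMap a = (k : ℂ) • a := by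
  rw [homog_iff] at ha
  refine wcoeff_ext fun r α => ?_
  rw [wcoeff_degMap, wcoeff_smul]
  by_cases h : r + α.degree = k
  · rw [h]
  · rw [ha r α h, smul_zero, smul_zero]

theorem Homog.degMap {k : ℕ} {a : W n} (ha : Homog k a) : degMap a = k • a := by
  rw [ha.degMap_eq_smul, Nat.cast_smul_eq_nsmul]

theorem Homog.euler {k : ℕ} {a : W n} (ha : Homog (k + 1) a) :
    a = ((k : ℂ) + 1)⁻¹ • (∑ i : Fin n, wp i * FormalStar.wdp i a +
      PowerSeries.X * FormalStar.wdl a) := by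
  have h : (k : ℂ) + 1 ≠ 0 := by exact_mod_cast Nat.succ_ne_zero k
  rw [← degMap_eq, ha.degMap_eq_smul, smul_smul, Nat.cast_succ, inv_mul_cancel₀ h, one_smul]

/-- Induction over homogeneous elements: they are generated by functions, multiplication
by `p_j` from the right, and multiplication by `λ`. -/
theorem Homog.induction {P : ℕ → W n → Prop} (piStar : ∀ f, P 0 (piStar n f))
    (add : ∀ k a b, P k a → P k b → P k (a + b)) (smul : ∀ k (c : ℂ) a, P k a → P k (c • a))
    (weylMul_wp : ∀ k b j, Homog k b → P (k + 1) (FormalStar.weylMul b (wp j)))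
    (X_mul : ∀ k a, P k a → P (k + 1) (PowerSeries.X * a)) {k : ℕ} {a : W n} (ha : Homog k a) :
    P k a := by
  induction k generalizing a with
  | zero =>
    rw [ha.eq_piStar]
    exact piStar _
  | succ k ih =>
    have hsum : ∀ s : Finset (Fin n), P (k + 1) (∑ i ∈ s, wp i * FormalStar.wdp i a) := by
      classical
      intro s
      induction s using Finset.induction_on with
      | empty =>
        -- The zero element in degree `k + 1` is reached as `0 • (λ · 0)`.
        have h0 := smul _ 0 _ (X_mul _ _ (ih (a := 0) DegIn.zero))
        rwa [zero_smul] at h0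
      | insert i s hi ihs =>
        rw [Finset.sum_insert hi]
        refine add _ _ _ ?_ ihs
        -- The undeformed product with `p_i` is traded for the Weyl product; the error is `λ` times
        -- an element of degree `k`, covered by the induction hypothesis.
        have h : wp i * FormalStar.wdp i a = FormalStar.weylMul (FormalStar.wdp i a) (wp i) +
            (-1 : ℂ) • (PowerSeries.X *
              ((Complex.I / 2) • FormalStar.wdq i (FormalStar.wdp i a))) := by
          rw [FormalStar.weylMul_wp, neg_smul, one_smul]
          ring
        rw [h]
        exact add _ _ _ (weylMul_wp _ _ _ (ha.wdp i))
          (smul _ _ _ (X_mul _ _ (smul _ _ _ (ih (DegIn.wdq i (ha.wdp i))))))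
    rw [ha.euler]
    exact smul _ _ _ (add _ _ _ (hsum _) (X_mul _ _ (ih ha.wdl)))

end

/-! The standard ordered symbol at `p = 0` -/

variable (n) in
/-- The operator `∑_i ∂²/∂q^i∂p_i`. -/
def lapl : Module.End ℂ (W n) := ∑ i : Fin n, wdq i ∘ₗ wdp i

theorem lapl_apply (a : W n) : lapl n a = ∑ i : Fin n, wdq i (wdp i a) := by
  simp [lapl, LinearMap.sum_apply]

theorem lapl_X_mul (a : W n) : lapl n (PowerSeries.X * a) = PowerSeries.X * lapl n a := by
  simp only [lapl_apply, wdp_X_mul, wdq_X_mul, Finset.mul_sum]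

theorem lapl_wdq (j : Fin n) (a : W n) : lapl n (wdq j a) = wdq j (lapl n a) := by
  simp only [lapl_apply, map_sum, ← wdq_wdp, wdq_wdq j]

theorem lapl_mul_wp (j : Fin n) (a : W n) :
    lapl n (a * wp j) = lapl n a * wp j + wdq j a := by
  classical
  have h : ∀ i, wdq i (wdp i (a * wp j)) =
      wdq i (wdp i a) * wp j + if i = j then wdq j a else 0 := fun i => by
    rw [wdp_mul, map_add, wdq_mul, wdq_mul, wdq_wp, wdp_wp, mul_zero, add_zero]
    split_ifs with h
    · rw [h, wdq_one]
      ring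
    · simp
  simp only [lapl_apply, h, Finset.sum_add_distrib, Finset.sum_mul]
  simp

theorem lapl_pow_wdq (s : ℕ) (j : Fin n) (a : W n) :
    (lapl n ^ s) (wdq j a) = wdq j ((lapl n ^ s) a) := by
  induction s with
  | zero => rfl
  | succ s ih => rw [pow_succ', Module.End.mul_apply, Module.End.mul_apply, ih, lapl_wdq]

theorem lapl_pow_X_mul (s : ℕ) (a : W n) :
    (lapl n ^ s) (PowerSeries.X * a) = PowerSeries.X * (lapl n ^ s) a := by
  induction s with
  | zero => rfl
  | succ s ih => rw [pow_succ', Module.End.mul_apply, Module.End.mul_apply, ih, lapl_X_mul]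

theorem lapl_pow_succ (s : ℕ) (a : W n) : (lapl n ^ (s + 1)) a = lapl n ((lapl n ^ s) a) := by
  rw [pow_succ', Module.End.mul_apply]

/-- The commutator of `lapl` with multiplication by `p_j` is `∂/∂q^j`, which commutes with `lapl`;
hence the factor `s + 1`. -/
theorem lapl_pow_mul_wp (s : ℕ) (j : Fin n) (a : W n) :
    (lapl n ^ (s + 1)) (a * wp j) = (lapl n ^ (s + 1)) a * wp j +
      ((s : ℂ) + 1) • (lapl n ^ s) (wdq j a) := by
  induction s with
  | zero => simp [lapl_mul_wp]
  | succ s ih =>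
    rw [lapl_pow_succ (s + 1), ih, map_add, lapl_mul_wp, map_smul, ← lapl_pow_succ, ← lapl_pow_succ,
      ← lapl_pow_wdq, add_assoc]
    congr 1
    push_cast
    module

/-- The coefficients `(-i/2)^s / s!`. -/
def ordConst (s : ℕ) : ℂ := (-(Complex.I / 2)) ^ s / (s.factorial : ℂ)

theorem ordConst_succ (s : ℕ) : ordConst (s + 1) * (s + 1) = -(Complex.I / 2) * ordConst s := by
  have h1 : (s.factorial : ℂ) ≠ 0 := by exact_mod_cast s.factorial_ne_zero
  have h2 : (s : ℂ) + 1 ≠ 0 := by exact_mod_cast Nat.succ_ne_zero s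
  rw [ordConst, ordConst, Nat.factorial_succ, pow_succ]
  push_cast
  field_simp

/-- The operator `exp(-(iλ/2) ∑_i ∂²/∂q^i∂p_i)`, which turns Weyl ordered symbols into standard
ordered ones. -/
def toStd (a : W n) : W n := xsum fun s => ordConst s • (lapl n ^ s) a

theorem toStd_add (a b : W n) : toStd (a + b) = toStd a + toStd b := by
  simp only [toStd, map_add, smul_add, xsum_add]

theorem toStd_smul (c : ℂ) (a : W n) : toStd (c • a) = c • toStd a := by
  simp only [toStd, map_smul, ← xsum_smul, smul_comm c]

theorem toStd_X_mul (a : W n) : toStd (PowerSeries.X * a) = PowerSeries.X * toStd a := by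
  simp only [toStd, lapl_pow_X_mul, ← mul_smul_comm, xsum_X_mul]

/-- Summed over `s`, the commutator relation reproduces the exponential itself. The correction is
opposite to the first-order term of `a ⋆ p_j`. -/
theorem toStd_mul_wp (a : W n) (j : Fin n) :
    toStd (a * wp j) = toStd a * wp j - PowerSeries.X * ((Complex.I / 2) • toStd (wdq j a)) := by
  have h : ∀ s, ordConst (s + 1) • (lapl n ^ (s + 1)) (a * wp j) =
      wp j * (ordConst (s + 1) • (lapl n ^ (s + 1)) a) +
        (-(Complex.I / 2)) • ordConst s • (lapl n ^ s) (wdq j a) := fun s => by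
    rw [lapl_pow_mul_wp, smul_add, smul_smul, ordConst_succ, mul_smul, mul_comm (wp j),
      smul_mul_assoc]
  have e : toStd a = ordConst 0 • a +
      PowerSeries.X * xsum fun s => ordConst (s + 1) • (lapl n ^ (s + 1)) a := xsum_eq_add _
  rw [e, toStd, xsum_eq_add]
  simp only [h]
  rw [xsum_add, xsum_mul_left, xsum_smul, toStd]
  simp only [pow_zero, Module.End.one_apply, neg_smul, add_mul, smul_mul_assoc]
  ring

/-- The standard ordered symbol at `p = 0`. As a differential operator, `a` maps the
constant function `1` to `symbolZero a`. -/
def symbolZero (a : W n) : PowerSeries (Smooth n) :=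
  PowerSeries.map MvPowerSeries.constantCoeff (toStd a)

theorem coeff_symbolZero (k : ℕ) (a : W n) :
    PowerSeries.coeff k (symbolZero a) = wcoeff k 0 (toStd a) := by
  rw [symbolZero, PowerSeries.coeff_map, wcoeff, MvPowerSeries.coeff_zero_eq_constantCoeff]

theorem symbolZero_add (a b : W n) : symbolZero (a + b) = symbolZero a + symbolZero b := by
  rw [symbolZero, toStd_add, map_add]
  rfl

theorem symbolZero_smul (c : ℂ) (a : W n) : symbolZero (c • a) = c • symbolZero a := by
  ext1 k
  rw [coeff_symbolZero, toStd_smul, wcoeff_smul, PowerSeries.coeff_smul, coeff_symbolZero]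

theorem symbolZero_sub (a b : W n) : symbolZero (a - b) = symbolZero a - symbolZero b := by
  rw [eq_sub_iff_add_eq, ← symbolZero_add, sub_add_cancel]

theorem symbolZero_X_mul (a : W n) :
    symbolZero (PowerSeries.X * a) = PowerSeries.X * symbolZero a := by
  rw [symbolZero, toStd_X_mul, map_mul, PowerSeries.map_X]
  rfl

theorem symbolZero_X_pow_mul (r : ℕ) (a : W n) :
    symbolZero (PowerSeries.X ^ r * a) = PowerSeries.X ^ r * symbolZero a :=
  map_X_pow_mul (φ := AddMonoidHom.mk' symbolZero symbolZero_add) symbolZero_X_mul r a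

theorem symbolZero_sum {ι : Type*} (s : Finset ι) (a : ι → W n) :
    symbolZero (∑ i ∈ s, a i) = ∑ i ∈ s, symbolZero (a i) :=
  map_sum (AddMonoidHom.mk' symbolZero symbolZero_add) a s

theorem toStd_piStar (f : Smooth n) : toStd (piStar n f) = piStar n f := by
  rw [toStd, xsum_eq_of_zero]
  · simp [ordConst]
  · intro s
    rw [pow_succ, Module.End.mul_apply, lapl_apply]
    simp [wdp_piStar]

theorem symbolZero_piStar (f : Smooth n) : symbolZero (piStar n f) = PowerSeries.C f := by
  rw [symbolZero, toStd_piStar]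
  simp [piStar]

/-- The operator of `p_j` is a multiple of `∂_j` and kills the constant function `1`. Concretely,
`toStd` turns right Weyl multiplication by `p_j` into the undeformed one, which vanishes at `p = 0`.
-/
theorem symbolZero_weylMul_wp (a : W n) (j : Fin n) : symbolZero (weylMul a (wp j)) = 0 := by
  rw [symbolZero, weylMul_wp, toStd_add, toStd_X_mul, toStd_smul, toStd_mul_wp, sub_add_cancel,
    map_mul, wp, PowerSeries.map_C, MvPowerSeries.constantCoeff_X, map_zero, mul_zero]

/-- At `p = 0` only powers of `λ` can carry the degree. -/
theorem Homog.symbolZero_eq {k : ℕ} {a : W n} (ha : Homog k a) :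
    symbolZero a = PowerSeries.X ^ k * PowerSeries.C (PowerSeries.coeff k (symbolZero a)) := by
  suffices h : ∃ g, symbolZero a = PowerSeries.X ^ k * PowerSeries.C g by
    obtain ⟨g, hg⟩ := h
    rw [hg, PowerSeries.coeff_X_pow_mul', if_pos le_rfl, Nat.sub_self, PowerSeries.coeff_zero_C]
  refine Homog.induction (P := fun k a => ∃ g, symbolZero a = PowerSeries.X ^ k * PowerSeries.C g)
    ?_ ?_ ?_ ?_ ?_ ha
  · exact fun f => ⟨f, by rw [symbolZero_piStar, pow_zero, one_mul]⟩
  · rintro k a b ⟨f, hf⟩ ⟨g, hg⟩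
    exact ⟨f + g, by rw [symbolZero_add, hf, hg, map_add, mul_add]⟩
  · rintro k c a ⟨f, hf⟩
    refine ⟨c • f, ?_⟩
    have h : (PowerSeries.C (c • f) : PowerSeries (Smooth n)) = c • PowerSeries.C f := by
      ext1 m
      rw [PowerSeries.coeff_smul, PowerSeries.coeff_C, PowerSeries.coeff_C]
      split_ifs
      · rfl
      · exact (smul_zero _).symm
    rw [symbolZero_smul, hf, h, mul_smul_comm]
  · exact fun k b j _ => ⟨0, by rw [symbolZero_weylMul_wp, map_zero, mul_zero]⟩
  · rintro k a ⟨f, hf⟩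
    exact ⟨f, by rw [symbolZero_X_mul, hf, pow_succ', mul_assoc]⟩

/-- A function acts as a multiplication operator. For the generators `b ⋆ p_j` both sides vanish by
associativity. -/
theorem Homog.symbolZero_piStar_weylMul {k : ℕ} {a : W n} (ha : Homog k a) (f : Smooth n) :
    symbolZero (FormalStar.weylMul (piStar n f) a) = PowerSeries.C f * symbolZero a := by
  refine Homog.induction (P := fun _ a => symbolZero (FormalStar.weylMul (piStar n f) a) =
    PowerSeries.C f * symbolZero a) ?_ ?_ ?_ ?_ ?_ ha
  · intro g
    rw [piStar_weylMul_piStar, symbolZero_piStar, symbolZero_piStar, map_mul]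
  · intro k a b h h'
    rw [weylMul_add, symbolZero_add, symbolZero_add, h, h', mul_add]
  · intro k c a h
    rw [weylMul_smul, symbolZero_smul, symbolZero_smul, h, mul_smul_comm]
  · intro k b j _
    rw [← weylMul_assoc, symbolZero_weylMul_wp, symbolZero_weylMul_wp, mul_zero]
  · intro k a h
    rw [weylMul_X_mul, symbolZero_X_mul, symbolZero_X_mul, h, mul_left_comm]

/-! Coordinate functions -/

/-- The coordinate function `q^j`. -/
def coord (j : Fin n) : Smooth n :=
  ⟨fun x => (x j : ℂ), (Complex.ofRealCLM.contDiff.comp (contDiff_apply ℝ ℝ j) :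
    ContDiff ℝ ∞ fun x : Fin n → ℝ => (x j : ℂ))⟩

theorem dq_coord (i j : Fin n) : dq i (coord j : Smooth n) = if i = j then 1 else 0 := by
  refine Smooth.ext fun x => ?_
  have h : HasFDerivAt (fun y : Fin n → ℝ => (y j : ℂ))
      (Complex.ofRealCLM.comp (ContinuousLinearMap.proj (R := ℝ) (φ := fun _ : Fin n => ℝ) j)) x :=
    (Complex.ofRealCLM.comp
      (ContinuousLinearMap.proj (R := ℝ) (φ := fun _ : Fin n => ℝ) j)).hasFDerivAt
  change fderiv ℝ (fun y : Fin n → ℝ => (y j : ℂ)) x (Pi.single i 1) = _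
  rw [h.fderiv]
  change (((Pi.single i 1 : Fin n → ℝ) j : ℝ) : ℂ) = _
  by_cases hij : i = j
  · subst hij
    rw [Pi.single_eq_same, if_pos rfl, Complex.ofReal_one]
    rfl
  · rw [Pi.single_eq_of_ne (Ne.symm hij), if_neg hij, Complex.ofReal_zero]
    rfl

theorem bd_one_piStar (f : Smooth n) (a : W n) :
    bd 1 (piStar n f) a = ∑ k : Fin n, piStar n (dq k f) * wdp k a := by
  rw [bd_succ]
  refine Finset.sum_congr rfl fun k _ => ?_
  rw [wdp_piStar, map_zero, LinearMap.zero_apply, sub_zero, wdq_piStar, bd_zero]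

theorem bd_coord (r : ℕ) (j : Fin n) (a : W n) : bd (r + 2) (piStar n (coord j)) a = 0 := by
  rw [bd_succ]
  refine Finset.sum_eq_zero fun k _ => ?_
  rw [wdp_piStar, map_zero, LinearMap.zero_apply, sub_zero, wdq_piStar, dq_coord]
  split_ifs
  · rw [piStar_one, bd_one_left]
  · simp

/-- A coordinate has constant derivatives, so the expansion stops at first order. This recovers
`∂/∂p_j` from the algebra structure. -/
theorem coord_weylMul_sub (j : Fin n) (a : W n) :
    weylMul (piStar n (coord j)) a - weylMul a (piStar n (coord j)) =
      PowerSeries.X * (Complex.I • wdp j a) := by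
  rw [weylMul_sub_swap_eq _ _ fun r => bd_coord r j a, bd_one_piStar, Finset.sum_eq_single j]
  · rw [dq_coord, if_pos rfl, piStar_one, one_mul]
  · intro k _ hk
    rw [dq_coord, if_neg hk, map_zero, zero_mul]
  · simp

/-! ### Faithfulness of the action on functions -/

theorem X_mul_injective {A : Type} [CommRing A] {a b : PowerSeries A}
    (h : PowerSeries.X * a = PowerSeries.X * b) : a = b := by
  ext1 k
  rw [← PowerSeries.coeff_succ_X_mul, h, PowerSeries.coeff_succ_X_mul]

/-- A homogeneous element that acts as the zero differential operator vanishes. -/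
theorem Homog.eq_zero_of_symbolZero {k : ℕ} {a : W n} (ha : Homog k a)
    (h : ∀ g, symbolZero (FormalStar.weylMul a (piStar n g)) = 0) : a = 0 := by
  induction k generalizing a with
  | zero =>
    have h1 := h 1
    rw [piStar_one, weylMul_one, ha.eq_piStar, symbolZero_piStar] at h1
    rw [ha.eq_piStar, PowerSeries.C_injective (h1.trans (map_zero _).symm), map_zero]
  | succ k ih =>
    -- The commutator of `a` with `q^j` also acts as zero; after cancelling `λ` it is a multiple of
    -- `∂a/∂p_j`, of lower degree.
    have hp : ∀ j, FormalStar.wdp j a = 0 := fun j => ih (ha.wdp j) fun g => by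
      have h1 : FormalStar.weylMul (PowerSeries.X * (Complex.I • FormalStar.wdp j a)) (piStar n g) =
          FormalStar.weylMul (piStar n (coord j)) (FormalStar.weylMul a (piStar n g)) -
            FormalStar.weylMul a (piStar n (coord j * g)) := by
        rw [← coord_weylMul_sub, sub_eq_add_neg, add_weylMul, ← neg_one_smul ℂ, smul_weylMul,
          weylMul_assoc, weylMul_assoc, piStar_weylMul_piStar, neg_one_smul, sub_eq_add_neg]
      have h2 := congrArg symbolZero h1
      rw [X_mul_weylMul, symbolZero_X_mul, symbolZero_sub, h,
        (ha.weylMul (homog_piStar g)).symbolZero_piStar_weylMul, h, mul_zero, sub_zero,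
        smul_weylMul, symbolZero_smul] at h2
      have h3 := X_mul_injective (h2.trans (mul_zero _).symm)
      exact (smul_eq_zero_iff_right Complex.I_ne_zero).1 h3
    -- With all `p`-derivatives zero, the Euler identity makes `a` divisible by `λ`, and the
    -- quotient again acts as zero.
    have he := ha.euler
    simp only [hp, mul_zero, Finset.sum_const_zero, zero_add, ← mul_smul_comm] at he
    rw [he, ih (a := ((k : ℂ) + 1)⁻¹ • FormalStar.wdl a) (DegIn.smul _ (Homog.wdl ha)) fun g => ?_, mul_zero]
    have h1 := h g
    rw [he, X_mul_weylMul, symbolZero_X_mul] at h1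
    exact X_mul_injective (h1.trans (mul_zero _).symm)

/-! Every differential operator has a symbol -/

theorem wp_weylMul_piStar (j : Fin n) (g : Smooth n) :
    weylMul (wp j) (piStar n g) =
      weylMul (piStar n g) (wp j) - PowerSeries.X * (Complex.I • piStar n (dq j g)) := by
  have h := weylMul_sub_swap_eq (piStar n g) (wp j) fun r => bd_wp r _ j
  rw [bd_one_wp, wdq_piStar] at h
  rw [← h, sub_sub_cancel]

/-- The element `w` of `𝒲` acts as the operator `λ^d φ`. -/
def ActsAs (d : ℕ) (φ : Module.End ℂ (Smooth n)) (w : W n) : Prop :=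
  Homog d w ∧ ∀ b g, symbolZero (weylMul b (weylMul w (piStar n g))) =
    PowerSeries.X ^ d * symbolZero (weylMul b (piStar n (φ g)))

/-- The arbitrary left factor `b` in `ActsAs` is what allows two actions to be composed by
associativity. -/
theorem ActsAs.mul {d e : ℕ} {φ ψ : Module.End ℂ (Smooth n)} {v w : W n} (hv : ActsAs d φ v)
    (hw : ActsAs e ψ w) : ActsAs (d + e) (φ * ψ) (weylMul v w) := by
  refine ⟨hv.1.weylMul hw.1, fun b g => ?_⟩
  rw [weylMul_assoc, ← weylMul_assoc b, hw.2, weylMul_assoc, hv.2, ← mul_assoc, ← pow_add,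
    add_comm e]
  rfl

theorem actsAs_one : ActsAs 0 1 (1 : W n) := by
  refine ⟨?_, fun b g => ?_⟩
  · rw [← piStar_one]
    exact homog_piStar 1
  · rw [one_weylMul, pow_zero, one_mul]
    rfl

/-- Moving `p_j` to the right past `g` leaves `-iλ ∂_j g` plus a term ending in `p_j`, which has
zero symbol; the factor `i` normalizes the result to `λ ∂_j`. -/
theorem actsAs_dq (j : Fin n) : ActsAs 1 (dq j) (Complex.I • wp j : W n) := by
  refine ⟨DegIn.smul _ (homog_wp j), fun b g => ?_⟩
  rw [smul_weylMul, wp_weylMul_piStar, smul_sub, ← mul_smul_comm, smul_smul, Complex.I_mul_I,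
    sub_eq_add_neg, weylMul_add, symbolZero_add, weylMul_smul, ← weylMul_assoc, symbolZero_smul,
    symbolZero_weylMul_wp, smul_zero, zero_add, neg_one_smul, mul_neg, neg_neg, weylMul_X_mul,
    symbolZero_X_mul, pow_one]

theorem exists_actsAs_dqPow (α : Fin n →₀ ℕ) : ∃ w : W n, ActsAs α.degree (dqPow α) w := by
  induction α using Finsupp.induction_linear with
  | zero => exact ⟨1, by rw [map_zero, dqPow_zero]; exact actsAs_one⟩
  | add α β hα hβ =>
    obtain ⟨v, hv⟩ := hα
    obtain ⟨w, hw⟩ := hβ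
    exact ⟨_, by rw [map_add, dqPow_add]; exact hv.mul hw⟩
  | single i m =>
    induction m with
    | zero => exact ⟨1, by rw [Finsupp.single_zero, map_zero, dqPow_zero]; exact actsAs_one⟩
    | succ m ih =>
      obtain ⟨v, hv⟩ := ih
      refine ⟨weylMul v (Complex.I • wp i), ?_⟩
      rw [Finsupp.single_add, map_add, dqPow_add, dqPow_single, Finsupp.degree_single i 1]
      exact hv.mul (actsAs_dq i)

theorem sub_weylMul (a b c : W n) : weylMul (a - b) c = weylMul a c - weylMul b c := by
  rw [eq_sub_iff_add_eq, ← add_weylMul, sub_add_cancel]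

theorem weylMul_sub (a b c : W n) : weylMul a (b - c) = weylMul a b - weylMul a c := by
  rw [eq_sub_iff_add_eq, ← weylMul_add, sub_add_cancel]

theorem sum_weylMul {ι : Type*} (s : Finset ι) (a : ι → W n) (b : W n) :
    weylMul (∑ i ∈ s, a i) b = ∑ i ∈ s, weylMul (a i) b :=
  map_sum (AddMonoidHom.mk' (fun a => weylMul a b) fun a c => add_weylMul a c b) a s

theorem X_pow_mul_weylMul (r : ℕ) (a b : W n) :
    weylMul (PowerSeries.X ^ r * a) b = PowerSeries.X ^ r * weylMul a b :=
  map_X_pow_mul (φ := AddMonoidHom.mk' (fun a => weylMul a b) fun a c => add_weylMul a c b)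
    (fun a => X_mul_weylMul a b) r a

/-! Hochschild cochains -/

/-- The Hochschild differential of a `1`-cochain. -/
def hoch (T : Smooth n → W n) (f g : Smooth n) : W n :=
  weylMul (piStar n f) (T g) - T (f * g) + weylMul (T f) (piStar n g)

theorem Homog.hoch {k : ℕ} {T : Smooth n → W n} (hT : ∀ f, Homog k (T f)) (f g : Smooth n) :
    Homog k (hoch T f g) := by
  have h1 := (homog_piStar f).weylMul (hT g)
  rw [zero_add] at h1
  exact (DegIn.sub h1 (hT _)).add ((hT f).weylMul (homog_piStar g))

theorem CoeffIn.toStd {Z : Type} {F : Submodule (Smooth n) (Z → Smooth n)} (hF : DqClosed F)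
    {a : Z → W n} (ha : CoeffIn F a) : CoeffIn F fun z => toStd (a z) := by
  refine CoeffIn.xsum fun s => CoeffIn.smul _ ?_
  induction s with
  | zero => simpa using ha
  | succ s ih =>
    simp only [lapl_pow_succ, lapl_apply]
    exact CoeffIn.sum fun i _ => (ih.wdp i).wdq hF i

/-- A bidifferential cocycle becomes the differential of a differential cochain after
multiplication by a power of `λ`. -/
theorem exists_hoch_eq_X_pow_mul {k : ℕ} {R : Smooth n → Smooth n → W n}
    (hR : ∀ f g, Homog k (R f g)) (hd : CoeffIn (bidiffOps n) fun p => R p.1 p.2)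
    (hc : ∀ f g h, weylMul (piStar n f) (R g h) - R (f * g) h + R f (g * h) =
      weylMul (R f g) (piStar n h)) :
    ∃ (N : ℕ) (T : Smooth n →ₗ[ℂ] W n), CoeffIn (diffOps n) T ∧ (∀ f, Homog (k + N) (T f)) ∧
      ∀ f g, hoch T f g = PowerSeries.X ^ N * R f g := by
  -- Up to the factor `λ^k`, this is the operator `R(f, g)` applied to the constant function `1`.
  let r : Smooth n → Smooth n → Smooth n := fun f g => PowerSeries.coeff k (symbolZero (R f g))
  have hr : ∀ f g, symbolZero (R f g) = PowerSeries.X ^ k * PowerSeries.C (r f g) :=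
    fun f g => (hR f g).symbolZero_eq
  have hrd : IsBidiffOp r := by
    rw [← mem_bidiffOps]
    simp only [r, coeff_symbolZero]
    exact CoeffIn.toStd dqClosed_bidiffOps hd k 0
  obtain ⟨a, ha⟩ := hrd
  choose w hw using exists_actsAs_dqPow (n := n)
  -- The order of `r` in its second argument. An operator of order `d` needs a factor `λ^d`, so
  -- `λ^(k+N)` suffices for all terms.
  let N := a.support.sup fun γ => γ.2.degree
  have hN : ∀ γ ∈ a.support, γ.2.degree ≤ N := fun γ hγ =>
    Finset.le_sup (f := fun γ : (Fin n →₀ ℕ) × (Fin n →₀ ℕ) => γ.2.degree) hγ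
  -- The element `T f` acts as `g ↦ λ^(k+N) r(f, g)`, the contracting homotopy.
  let T : Smooth n →ₗ[ℂ] W n :=
    { toFun := fun f => ∑ γ ∈ a.support, PowerSeries.X ^ (k + N - γ.2.degree) *
        weylMul (piStar n (a γ * dqPow γ.1 f)) (w γ.2)
      map_add' := fun f g => by
        simp only [map_add, mul_add, add_weylMul, Finset.sum_add_distrib]
      map_smul' := fun c f => by
        simp only [map_smul, mul_smul_comm, smul_weylMul, ← Finset.smul_sum, RingHom.id_apply] }
  have hT : ∀ f, T f = ∑ γ ∈ a.support, PowerSeries.X ^ (k + N - γ.2.degree) *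
        weylMul (piStar n (a γ * dqPow γ.1 f)) (w γ.2) := fun _ => rfl
  have hTh : ∀ f, Homog (k + N) (T f) := fun f => by
    refine DegIn.sum fun γ hγ => ?_
    have h := ((homog_piStar (a γ * dqPow γ.1 f)).weylMul (hw γ.2).1).X_pow_mul
      (k + N - γ.2.degree)
    have h' := hN γ hγ
    rwa [zero_add, add_tsub_cancel_of_le (by omega)] at h
  have hTs : ∀ f g, symbolZero (weylMul (T f) (piStar n g)) =
      PowerSeries.X ^ (k + N) * PowerSeries.C (r f g) := fun f g => by
    rw [hT, sum_weylMul, symbolZero_sum, ha, Finsupp.sum, map_sum, Finset.mul_sum]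
    refine Finset.sum_congr rfl fun γ hγ => ?_
    have h' := hN γ hγ
    rw [X_pow_mul_weylMul, symbolZero_X_pow_mul, weylMul_assoc, (hw γ.2).2, ← mul_assoc, ← pow_add,
      tsub_add_cancel_of_le (by omega), piStar_weylMul_piStar, symbolZero_piStar]
  refine ⟨N, T, ?_, hTh, fun f g => ?_⟩
  · refine CoeffIn.sum fun γ _ => CoeffIn.X_pow_mul _ ?_
    refine CoeffIn.weylMul_const dqClosed_diffOps (CoeffIn.piStar ?_) _
    exact Submodule.smul_mem _ (a γ) (Submodule.subset_span ⟨γ.1, rfl⟩)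
  · have hh : Homog (k + N) (hoch T f g - PowerSeries.X ^ N * R f g) :=
      (Homog.hoch hTh f g).sub ((hR f g).X_pow_mul N)
    -- By faithfulness it is enough to apply both sides to a function `h`; the cocycle identity
    -- applied to `1` is the resulting equation.
    refine sub_eq_zero.1 (hh.eq_zero_of_symbolZero fun h => ?_)
    have h1 := congrArg symbolZero (hc f g h)
    rw [symbolZero_add, symbolZero_sub, (hR g h).symbolZero_piStar_weylMul, hr, hr, hr] at h1
    rw [sub_weylMul, X_pow_mul_weylMul, symbolZero_sub, symbolZero_X_pow_mul, ← h1, hoch,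
      add_weylMul, sub_weylMul, symbolZero_add, symbolZero_sub, weylMul_assoc, weylMul_assoc,
      piStar_weylMul_piStar,
      ((hTh g).weylMul (homog_piStar h)).symbolZero_piStar_weylMul, hTs, hTs, hTs, pow_add]
    ring

/-! Derivations that are differential operators -/

/-- The differential operator with a given polynomial symbol. -/
def opOfSymbol : MvPolynomial (Fin n) (Smooth n) →ₗ[Smooth n] Smooth n → Smooth n :=
  (MvPolynomial.basisMonomials (Fin n) (Smooth n)).constr (Smooth n) fun α f => dqPow α f

theorem opOfSymbol_monomial (α : Fin n →₀ ℕ) (c f : Smooth n) :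
    opOfSymbol (MvPolynomial.monomial α c) f = c * dqPow α f := by
  have h : (MvPolynomial.monomial α c : MvPolynomial (Fin n) (Smooth n)) =
      c • MvPolynomial.basisMonomials (Fin n) (Smooth n) α := by
    rw [MvPolynomial.coe_basisMonomials, MvPolynomial.smul_monomial, smul_eq_mul, mul_one]
  rw [h, map_smul, opOfSymbol, Module.Basis.constr_basis]
  rfl

theorem exists_opOfSymbol {D : Smooth n → Smooth n} (hD : D ∈ diffOps n) :
    ∃ s, opOfSymbol s = D := by
  induction hD using Submodule.span_induction with
  | mem D hD =>
    obtain ⟨α, rfl⟩ := hD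
    refine ⟨MvPolynomial.monomial α 1, ?_⟩
    funext f
    rw [opOfSymbol_monomial, one_mul]
  | zero => exact ⟨0, map_zero _⟩
  | add D E _ _ h h' =>
    obtain ⟨s, rfl⟩ := h
    obtain ⟨t, rfl⟩ := h'
    exact ⟨s + t, map_add _ _ _⟩
  | smul c D _ h =>
    obtain ⟨s, rfl⟩ := h
    exact ⟨c • s, map_smul _ _ _⟩

/-- Leibniz rule for a factor with constant derivatives. For `α i = 0` the truncated exponent is
harmless because its coefficient is zero. -/
theorem dqPow_coord_mul (i : Fin n) (α : Fin n →₀ ℕ) (f : Smooth n) :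
    dqPow α (coord i * f) =
      coord i * dqPow α f + (α i : Smooth n) * dqPow (α - Finsupp.single i 1) f := by
  classical
  induction α using Finsupp.induction_linear generalizing f with
  | zero => simp [dqPow_zero]
  | add α β hα hβ =>
    rw [dqPow_add, Module.End.mul_apply, hβ, map_add, hα, Module.End.mul_apply,
      ← nsmul_eq_mul (β i), map_nsmul, nsmul_eq_mul, ← Module.End.mul_apply, ← Module.End.mul_apply,
      ← dqPow_add, ← dqPow_add, Finsupp.add_apply, add_assoc]
    congr 1
    by_cases h1 : α i = 0
    · by_cases h2 : β i = 0
      · simp [h1, h2]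
      · have : α + β - Finsupp.single i 1 = α + (β - Finsupp.single i 1) :=
          (add_tsub_assoc_of_le (Finsupp.single_le_iff.2 (Nat.one_le_iff_ne_zero.2 h2)) _)
        simp [h1, this, dqPow_add]
    · have e1 : α + β - Finsupp.single i 1 = α - Finsupp.single i 1 + β :=
        (tsub_add_eq_add_tsub (Finsupp.single_le_iff.2 (Nat.one_le_iff_ne_zero.2 h1))).symm
      by_cases h2 : β i = 0
      · simp [h2, e1]
      · have e2 : α + β - Finsupp.single i 1 = α + (β - Finsupp.single i 1) :=
          (add_tsub_assoc_of_le (Finsupp.single_le_iff.2 (Nat.one_le_iff_ne_zero.2 h2)) _)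
        have e3 : dqPow α (dqPow (β - Finsupp.single i 1) f) =
            dqPow (α + β - Finsupp.single i 1) f := by
          rw [e2, dqPow_add]
          rfl
        rw [e3, ← e1]
        push_cast
        ring
  | single j m =>
    induction m generalizing f with
    | zero => simp [dqPow_zero]
    | succ m ih =>
      have hs : ∀ g, dqPow (Finsupp.single j (m + 1)) g = dqPow (Finsupp.single j m) (dq j g) :=
        fun g => by rw [Finsupp.single_add, dqPow_add, dqPow_single]; rfl
      rw [hs, dq_mul, map_add, ih, hs, dq_coord]
      by_cases hij : j = i
      · subst hij
        rw [if_pos rfl, one_mul]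
        simp only [Finsupp.single_eq_same, ← Finsupp.single_tsub, Nat.add_sub_cancel]
        cases m with
        | zero => simp; ring
        | succ m =>
          have : dqPow (Finsupp.single j m) (dq j f) = dqPow (Finsupp.single j (m + 1)) f := by
            rw [Finsupp.single_add, dqPow_add, dqPow_single]; rfl
          rw [Nat.add_sub_cancel, this]
          push_cast
          ring
      · simp [hij]

theorem opOfSymbol_coord_mul (i : Fin n) (s : MvPolynomial (Fin n) (Smooth n)) (f : Smooth n) :
    opOfSymbol s (coord i * f) =
      coord i * opOfSymbol s f + opOfSymbol (MvPolynomial.pderiv i s) f := by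
  induction s using MvPolynomial.induction_on' with
  | monomial α c =>
    rw [MvPolynomial.pderiv_monomial, opOfSymbol_monomial, opOfSymbol_monomial,
      opOfSymbol_monomial, dqPow_coord_mul]
    ring
  | add p q hp hq =>
    simp only [map_add, Pi.add_apply, hp, hq]
    ring

theorem smooth_natCast_mul_eq_zero {k : ℕ} {f : Smooth n} (h : f * ((k : Smooth n) + 1) = 0) :
    f = 0 := by
  have h' := natCast_smul_smooth (k + 1) f
  push_cast at h'
  rw [h] at h'
  exact (smul_eq_zero_iff_right (by exact_mod_cast Nat.succ_ne_zero k)).1 h'.symm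

theorem eq_C_of_pderiv_eq_zero {s : MvPolynomial (Fin n) (Smooth n)}
    (h : ∀ i, MvPolynomial.pderiv i s = 0) : s = MvPolynomial.C (MvPolynomial.coeff 0 s) := by
  classical
  ext1 α
  rw [MvPolynomial.coeff_C]
  split_ifs with hα
  · rw [hα]
  · obtain ⟨i, hi⟩ : ∃ i, α i ≠ 0 := by
      by_contra hne
      push Not at hne
      exact hα (Finsupp.ext hne).symm
    have h1 := congrArg (MvPolynomial.coeff (α - Finsupp.single i 1)) (h i)
    rw [MvPolynomial.coeff_pderiv, tsub_add_cancel_of_le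
      (Finsupp.single_le_iff.2 (Nat.one_le_iff_ne_zero.2 hi)), MvPolynomial.coeff_zero] at h1
    exact smooth_natCast_mul_eq_zero h1

theorem opOfSymbol_C (c f : Smooth n) : opOfSymbol (MvPolynomial.C c) f = c * f := by
  rw [MvPolynomial.C_apply, opOfSymbol_monomial, dqPow_zero]
  rfl

/-- Commuting with `q^i` differentiates the symbol and lowers its order, so by induction all
derivatives of the symbol vanish. The remaining constant symbol is detected on the function `1`. -/
theorem opOfSymbol_injective {s : MvPolynomial (Fin n) (Smooth n)}
    (h : ∀ f, opOfSymbol s f = 0) : s = 0 := by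
  suffices key : ∀ (d : ℕ) (s : MvPolynomial (Fin n) (Smooth n)),
      (∀ α : Fin n →₀ ℕ, d ≤ α.degree → MvPolynomial.coeff α s = 0) →
      (∀ f, opOfSymbol s f = 0) → s = 0 by
    refine key (s.support.sup (fun α => α.degree) + 1) s (fun α hα => ?_) h
    by_contra hne
    have := (Finset.le_sup (f := fun α : Fin n →₀ ℕ => α.degree) (MvPolynomial.mem_support_iff.2 hne))
    change α.degree ≤ s.support.sup (fun α => α.degree) at this
    omega
  intro d
  induction d with
  | zero => exact fun s hs _ => MvPolynomial.ext _ _ fun α => hs α (Nat.zero_le _)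
  | succ d ih =>
    intro s hs h
    have hp : ∀ i, MvPolynomial.pderiv i s = 0 := fun i => by
      refine ih _ (fun α hα => ?_) fun f => ?_
      · rw [MvPolynomial.coeff_pderiv, hs, zero_mul]
        rw [map_add, Finsupp.degree_single]
        omega
      · have h1 := opOfSymbol_coord_mul i s f
        rwa [h, h, mul_zero, zero_add, eq_comm] at h1
    have h1 := h 1
    rw [eq_C_of_pderiv_eq_zero hp, opOfSymbol_C, mul_one] at h1
    rw [eq_C_of_pderiv_eq_zero hp, h1, map_zero]

/-- A derivation of `C^∞(ℝⁿ)` that is a differential operator is a vector field. -/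
theorem derivation_eq_sum {D : Smooth n → Smooth n} (hD : D ∈ diffOps n)
    (hmul : ∀ f g, D (f * g) = f * D g + D f * g) (f : Smooth n) :
    D f = ∑ i : Fin n, D (coord i) * dq i f := by
  classical
  -- The difference from the expected vector field commutes with all coordinates, so its symbol is
  -- constant in the fibre variables; since `E 1 = 0`, it vanishes.
  let E : Smooth n → Smooth n := D - ∑ i : Fin n, D (coord i) • fun f => dq i f
  have hE : E ∈ diffOps n := by
    refine Submodule.sub_mem _ hD (Submodule.sum_mem _ fun i _ => Submodule.smul_mem _ _ ?_)
    exact Submodule.subset_span ⟨Finsupp.single i 1, by simp only [dqPow_single]⟩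
  have hEf : ∀ f, E f = D f - ∑ i : Fin n, D (coord i) * dq i f := fun f => by
    simp [E, Finset.sum_apply]
  have hEcoord : ∀ i f, E (coord i * f) = coord i * E f := fun i f => by
    have h : ∀ j, D (coord j) * dq j (coord i * f) =
        (if j = i then D (coord j) * f else 0) + coord i * (D (coord j) * dq j f) := fun j => by
      rw [dq_mul, dq_coord]
      split_ifs <;> ring
    rw [hEf, hEf, hmul]
    simp only [h, Finset.sum_add_distrib, ← Finset.mul_sum]
    simp
    ring
  have hE1 : E 1 = 0 := by
    have h1 := hmul 1 1
    rw [mul_one, mul_one, one_mul] at h1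
    rw [hEf, left_eq_add.1 h1]
    simp [dq_one]
  obtain ⟨s, hs⟩ := exists_opOfSymbol hE
  have hp : ∀ i, MvPolynomial.pderiv i s = 0 := fun i => opOfSymbol_injective fun f => by
    have h1 := opOfSymbol_coord_mul i s f
    rwa [hs, hEcoord, left_eq_add] at h1
  have hEc : ∀ f, E f = MvPolynomial.coeff 0 s * f := fun f => by
    rw [← hs, eq_C_of_pderiv_eq_zero hp, opOfSymbol_C]
    simp
  have h0 : MvPolynomial.coeff 0 s = 0 := by
    have h1 := hEc 1
    rwa [hE1, mul_one, eq_comm] at h1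
  have h2 := hEc f
  rw [h0, zero_mul, hEf] at h2
  exact sub_eq_zero.1 h2

/-! The commutator divided by `λ` -/

/-- The commutator of the Weyl-Moyal product divided by `λ`. -/
def weylBracket (a b : W n) : W n :=
  xsum fun r => ((1 - (-1) ^ (r + 1)) * weylConst (r + 1)) • bd (r + 1) a b

/-- The terms of order zero cancel because the undeformed product is commutative. -/
theorem X_mul_weylBracket (a b : W n) :
    PowerSeries.X * weylBracket a b = weylMul a b - weylMul b a := by
  rw [weylMul_swap_eq a b, weylMul_eq_xsum a b, xsum_eq_add fun r => weylConst r • bd r a b,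
    xsum_eq_add fun r => ((-1) ^ r * weylConst r) • bd r a b, weylBracket]
  simp only [sub_mul, one_mul, sub_smul]
  rw [pow_zero, one_mul, add_sub_add_left_eq_sub, ← mul_sub]
  congr 1
  rw [eq_sub_iff_add_eq, ← xsum_add]
  simp only [sub_add_cancel]

theorem wcoeff_zero_weylBracket (α : Fin n →₀ ℕ) (a b : W n) :
    wcoeff 0 α (weylBracket a b) = Complex.I • wcoeff 0 α (bd 1 a b) := by
  rw [weylBracket, wcoeff_xsum, Finset.Nat.antidiagonal_zero, Finset.sum_singleton, wcoeff_smul]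
  congr 1
  rw [zero_add, weylConst_one, pow_one]
  ring

theorem wcoeff_zero_mul (α : Fin n →₀ ℕ) (a b : W n) :
    wcoeff 0 α (a * b) = ∑ y ∈ Finset.HasAntidiagonal.antidiagonal α,
      wcoeff 0 y.1 a * wcoeff 0 y.2 b := by
  rw [wcoeff_mul, Finset.Nat.antidiagonal_zero, Finset.sum_singleton]

theorem wcoeff_zero_weylMul (α : Fin n →₀ ℕ) (a b : W n) :
    wcoeff 0 α (weylMul a b) = wcoeff 0 α (a * b) := by
  rw [weylMul_eq_xsum, wcoeff_xsum, Finset.Nat.antidiagonal_zero, Finset.sum_singleton, weylConst_zero,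
    one_smul, bd_zero]

theorem wcoeff_piStar_mul (r : ℕ) (α : Fin n →₀ ℕ) (f : Smooth n) (a : W n) :
    wcoeff r α (piStar n f * a) = f * wcoeff r α a := by
  change MvPowerSeries.coeff α (PowerSeries.coeff r
    (PowerSeries.C (MvPowerSeries.C f) * a)) = _
  rw [PowerSeries.coeff_C_mul, MvPowerSeries.coeff_C_mul]
  rfl

theorem wcoeff_zero_bd_one_piStar (α : Fin n →₀ ℕ) (f : Smooth n) (a : W n) :
    wcoeff 0 α (bd 1 (piStar n f) a) = ∑ k : Fin n, dq k f * wcoeff 0 α (wdp k a) := by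
  rw [bd_one_piStar, wcoeff_sum]
  simp only [wcoeff_piStar_mul]

theorem wcoeff_zero_bd_one_coord (α : Fin n →₀ ℕ) (j : Fin n) (a : W n) :
    wcoeff 0 α (bd 1 (piStar n (coord j)) a) = wcoeff 0 α (wdp j a) := by
  rw [wcoeff_zero_bd_one_piStar, Finset.sum_eq_single j]
  · rw [dq_coord, if_pos rfl, one_mul]
  · intro k _ hk
    rw [dq_coord, if_neg hk, zero_mul]
  · simp

/-! Division by `λ` -/

/-- The quotient of a series by `λ`, discarding the constant term. -/
def divX (a : W n) : W n := PowerSeries.mk fun r => PowerSeries.coeff (r + 1) a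

theorem wcoeff_divX (r : ℕ) (α : Fin n →₀ ℕ) (a : W n) :
    wcoeff r α (divX a) = wcoeff (r + 1) α a := by
  rw [wcoeff, divX, PowerSeries.coeff_mk, wcoeff]

theorem X_mul_divX {a : W n} (ha : ∀ α, wcoeff 0 α a = 0) : PowerSeries.X * divX a = a :=
  wcoeff_ext fun r α => by
    cases r with
    | zero => rw [wcoeff_zero_X_mul, ha]
    | succ r => rw [wcoeff_succ_X_mul, wcoeff_divX]

theorem CoeffIn.divX {Z : Type} {F : Submodule (Smooth n) (Z → Smooth n)} {a : Z → W n}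
    (ha : CoeffIn F a) : CoeffIn F fun z => divX (a z) := fun r α => by
  simp only [wcoeff_divX]
  exact ha (r + 1) α

/-! Primitives of cocycles -/

theorem hoch_add (T U : Smooth n → W n) (f g : Smooth n) :
    hoch (fun f => T f + U f) f g = hoch T f g + hoch U f g := by
  simp only [hoch, weylMul_add, add_weylMul]
  abel

theorem hoch_smul (c : ℂ) (T : Smooth n → W n) (f g : Smooth n) :
    hoch (fun f => c • T f) f g = c • hoch T f g := by
  simp only [hoch, weylMul_smul, smul_weylMul, smul_add, smul_sub]

theorem hoch_X_mul (T : Smooth n → W n) (f g : Smooth n) :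
    hoch (fun f => PowerSeries.X * T f) f g = PowerSeries.X * hoch T f g := by
  simp only [hoch, weylMul_X_mul, X_mul_weylMul, mul_add, mul_sub]

/-- After multiplication by `λ` this is an inner derivation, hence closed, and `λ` can be cancelled.
-/
theorem hoch_weylBracket (S : W n) (f g : Smooth n) :
    hoch (fun f => weylBracket (piStar n f) S) f g = 0 := by
  refine X_mul_injective ?_
  rw [← hoch_X_mul, mul_zero]
  simp only [X_mul_weylBracket, hoch, weylMul_sub, sub_weylMul, ← piStar_weylMul_piStar,
    weylMul_assoc]
  abel

/-- Antisymmetrizing the differential removes `T (f * g)` and leaves only commutators. On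
coordinates, this gives the closedness of a one-form in `p`. -/
theorem weylBracket_piStar_sub (T : Smooth n → W n) (f g : Smooth n) :
    PowerSeries.X * (weylBracket (piStar n f) (T g) - weylBracket (piStar n g) (T f)) =
      hoch T f g - hoch T g f := by
  rw [mul_sub, X_mul_weylBracket, X_mul_weylBracket, hoch, hoch, mul_comm f g]
  abel

theorem wcoeff_zero_hoch (α : Fin n →₀ ℕ) (T : Smooth n → W n) (f g : Smooth n) :
    wcoeff 0 α (hoch T f g) = f * wcoeff 0 α (T g) - wcoeff 0 α (T (f * g)) +
      wcoeff 0 α (T f) * g := by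
  rw [hoch, wcoeff_add, wcoeff_sub, wcoeff_zero_weylMul, wcoeff_zero_weylMul, wcoeff_piStar_mul,
    mul_comm (T f), wcoeff_piStar_mul, mul_comm g]

/-- If the differential of a homogeneous differential cochain is divisible by `λ`, and the quotient
is symmetric modulo `λ`, then the quotient is itself the differential of such a cochain. -/
theorem exists_hoch_eq_of_X_mul {k : ℕ} {T : Smooth n →ₗ[ℂ] W n} (hT : CoeffIn (diffOps n) T)
    (hTh : ∀ f, Homog (k + 1) (T f)) {R : Smooth n → Smooth n → W n}
    (hTR : ∀ f g, hoch T f g = PowerSeries.X * R f g)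
    (hs : ∀ α f g, wcoeff 0 α (R f g) = wcoeff 0 α (R g f)) :
    ∃ U : Smooth n →ₗ[ℂ] W n, CoeffIn (diffOps n) U ∧ (∀ f, Homog k (U f)) ∧
      ∀ f g, hoch U f g = R f g := by
  classical
  -- Modulo `λ` the differential of `T` vanishes and the two module actions coincide, so each
  -- coefficient of `T` is a derivation.
  have hder : ∀ α f, wcoeff 0 α (T f) = ∑ i : Fin n, wcoeff 0 α (T (coord i)) * dq i f :=
    fun α f => by
      refine derivation_eq_sum (D := fun f => wcoeff 0 α (T f)) (hT 0 α) (fun f g => ?_) f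
      have h := wcoeff_zero_hoch α T f g
      rw [hTR, wcoeff_zero_X_mul] at h
      change wcoeff 0 α (T (f * g)) = f * wcoeff 0 α (T g) + wcoeff 0 α (T f) * g
      linear_combination h
  -- The one-form `∑ T(q^i) dp_i` is closed modulo `λ`, by the symmetry of `R`.
  have hsym : ∀ α i j, wcoeff 0 α (wdp j (T (coord i))) = wcoeff 0 α (wdp i (T (coord j))) :=
    fun α i j => by
      have h : weylBracket (piStar n (coord j)) (T (coord i)) -
          weylBracket (piStar n (coord i)) (T (coord j)) =
          R (coord j) (coord i) - R (coord i) (coord j) := by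
        refine X_mul_injective ?_
        rw [weylBracket_piStar_sub, hTR, hTR, mul_sub]
      have h1 := congrArg (wcoeff 0 α) h
      rw [wcoeff_sub, wcoeff_sub, hs α (coord j), sub_self, wcoeff_zero_weylBracket,
        wcoeff_zero_weylBracket, wcoeff_zero_bd_one_coord, wcoeff_zero_bd_one_coord,
        ← smul_sub] at h1
      exact sub_eq_zero.1 ((smul_eq_zero_iff_right Complex.I_ne_zero).1 h1)
  -- The potential from the Poincaré lemma for homogeneous forms: the coefficients have degree `k +
  -- 1`, so the potential has degree `k + 2`, which is the normalizing factor.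
  let S : W n := ((k : ℂ) + 2)⁻¹ • ∑ i : Fin n, wp i * T (coord i)
  have hSh : Homog (k + 2) S := by
    refine DegIn.smul _ (DegIn.sum fun i _ => ?_)
    refine DegIn.mul (fun a ha b hb => ?_) (homog_wp i) (hTh (coord i))
    rw [Set.mem_singleton_iff] at ha hb ⊢
    rw [ha, hb]
    push_cast
    ring
  have hS : ∀ α j, wcoeff 0 α (wdp j S) = wcoeff 0 α (T (coord j)) := fun α j => by
    have h1 : ∀ i, wcoeff 0 α (wdp j (wp i * T (coord i))) =
        (if i = j then wcoeff 0 α (T (coord i)) else 0) +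
          wcoeff 0 α (wp i * wdp i (T (coord j))) := fun i => by
      have e : wcoeff 0 α (wp i * wdp j (T (coord i))) =
          wcoeff 0 α (wp i * wdp i (T (coord j))) := by
        rw [wcoeff_zero_mul, wcoeff_zero_mul]
        exact Finset.sum_congr rfl fun y _ => by rw [hsym]
      rw [wdp_mul, wdp_wp, wcoeff_add, e]
      simp only [eq_comm (a := j)]
      split_ifs
      · rw [one_mul]
      · rw [zero_mul, wcoeff_zero]
    have h2 := congrArg (wcoeff 0 α) (hTh (coord j)).degMap_eq_smul
    rw [degMap_eq, wcoeff_add, wcoeff_zero_X_mul, add_zero, wcoeff_sum, wcoeff_smul] at h2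
    simp only [S, map_smul, map_sum, wcoeff_smul, wcoeff_sum, h1, Finset.sum_add_distrib, h2]
    rw [Finset.sum_ite_eq' Finset.univ j, if_pos (Finset.mem_univ j), smul_add, smul_smul,
      ← one_smul ℂ (wcoeff 0 α (T (coord j))), smul_smul, smul_smul, ← add_smul]
    congr 1
    have : (k : ℂ) + 2 ≠ 0 := by exact_mod_cast Nat.succ_ne_zero (k + 1)
    push_cast
    field_simp
    ring
  clear_value S
  -- At order `λ^0` the added derivation equals `i² ∑ ∂_j f ∂S/∂p_j = -∑ T(q^j) ∂_j f` and cancels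
  -- `T f`.
  let V : Smooth n → W n := fun f => T f + Complex.I • weylBracket (piStar n f) S
  have hXV : ∀ f, PowerSeries.X * V f = PowerSeries.X * T f +
      Complex.I • (weylMul (piStar n f) S - weylMul S (piStar n f)) := fun f => by
    rw [← X_mul_weylBracket, mul_add, mul_smul_comm]
  have hV0 : ∀ f α, wcoeff 0 α (V f) = 0 := fun f α => by
    rw [wcoeff_add, wcoeff_smul, wcoeff_zero_weylBracket, smul_smul, Complex.I_mul_I,
      wcoeff_zero_bd_one_piStar, hder, neg_one_smul, ← sub_eq_add_neg, sub_eq_zero]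
    exact Finset.sum_congr rfl fun i _ => by rw [hS, mul_comm]
  have hVadd : ∀ f g, V (f + g) = V f + V g := fun f g => by
    refine X_mul_injective ?_
    rw [hXV (f + g), mul_add _ (V f), hXV f, hXV g, map_add, map_add, add_weylMul, weylMul_add, mul_add]
    module
  have hVsmul : ∀ (c : ℂ) f, V (c • f) = c • V f := fun c f => by
    refine X_mul_injective ?_
    rw [hXV (c • f), mul_smul_comm c _ (V f), hXV f, map_smul, map_smul, smul_weylMul, weylMul_smul,
      mul_smul_comm]
    module
  have hVh : ∀ f, Homog (k + 1) (V f) := fun f => by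
    refine Homog.of_X_mul ?_
    rw [hXV]
    have h1 := (homog_piStar f).weylMul hSh
    rw [zero_add] at h1
    exact (hTh f).X_mul.add (DegIn.smul _ (h1.sub (hSh.weylMul (homog_piStar f))))
  have hVd : CoeffIn (diffOps n) V := by
    have h1 : CoeffIn (diffOps n) fun f => PowerSeries.X * V f := by
      simp only [hXV]
      have h2 := hT.X_pow_mul 1
      rw [pow_one] at h2
      exact h2.add (((CoeffIn.weylMul_const dqClosed_diffOps (CoeffIn.piStar id_mem_diffOps) S).sub
        (CoeffIn.const_weylMul dqClosed_diffOps (CoeffIn.piStar id_mem_diffOps) S)).smul _)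
    intro r α
    simpa only [wcoeff_succ_X_mul] using h1 (r + 1) α
  have hXU : ∀ f, PowerSeries.X * divX (V f) = V f := fun f => X_mul_divX (hV0 f)
  let U : Smooth n →ₗ[ℂ] W n :=
    { toFun := fun f => divX (V f)
      map_add' := fun f g => X_mul_injective (by rw [mul_add, hXU, hXU, hXU, hVadd])
      map_smul' := fun c f => X_mul_injective (by
        rw [RingHom.id_apply, mul_smul_comm, hXU, hXU, hVsmul]) }
  refine ⟨U, hVd.divX, fun f => Homog.of_X_mul ?_, fun f g => X_mul_injective ?_⟩
  · change Homog _ (PowerSeries.X * divX (V f))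
    rw [hXU]
    exact hVh f
  · rw [← hoch_X_mul]
    change hoch (fun f => PowerSeries.X * divX (V f)) f g = _
    simp only [hXU]
    rw [← hTR]
    simp only [V]
    rw [hoch_add, hoch_smul, hoch_weylBracket, smul_zero, add_zero]

/-- A homogeneous bidifferential cocycle that is symmetric modulo `λ` is the differential of
a homogeneous differential cochain. -/
theorem exists_hoch_eq {k : ℕ} {R : Smooth n → Smooth n → W n}
    (hR : ∀ f g, Homog k (R f g)) (hd : CoeffIn (bidiffOps n) fun p => R p.1 p.2)
    (hc : ∀ f g h, weylMul (piStar n f) (R g h) - R (f * g) h + R f (g * h) =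
      weylMul (R f g) (piStar n h))
    (hs : ∀ α f g, wcoeff 0 α (R f g) = wcoeff 0 α (R g f)) :
    ∃ U : Smooth n →ₗ[ℂ] W n, CoeffIn (diffOps n) U ∧ (∀ f, Homog k (U f)) ∧
      ∀ f g, hoch U f g = R f g := by
  obtain ⟨N, T, hT, hTh, hTR⟩ := exists_hoch_eq_X_pow_mul hR hd hc
  -- Each round removes one `λ`, with `λ^N R` in the role of the quotient; it is symmetric modulo
  -- `λ` by assumption for `N = 0` and because it vanishes there otherwise.
  induction N generalizing T with
  | zero => exact ⟨T, hT, hTh, fun f g => by rw [hTR, pow_zero, one_mul]⟩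
  | succ N ih =>
    obtain ⟨U, hU, hUh, hUR⟩ := exists_hoch_eq_of_X_mul (k := k + N) hT hTh
      (R := fun f g => PowerSeries.X ^ N * R f g)
      (fun f g => by rw [hTR, pow_succ', mul_assoc]) fun α f g => by
        rw [wcoeff_X_pow_mul, wcoeff_X_pow_mul]
        split_ifs
        · rw [Nat.zero_sub]
          exact hs α f g
        · rfl
    exact ih U hU hUh hUR

section

/-! Bilinearity of the star product -/

theorem formalMul_eq_xsum (C : ℕ → Smooth n →ₗ[ℂ] Smooth n →ₗ[ℂ] Smooth n)
    (F G : PowerSeries (Smooth n)) :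
    formalMul C F G = xsum fun r => PowerSeries.mk fun m =>
      ∑ y ∈ Finset.HasAntidiagonal.antidiagonal m,
        C r (PowerSeries.coeff y.1 F) (PowerSeries.coeff y.2 G) := by
  ext1 m
  simp only [formalMul, coeff_xsum, PowerSeries.coeff_mk]

theorem coeff_formalMul (C : ℕ → Smooth n →ₗ[ℂ] Smooth n →ₗ[ℂ] Smooth n)
    (F G : PowerSeries (Smooth n)) (m : ℕ) :
    PowerSeries.coeff m (formalMul C F G) = ∑ x ∈ Finset.HasAntidiagonal.antidiagonal m,
      ∑ y ∈ Finset.HasAntidiagonal.antidiagonal x.2,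
        C x.1 (PowerSeries.coeff y.1 F) (PowerSeries.coeff y.2 G) := by
  rw [formalMul, PowerSeries.coeff_mk]

namespace StarProduct

variable {P : PoissonStructure n} (S : StarProduct P)

theorem add_mul (F G H : PowerSeries (Smooth n)) : S.mul (F + G) H = S.mul F H + S.mul G H := by
  ext1 m
  simp only [mul, map_add, coeff_formalMul, LinearMap.add_apply, Finset.sum_add_distrib]

theorem mul_add (F G H : PowerSeries (Smooth n)) : S.mul F (G + H) = S.mul F G + S.mul F H := by
  ext1 m
  simp only [mul, map_add, coeff_formalMul, Finset.sum_add_distrib]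

theorem X_mul_mul (F G : PowerSeries (Smooth n)) :
    S.mul (PowerSeries.X * F) G = PowerSeries.X * S.mul F G := by
  simp only [mul, formalMul_eq_xsum]
  rw [← xsum_X_mul]
  congr 1
  funext r
  ext1 m
  cases m with
  | zero => simp
  | succ m =>
    rw [PowerSeries.coeff_succ_X_mul, PowerSeries.coeff_mk, PowerSeries.coeff_mk,
      Finset.Nat.sum_antidiagonal_succ]
    simp [PowerSeries.coeff_succ_X_mul]

theorem mul_X_mul (F G : PowerSeries (Smooth n)) :
    S.mul F (PowerSeries.X * G) = PowerSeries.X * S.mul F G := by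
  simp only [mul, formalMul_eq_xsum]
  rw [← xsum_X_mul]
  congr 1
  funext r
  ext1 m
  cases m with
  | zero => simp
  | succ m =>
    rw [PowerSeries.coeff_succ_X_mul, PowerSeries.coeff_mk, PowerSeries.coeff_mk,
      Finset.Nat.sum_antidiagonal_succ']
    simp [PowerSeries.coeff_succ_X_mul]

theorem coeff_C_mul_C (r : ℕ) (f g : Smooth n) :
    PowerSeries.coeff r (S.mul (PowerSeries.C f) (PowerSeries.C g)) = S.C r f g := by
  rw [mul, coeff_formalMul, Finset.sum_eq_single (r, 0)]
  · simp
  · rintro ⟨a, b⟩ h hne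
    rw [Finset.HasAntidiagonal.mem_antidiagonal] at h
    have hb : b ≠ 0 := by
      rintro rfl
      exact hne (by simp at h; rw [h])
    refine Finset.sum_eq_zero fun y hy => ?_
    rw [Finset.HasAntidiagonal.mem_antidiagonal] at hy
    simp only at hy
    by_cases h1 : y.1 = 0
    · have h2 : y.2 ≠ 0 := by omega
      rw [PowerSeries.coeff_C (n := y.2), if_neg h2, map_zero]
    · rw [PowerSeries.coeff_C (n := y.1), if_neg h1, map_zero, LinearMap.zero_apply]
  · intro h
    simp at h

theorem coeff_zero_mul (F G : PowerSeries (Smooth n)) :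
    PowerSeries.coeff 0 (S.mul F G) = PowerSeries.coeff 0 F * PowerSeries.coeff 0 G := by
  rw [mul, coeff_formalMul, Finset.Nat.antidiagonal_zero, Finset.sum_singleton,
    Finset.Nat.antidiagonal_zero, Finset.sum_singleton, S.zero]

theorem star_C (hS : S.IsHermitian) (r : ℕ) (f g : Smooth n) :
    star (S.C r f g) = S.C r (star g) (star f) := by
  have h := congrArg (PowerSeries.coeff r) (hS (PowerSeries.C f) (PowerSeries.C g))
  simp only [conjFormal, PowerSeries.coeff_map, PowerSeries.map_C] at h
  rw [coeff_C_mul_C, coeff_C_mul_C] at h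
  exact h

end StarProduct

/-! The obstruction -/

variable (n) in
/-- The identity map from `𝒲` to the formal Weyl algebra. -/
def toWeyl : W n ≃ₗ[PowerSeries ℂ] Weyl n := LinearEquiv.refl _ (W n)

theorem toWeyl_weylMul (a b : W n) : toWeyl n (weylMul a b) = toWeyl n a * toWeyl n b := rfl

theorem toWeyl_X_pow_mul (r : ℕ) (a : W n) :
    toWeyl n (PowerSeries.X ^ r * a) = (PowerSeries.X : PowerSeries ℂ) ^ r • toWeyl n a := by
  rw [← X_pow_psmul, map_smul]

/-- The generating series of `F ↦ ∑_k t_k(F)` with respect to the degree. -/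
def genSer (t : ℕ → Smooth n →ₗ[ℂ] W n) (F : PowerSeries (Smooth n)) : PowerSeries (Weyl n) :=
  PowerSeries.mk fun k => ∑ x ∈ Finset.HasAntidiagonal.antidiagonal k,
    (PowerSeries.X : PowerSeries ℂ) ^ x.1 • toWeyl n (t x.2 (PowerSeries.coeff x.1 F))

variable {t t' : ℕ → Smooth n →ₗ[ℂ] W n}

theorem coeff_genSer (k : ℕ) (F : PowerSeries (Smooth n)) :
    PowerSeries.coeff k (genSer t F) = ∑ x ∈ Finset.HasAntidiagonal.antidiagonal k,
      (PowerSeries.X : PowerSeries ℂ) ^ x.1 • toWeyl n (t x.2 (PowerSeries.coeff x.1 F)) := by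
  rw [genSer, PowerSeries.coeff_mk]

theorem genSer_add (F G : PowerSeries (Smooth n)) :
    genSer t (F + G) = genSer t F + genSer t G := by
  ext1 k
  rw [map_add, coeff_genSer, coeff_genSer, coeff_genSer, ← Finset.sum_add_distrib]
  refine Finset.sum_congr rfl fun x _ => ?_
  rw [map_add, map_add, map_add, smul_add]

/-- The outer variable records the degree and the scalar `X` is `λ`. Since `λ` has degree one, both
appear. -/
theorem genSer_X_mul (F : PowerSeries (Smooth n)) :
    genSer t (PowerSeries.X * F) =
      PowerSeries.X * ((PowerSeries.X : PowerSeries ℂ) • genSer t F) := by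
  ext1 k
  cases k with
  | zero =>
    rw [PowerSeries.coeff_zero_X_mul, coeff_genSer, Finset.Nat.antidiagonal_zero,
      Finset.sum_singleton, PowerSeries.coeff_zero_X_mul, map_zero, map_zero, smul_zero]
  | succ k =>
    rw [PowerSeries.coeff_succ_X_mul, PowerSeries.coeff_smul, coeff_genSer, coeff_genSer,
      Finset.Nat.sum_antidiagonal_succ, Finset.smul_sum, PowerSeries.coeff_zero_X_mul, map_zero,
      map_zero, smul_zero, zero_add]
    refine Finset.sum_congr rfl fun x _ => ?_
    rw [PowerSeries.coeff_succ_X_mul, smul_smul, pow_succ']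

theorem coeff_genSer_C (k : ℕ) (f : Smooth n) :
    PowerSeries.coeff k (genSer t (PowerSeries.C f)) = toWeyl n (t k f) := by
  rw [coeff_genSer, Finset.sum_eq_single (0, k)]
  · simp
  · rintro ⟨a, b⟩ h hne
    rw [Finset.HasAntidiagonal.mem_antidiagonal] at h
    have ha : a ≠ 0 := by
      rintro rfl
      exact hne (by simp at h; rw [h])
    rw [PowerSeries.coeff_C (n := a), if_neg ha, map_zero, map_zero, smul_zero]
  · intro h
    simp at h

variable {P : PoissonStructure n} (S : StarProduct P)

/-- The deviation of the generating series of `t` from being multiplicative. -/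
def deviation (t : ℕ → Smooth n →ₗ[ℂ] W n) (F G : PowerSeries (Smooth n)) :
    PowerSeries (Weyl n) :=
  genSer t F * genSer t G - genSer t (S.mul F G)

/-- Formal consequence of the associativity of `⋆` and of the Weyl-Moyal product, valid for every
`t`. -/
theorem deviation_cocycle (F G H : PowerSeries (Smooth n)) :
    genSer t F * deviation S t G H - deviation S t (S.mul F G) H + deviation S t F (S.mul G H) =
      deviation S t F G * genSer t H := by
  have h : S.mul (S.mul F G) H = S.mul F (S.mul G H) := S.assoc F G H
  simp only [deviation, h, mul_sub, sub_mul, mul_assoc]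
  abel

theorem deviation_add_left (F F' G : PowerSeries (Smooth n)) :
    deviation S t (F + F') G = deviation S t F G + deviation S t F' G := by
  simp only [deviation, S.add_mul, genSer_add, add_mul]
  abel

theorem deviation_add_right (F G G' : PowerSeries (Smooth n)) :
    deviation S t F (G + G') = deviation S t F G + deviation S t F G' := by
  simp only [deviation, S.mul_add, genSer_add, mul_add]
  abel

theorem deviation_X_mul_left (F G : PowerSeries (Smooth n)) :
    deviation S t (PowerSeries.X * F) G =
      PowerSeries.X * ((PowerSeries.X : PowerSeries ℂ) • deviation S t F G) := by
  rw [deviation, deviation, S.X_mul_mul, genSer_X_mul, genSer_X_mul, mul_assoc, smul_mul_assoc,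
    smul_sub, mul_sub]

theorem deviation_X_mul_right (F G : PowerSeries (Smooth n)) :
    deviation S t F (PowerSeries.X * G) =
      PowerSeries.X * ((PowerSeries.X : PowerSeries ℂ) • deviation S t F G) := by
  rw [deviation, deviation, S.mul_X_mul, genSer_X_mul, genSer_X_mul, ← mul_assoc,
    (PowerSeries.commute_X (genSer t F)).eq, mul_assoc, mul_smul_comm, smul_sub, mul_sub]

/-- The degree `k` component of the deviation of `t` on functions. -/
def obst (t : ℕ → Smooth n →ₗ[ℂ] W n) (k : ℕ) (f g : Smooth n) : W n :=
  ∑ x ∈ Finset.HasAntidiagonal.antidiagonal k, weylMul (t x.1 f) (t x.2 g) -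
    ∑ x ∈ Finset.HasAntidiagonal.antidiagonal k, PowerSeries.X ^ x.1 * t x.2 (S.C x.1 f g)

theorem coeff_deviation_C (k : ℕ) (f g : Smooth n) :
    PowerSeries.coeff k (deviation S t (PowerSeries.C f) (PowerSeries.C g)) =
      toWeyl n (obst S t k f g) := by
  rw [deviation, map_sub, PowerSeries.coeff_mul, coeff_genSer, obst, map_sub, map_sum, map_sum]
  simp only [coeff_genSer_C, S.coeff_C_mul_C, toWeyl_weylMul, toWeyl_X_pow_mul]

/-- Splitting off the constant term of each argument leaves multiples of `λ`, which shift the degree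
by one; so vanishing on functions propagates to all series by induction on the degree. -/
theorem coeff_deviation_eq_zero {k : ℕ} (h : ∀ j < k, ∀ f g, obst S t j f g = 0) {j : ℕ}
    (hj : j < k) (F G : PowerSeries (Smooth n)) :
    PowerSeries.coeff j (deviation S t F G) = 0 := by
  induction j generalizing F G with
  | zero =>
    rw [PowerSeries.eq_X_mul_shift_add_const F, deviation_add_left, map_add, deviation_X_mul_left,
      PowerSeries.coeff_zero_X_mul, zero_add, PowerSeries.eq_X_mul_shift_add_const G,
      deviation_add_right, map_add, deviation_X_mul_right, PowerSeries.coeff_zero_X_mul, zero_add]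
    rw [coeff_deviation_C, h 0 hj, map_zero]
  | succ j ih =>
    have ih' := fun F G => ih (by omega) F G
    rw [PowerSeries.eq_X_mul_shift_add_const F, deviation_add_left, map_add, deviation_X_mul_left,
      PowerSeries.coeff_succ_X_mul, PowerSeries.coeff_smul, ih', smul_zero, zero_add,
      PowerSeries.eq_X_mul_shift_add_const G, deviation_add_right, map_add, deviation_X_mul_right,
      PowerSeries.coeff_succ_X_mul, PowerSeries.coeff_smul, ih', smul_zero, zero_add]
    rw [coeff_deviation_C, h _ hj, map_zero]

theorem coeff_deviation_eq_obst {k : ℕ} (h : ∀ j < k, ∀ f g, obst S t j f g = 0)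
    (F G : PowerSeries (Smooth n)) :
    PowerSeries.coeff k (deviation S t F G) =
      toWeyl n (obst S t k (PowerSeries.coeff 0 F) (PowerSeries.coeff 0 G)) := by
  have key : ∀ F' : PowerSeries (Weyl n), (∀ j < k, PowerSeries.coeff j F' = 0) →
      PowerSeries.coeff k (PowerSeries.X * ((PowerSeries.X : PowerSeries ℂ) • F')) = 0 :=
    fun F' hF' => by
      cases k with
      | zero => rw [PowerSeries.coeff_zero_X_mul]
      | succ k =>
        rw [PowerSeries.coeff_succ_X_mul, PowerSeries.coeff_smul, hF' k (Nat.lt_succ_self k),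
          smul_zero]
  have hz := fun F G j hj => coeff_deviation_eq_zero S h (j := j) hj F G
  conv_lhs => rw [PowerSeries.eq_X_mul_shift_add_const F, deviation_add_left, map_add,
    deviation_X_mul_left, key _ (hz _ _), zero_add, PowerSeries.eq_X_mul_shift_add_const G,
    deviation_add_right, map_add, deviation_X_mul_right, key _ (hz _ _), zero_add]
  rw [coeff_deviation_C, PowerSeries.coeff_zero_eq_constantCoeff]

/-- The component of degree `k` of `deviation_cocycle`: the deviation starts in degree `k`, so in
each product only `t 0 = π*` meets it. -/
theorem obst_cocycle {k : ℕ} (h0 : t 0 = piStar n) (h : ∀ j < k, ∀ f g, obst S t j f g = 0)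
    (f g u : Smooth n) :
    weylMul (piStar n f) (obst S t k g u) - obst S t k (f * g) u + obst S t k f (g * u) =
      weylMul (obst S t k f g) (piStar n u) := by
  have hz := fun F G j hj => coeff_deviation_eq_zero S h (j := j) hj F G
  have h1 := congrArg (PowerSeries.coeff k) (deviation_cocycle S (t := t) (PowerSeries.C f)
    (PowerSeries.C g) (PowerSeries.C u))
  rw [map_add, map_sub, coeff_deviation_eq_obst S h, coeff_deviation_eq_obst S h,
    S.coeff_zero_mul, S.coeff_zero_mul, PowerSeries.coeff_mul, PowerSeries.coeff_mul,
    Finset.sum_eq_single (0, k), Finset.sum_eq_single (k, 0), coeff_genSer_C, coeff_genSer_C,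
    coeff_deviation_eq_obst S h, coeff_deviation_eq_obst S h, h0] at h1
  · simp only [PowerSeries.coeff_zero_C, ← toWeyl_weylMul, ← map_sub, ← map_add] at h1
    exact (toWeyl n).injective h1
  · rintro ⟨a, b⟩ hab hne
    rw [Finset.HasAntidiagonal.mem_antidiagonal] at hab
    have : a < k := by
      by_contra hlt
      exact hne (Prod.ext (by simp only at hab ⊢; omega) (by simp only at hab ⊢; omega))
    rw [hz _ _ _ this, zero_mul]
  · intro h
    simp at h
  · rintro ⟨a, b⟩ hab hne
    rw [Finset.HasAntidiagonal.mem_antidiagonal] at hab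
    have : b < k := by
      by_contra hlt
      exact hne (Prod.ext (by simp only at hab ⊢; omega) (by simp only at hab ⊢; omega))
    rw [hz _ _ _ this, mul_zero]
  · intro h
    simp at h

/-! ### Dependence, grading and symmetry of the obstruction -/

theorem obst_congr {k : ℕ} (h : ∀ j ≤ k, t j = t' j) (f g : Smooth n) :
    obst S t k f g = obst S t' k f g := by
  rw [obst, obst]
  congr 1
  · refine Finset.sum_congr rfl fun x hx => ?_
    rw [Finset.HasAntidiagonal.mem_antidiagonal] at hx
    rw [h _ (by omega), h _ (by omega)]
  · refine Finset.sum_congr rfl fun x hx => ?_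
    rw [Finset.HasAntidiagonal.mem_antidiagonal] at hx
    rw [h _ (by omega)]

/-- The component `t k` is paired only with `t 0` in degree `k`, hence enters linearly; `k ≠ 0`
keeps the pairs `(k, 0)` and `(0, k)` apart. -/
theorem obst_add {k : ℕ} (hk : k ≠ 0) {u : Smooth n →ₗ[ℂ] W n} (h0 : t 0 = piStar n)
    (h : ∀ j < k, t' j = t j) (hu : t' k = t k + u) (f g : Smooth n) :
    obst S t' k f g = obst S t k f g + hoch u f g := by
  have h1 : ∀ x ∈ Finset.HasAntidiagonal.antidiagonal k, weylMul (t' x.1 f) (t' x.2 g) =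
      weylMul (t x.1 f) (t x.2 g) +
        ((if x = (k, 0) then weylMul (u f) (piStar n g) else 0) +
          if x = (0, k) then weylMul (piStar n f) (u g) else 0) := by
    rintro ⟨a, b⟩ hx
    rw [Finset.HasAntidiagonal.mem_antidiagonal] at hx
    simp only at hx ⊢
    by_cases ha : a = k
    · have hb : b = 0 := by omega
      subst ha hb
      rw [hu, h 0 (by omega), LinearMap.add_apply, add_weylMul, h0, if_pos rfl, if_neg, add_zero]
      rw [Prod.mk.injEq]
      omega
    · by_cases hb : b = k
      · have ha' : a = 0 := by omega
        subst ha' hb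
        rw [hu, h 0 (by omega), LinearMap.add_apply, weylMul_add, h0, if_pos rfl, if_neg, zero_add]
        rw [Prod.mk.injEq]
        omega
      · rw [h a (by omega), h b (by omega), if_neg, if_neg, add_zero, add_zero]
        · simp [hb]
        · simp [ha]
  have h2 : ∀ x ∈ Finset.HasAntidiagonal.antidiagonal k,
      PowerSeries.X ^ x.1 * t' x.2 (S.C x.1 f g) =
        PowerSeries.X ^ x.1 * t x.2 (S.C x.1 f g) + if x = (0, k) then u (f * g) else 0 := by
    rintro ⟨a, b⟩ hx
    rw [Finset.HasAntidiagonal.mem_antidiagonal] at hx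
    simp only at hx ⊢
    by_cases hb : b = k
    · have ha : a = 0 := by omega
      subst ha hb
      rw [hu, LinearMap.add_apply, S.zero, if_pos rfl, pow_zero, one_mul, one_mul]
    · rw [h b (by omega), if_neg, add_zero]
      simp [hb]
  rw [obst, obst, Finset.sum_congr rfl h1, Finset.sum_congr rfl h2, Finset.sum_add_distrib,
    Finset.sum_add_distrib, Finset.sum_add_distrib, Finset.sum_ite_eq', Finset.sum_ite_eq',
    Finset.sum_ite_eq', hoch]
  simp only [Finset.HasAntidiagonal.mem_antidiagonal, add_zero, zero_add, if_true]
  abel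

theorem obst_homog {k : ℕ} (h : ∀ j ≤ k, ∀ f, Homog j (t j f)) (f g : Smooth n) :
    Homog k (obst S t k f g) := by
  rw [obst]
  refine DegIn.sub (DegIn.sum fun x hx => ?_) (DegIn.sum fun x hx => ?_)
  · rw [Finset.HasAntidiagonal.mem_antidiagonal] at hx
    have := (h x.1 (by omega) f).weylMul (h x.2 (by omega) g)
    rwa [hx] at this
  · rw [Finset.HasAntidiagonal.mem_antidiagonal] at hx
    have := (h x.2 (by omega) (S.C x.1 f g)).X_pow_mul x.1
    rwa [add_comm, hx] at this

theorem StarProduct.mem_bidiffOps (r : ℕ) :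
    (fun p : Smooth n × Smooth n => S.C r p.1 p.2) ∈ bidiffOps n := by
  cases r with
  | zero =>
    simp only [S.zero]
    exact mul_mem_bidiffOps id_mem_diffOps id_mem_diffOps
  | succ r => exact FormalStar.mem_bidiffOps.2 (S.bidiff _ (by omega))

theorem obst_coeffIn {k : ℕ} (h : ∀ j ≤ k, CoeffIn (diffOps n) (t j)) :
    CoeffIn (bidiffOps n) fun p => obst S t k p.1 p.2 := by
  simp only [obst]
  refine CoeffIn.sub (CoeffIn.sum fun x hx => ?_) (CoeffIn.sum fun x hx => ?_)
  · rw [Finset.HasAntidiagonal.mem_antidiagonal] at hx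
    exact coeffIn_bidiffOps_weylMul (h _ (by omega)) (h _ (by omega))
  · rw [Finset.HasAntidiagonal.mem_antidiagonal] at hx
    exact CoeffIn.X_pow_mul _ fun r α =>
      dqClosed_bidiffOps.comp (h _ (by omega) r α) (S.mem_bidiffOps x.1)

/-- Modulo `λ` the Weyl products commute, so the first sum is symmetric. In the second sum only the
term without a factor `λ` could contribute, and it contains `t k = 0`. -/
theorem obst_symm {k : ℕ} (hk : t k = 0) (α : Fin n →₀ ℕ) (f g : Smooth n) :
    wcoeff 0 α (obst S t k f g) = wcoeff 0 α (obst S t k g f) := by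
  have h : ∀ f g, wcoeff 0 α (∑ x ∈ Finset.HasAntidiagonal.antidiagonal k,
      PowerSeries.X ^ x.1 * t x.2 (S.C x.1 f g)) = 0 := fun f g => by
    rw [wcoeff_sum]
    refine Finset.sum_eq_zero fun x hx => ?_
    rw [Finset.HasAntidiagonal.mem_antidiagonal] at hx
    rw [wcoeff_X_pow_mul]
    split_ifs with h1
    · have : x.2 = k := by omega
      rw [this, hk, LinearMap.zero_apply, wcoeff_zero]
    · rfl
  rw [obst, obst, wcoeff_sub, wcoeff_sub, h, h, wcoeff_sum, wcoeff_sum,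
    ← Finset.Nat.sum_antidiagonal_swap]
  congr 1
  refine Finset.sum_congr rfl fun x _ => ?_
  rw [wcoeff_zero_weylMul, wcoeff_zero_weylMul, mul_comm]
  rfl

/-! Conjugation of cochains -/

/-- The cochain `f ↦ conj (T (conj f))`. -/
def conjCochain (T : Smooth n →ₗ[ℂ] W n) : Smooth n →ₗ[ℂ] W n where
  toFun f := conjW (T (star f))
  map_add' f g := by rw [star_add, map_add, map_add]
  map_smul' c f := by
    rw [star_smul_smooth, map_smul, conjW_smul, star_star, RingHom.id_apply]

theorem conjCochain_apply (T : Smooth n →ₗ[ℂ] W n) (f : Smooth n) :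
    conjCochain T f = conjW (T (star f)) := rfl

theorem hoch_conjCochain (T : Smooth n →ₗ[ℂ] W n) (f g : Smooth n) :
    hoch (conjCochain T) f g = conjW (hoch T (star g) (star f)) := by
  simp only [hoch, conjCochain_apply, map_add, map_sub, conjW_weylMul, conjW_piStar, star_star,
    star_mul]
  abel

theorem homog_conjCochain {k : ℕ} {T : Smooth n →ₗ[ℂ] W n} (h : ∀ f, Homog k (T f))
    (f : Smooth n) : Homog k (conjCochain T f) := fun r α hr => by
  rw [conjCochain_apply, wcoeff_conjW, h _ r α hr, star_zero]

theorem coeffIn_conjCochain {T : Smooth n →ₗ[ℂ] W n} (h : CoeffIn (diffOps n) T) :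
    CoeffIn (diffOps n) (conjCochain T) := fun r α => by
  simp only [conjCochain_apply, wcoeff_conjW]
  exact star_mem_diffOps (h r α)

theorem obst_conj (hS : S.IsHermitian) {k : ℕ}
    (h : ∀ j ≤ k, ∀ f, t j (star f) = conjW (t j f)) (f g : Smooth n) :
    conjW (obst S t k (star g) (star f)) = obst S t k f g := by
  have h' : ∀ j ≤ k, ∀ f, conjW (t j (star f)) = t j f := fun j hj f => by
    rw [h j hj, conjW_conjW]
  rw [obst, obst, map_sub, map_sum, map_sum, ← Finset.Nat.sum_antidiagonal_swap]
  congr 1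
  · refine Finset.sum_congr rfl fun x hx => ?_
    rw [Finset.HasAntidiagonal.mem_antidiagonal] at hx
    rw [conjW_weylMul, h' _ (by simp; omega), h' _ (by simp; omega)]
    rfl
  · refine Finset.sum_congr rfl fun x hx => ?_
    rw [Finset.HasAntidiagonal.mem_antidiagonal] at hx
    rw [map_mul, map_pow, conjW_X, ← S.star_C hS, h' _ (by omega)]

end

section

variable {t t' : ℕ → Smooth n →ₗ[ℂ] W n} {P : PoissonStructure n} (S : StarProduct P)

/-! Construction of the cochains -/

/-- The conditions on the cochain `t k`, given the previous ones. -/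
structure IsGoodAt (t : ℕ → Smooth n →ₗ[ℂ] W n) (k : ℕ) : Prop where
  coeffIn : CoeffIn (diffOps n) (t k)
  homog : ∀ f, Homog k (t k f)
  obst : ∀ f g, obst S t k f g = 0
  real : S.IsHermitian → ∀ f, t k (star f) = conjW (t k f)

variable {S}

theorem IsGoodAt.congr {k : ℕ} (h : ∀ j ≤ k, t j = t' j) (ht : IsGoodAt S t k) :
    IsGoodAt S t' k := by
  have hk := h k le_rfl
  refine ⟨?_, ?_, fun f g => ?_, ?_⟩
  · rw [← hk]
    exact ht.coeffIn
  · rw [← hk]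
    exact ht.homog
  · rw [← obst_congr S h]
    exact ht.obst f g
  · rw [← hk]
    exact ht.real

theorem isGoodAt_zero (h0 : t 0 = piStar n) : IsGoodAt S t 0 := by
  refine ⟨?_, ?_, fun f g => ?_, fun _ f => ?_⟩
  · rw [h0]
    exact CoeffIn.piStar id_mem_diffOps
  · rw [h0]
    exact homog_piStar
  · rw [FormalStar.obst, Finset.Nat.antidiagonal_zero, Finset.sum_singleton, Finset.sum_singleton,
      h0, piStar_weylMul_piStar, S.zero, pow_zero, one_mul, sub_self]
  · rw [h0, conjW_piStar]

theorem exists_isGoodAt {k : ℕ} (hk : k ≠ 0) (h0 : t 0 = piStar n)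
    (h : ∀ j < k, IsGoodAt S t j) : ∃ u, IsGoodAt S (Function.update t k u) k := by
  -- A zero entry in degree `k` makes the obstruction symmetric modulo `λ`.
  let s := Function.update t k 0
  have hsk : s k = 0 := Function.update_self _ _ _
  have hsj : ∀ j, j ≠ k → s j = t j := fun j hj => Function.update_of_ne hj _ _
  have hs0 : s 0 = piStar n := by rw [hsj 0 hk.symm, h0]
  have hd : ∀ j ≤ k, CoeffIn (diffOps n) (s j) := fun j hj => by
    by_cases hjk : j = k
    · rw [hjk, hsk]
      exact CoeffIn.zero
    · rw [hsj j hjk]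
      exact (h j (by omega)).coeffIn
  have hh : ∀ j ≤ k, ∀ f, Homog j (s j f) := fun j hj => by
    by_cases hjk : j = k
    · rw [hjk, hsk]
      exact fun _ => DegIn.zero
    · rw [hsj j hjk]
      exact (h j (by omega)).homog
  have hr : S.IsHermitian → ∀ j ≤ k, ∀ f, s j (star f) = conjW (s j f) := fun hS j hj => by
    by_cases hjk : j = k
    · rw [hjk, hsk]
      exact fun _ => (map_zero conjW).symm
    · rw [hsj j hjk]
      exact (h j (by omega)).real hS
  have ho : ∀ j < k, ∀ f g, obst S s j f g = 0 := fun j hj f g => by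
    rw [obst_congr S (t' := t) fun i hi => hsj i (by omega)]
    exact (h j hj).obst f g
  obtain ⟨U, hU, hUh, hUo⟩ := exists_hoch_eq (obst_homog S hh) (obst_coeffIn S hd)
    (obst_cocycle S hs0 ho) (obst_symm S hsk)
  have key : ∃ V : Smooth n →ₗ[ℂ] W n, CoeffIn (diffOps n) V ∧ (∀ f, Homog k (V f)) ∧
      (∀ f g, hoch V f g = obst S s k f g) ∧
      (S.IsHermitian → ∀ f, V (star f) = conjW (V f)) := by
    -- The obstruction is invariant under conjugation with exchanged arguments, so the conjugate of
    -- a primitive is a primitive, and their mean is real.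
    by_cases hS : S.IsHermitian
    · refine ⟨(1 / 2 : ℂ) • (U + conjCochain U), (hU.add (coeffIn_conjCochain hU)).smul _,
        fun f => ((hUh f).add (homog_conjCochain hUh f)).smul _, fun f g => ?_, fun _ f => ?_⟩
      · have e : ⇑((1 / 2 : ℂ) • (U + conjCochain U)) =
            fun f => (1 / 2 : ℂ) • (U f + conjCochain U f) := rfl
        rw [e, hoch_smul, hoch_add, hoch_conjCochain, hUo, hUo, obst_conj S hS (hr hS)]
        module
      · simp only [LinearMap.smul_apply, LinearMap.add_apply, conjCochain_apply, star_star,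
          conjW_smul, map_add, conjW_conjW]
        rw [add_comm]
        congr 1
        simp
    · exact ⟨U, hU, hUh, hUo, fun h => absurd h hS⟩
  obtain ⟨V, hV, hVh, hVo, hVr⟩ := key
  have hself : Function.update t k (-V) k = -V := Function.update_self _ _ _
  refine ⟨-V, ⟨?_, ?_, fun f g => ?_, ?_⟩⟩
  · rw [hself]
    exact hV.neg
  · rw [hself]
    exact fun f => (hVh f).neg
  · rw [obst_add S hk (t := s) (u := -V) hs0
      (fun j hj => by rw [Function.update_of_ne hj.ne, hsj j hj.ne]) (by rw [hself, hsk, zero_add])]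
    have e : ⇑(-V) = fun f => (-1 : ℂ) • V f := by
      funext f
      rw [LinearMap.neg_apply, neg_one_smul]
    rw [e, hoch_smul, hVo, neg_one_smul, add_neg_cancel]
  · rw [hself]
    intro hS f
    rw [LinearMap.neg_apply, LinearMap.neg_apply, hVr hS, map_neg]

/-- Sequences can be constructed recursively from conditions on their initial segments. -/
theorem exists_seq_of_update {X : Type*} (Q : (ℕ → X) → ℕ → Prop) (x : X)
    (hcongr : ∀ s s' k, (∀ j ≤ k, s j = s' j) → Q s k → Q s' k)
    (hzero : ∀ s : ℕ → X, s 0 = x → Q s 0)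
    (hstep : ∀ (s : ℕ → X) k, k ≠ 0 → s 0 = x → (∀ j < k, Q s j) →
      ∃ u, Q (Function.update s k u) k) :
    ∃ s : ℕ → X, s 0 = x ∧ ∀ k, Q s k := by
  have hex : ∀ (s : ℕ → X) k, ∃ u, k ≠ 0 → s 0 = x → (∀ j < k, Q s j) →
      Q (Function.update s k u) k := fun s k => by
    by_cases h : k ≠ 0 ∧ s 0 = x ∧ ∀ j < k, Q s j
    · obtain ⟨u, hu⟩ := hstep s k h.1 h.2.1 h.2.2
      exact ⟨u, fun _ _ _ => hu⟩
    · exact ⟨x, fun h1 h2 h3 => absurd ⟨h1, h2, h3⟩ h⟩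
  choose nxt hnxt using hex
  -- The `k`-th sequence has its final entries up to index `k`; the diagonal is the required
  -- sequence.
  let F : ℕ → ℕ → X := fun k =>
    Nat.rec (fun _ => x) (fun k s => Function.update s (k + 1) (nxt s (k + 1))) k
  have hF : ∀ k, F (k + 1) = Function.update (F k) (k + 1) (nxt (F k) (k + 1)) := fun _ => rfl
  have hstable : ∀ j d, F (j + d) j = F j j := fun j d => by
    induction d with
    | zero => rfl
    | succ d ih => rw [← add_assoc, hF, Function.update_of_ne (by omega), ih]
  have hFz : ∀ k, F k 0 = x := fun k => by
    have h := hstable 0 k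
    rw [zero_add] at h
    exact h
  have hQ : ∀ k, ∀ j ≤ k, Q (F k) j := fun k => by
    induction k with
    | zero =>
      intro j hj
      rw [Nat.le_zero.1 hj]
      exact hzero _ rfl
    | succ k ih =>
      intro j hj
      by_cases hjk : j = k + 1
      · rw [hjk, hF]
        exact hnxt _ _ (Nat.succ_ne_zero k) (hFz k) fun i hi => ih i (by omega)
      · refine hcongr (F k) _ j (fun i hi => ?_) (ih j (by omega))
        rw [hF, Function.update_of_ne (by omega)]
  refine ⟨fun k => F k k, rfl, fun k => hcongr (F k) _ k (fun j hj => ?_) (hQ k k le_rfl)⟩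
  obtain ⟨d, rfl⟩ := Nat.exists_eq_add_of_le hj
  exact hstable j d

variable (S) in
theorem exists_cochains :
    ∃ t : ℕ → Smooth n →ₗ[ℂ] W n, t 0 = piStar n ∧ ∀ k, IsGoodAt S t k :=
  exists_seq_of_update (IsGoodAt S) (piStar n) (fun _ _ _ h ht => ht.congr h)
    (fun _ h => isGoodAt_zero h) fun _ _ hk h0 h => exists_isGoodAt hk h0 h

/-! Summation of the cochains -/

/-- The element of `𝒲₀` with given coefficients. -/
def W0.ofCoeffs (u : (Fin n →₀ ℕ) → Smooth n) : W0 n := u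

/-- The element of `𝒲` with given coefficients. -/
def W.ofCoeffs (u : ℕ → (Fin n →₀ ℕ) → Smooth n) : W n := PowerSeries.mk fun r => W0.ofCoeffs (u r)

theorem wcoeff_ofCoeffs (u : ℕ → (Fin n →₀ ℕ) → Smooth n) (r : ℕ) (α : Fin n →₀ ℕ) :
    wcoeff r α (W.ofCoeffs u) = u r α := by
  rw [wcoeff, W.ofCoeffs, PowerSeries.coeff_mk]
  rfl

/-- The sum of homogeneous cochains `t k` of degree `k`. -/
def cochainSum (t : ℕ → Smooth n →ₗ[ℂ] W n) : Smooth n →ₗ[ℂ] W n where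
  toFun f := W.ofCoeffs fun r α => wcoeff r α (t (r + α.degree) f)
  map_add' f g := wcoeff_ext fun r α => by
    simp only [wcoeff_ofCoeffs, wcoeff_add, map_add]
  map_smul' c f := wcoeff_ext fun r α => by
    simp only [wcoeff_ofCoeffs, wcoeff_smul, map_smul, RingHom.id_apply]

theorem wcoeff_cochainSum (r : ℕ) (α : Fin n →₀ ℕ) (f : Smooth n) :
    wcoeff r α (cochainSum t f) = wcoeff r α (t (r + α.degree) f) :=
  wcoeff_ofCoeffs (fun r α => wcoeff r α (t (r + α.degree) f)) r α

theorem lambdaExt_eq_xsum (T : Smooth n →ₗ[ℂ] W n) (F : PowerSeries (Smooth n)) :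
    lambdaExt T F = xsum fun r => T (PowerSeries.coeff r F) := rfl

theorem lambdaExt_add (T : Smooth n →ₗ[ℂ] W n) (F G : PowerSeries (Smooth n)) :
    lambdaExt T (F + G) = lambdaExt T F + lambdaExt T G := by
  simp only [lambdaExt_eq_xsum, map_add, xsum_add]

theorem lambdaExt_smul (T : Smooth n →ₗ[ℂ] W n) (c : ℂ) (F : PowerSeries (Smooth n)) :
    lambdaExt T (c • F) = c • lambdaExt T F := by
  simp only [lambdaExt_eq_xsum, PowerSeries.coeff_smul, map_smul, xsum_smul]

theorem lambdaExt_X_mul (T : Smooth n →ₗ[ℂ] W n) (F : PowerSeries (Smooth n)) :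
    lambdaExt T (PowerSeries.X * F) = PowerSeries.X * lambdaExt T F := by
  rw [lambdaExt_eq_xsum, xsum_eq_add, PowerSeries.coeff_zero_X_mul, map_zero, zero_add]
  simp only [PowerSeries.coeff_succ_X_mul]
  rfl

/-- The `λ`-linear extension of a cochain as a `ℂ[[λ]]`-linear map. -/
def lambdaExtLin (T : Smooth n →ₗ[ℂ] W n) : PowerSeries (Smooth n) →ₗ[PowerSeries ℂ] W n where
  toFun := lambdaExt T
  map_add' := lambdaExt_add T
  map_smul' c F := map_smul_of_map_X_mul
    (φ := { toFun := lambdaExt T, map_add' := lambdaExt_add T, map_smul' := lambdaExt_smul T })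
    (lambdaExt_X_mul T) c F

theorem wcoeff_lambdaExt (T : Smooth n →ₗ[ℂ] W n) (F : PowerSeries (Smooth n)) (r : ℕ)
    (α : Fin n →₀ ℕ) :
    wcoeff r α (lambdaExt T F) = ∑ x ∈ Finset.HasAntidiagonal.antidiagonal r,
      wcoeff x.2 α (T (PowerSeries.coeff x.1 F)) := by
  rw [lambdaExt_eq_xsum, wcoeff_xsum]

theorem wcoeff_cochainSum_eq_sum (hh : ∀ k f, Homog k (t k f)) {r N : ℕ} {α : Fin n →₀ ℕ}
    (hN : r + α.degree < N) (f : Smooth n) :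
    wcoeff r α (cochainSum t f) = ∑ k ∈ Finset.range N, wcoeff r α (t k f) := by
  rw [wcoeff_cochainSum, Finset.sum_eq_single (r + α.degree)]
  · intro k _ hk
    exact homog_iff.1 (hh k f) r α hk.symm
  · intro h
    exact absurd (Finset.mem_range.2 hN) h

theorem hasFormalSum_cochainSum (hh : ∀ k f, Homog k (t k f)) (F : PowerSeries (Smooth n)) :
    HasFormalSum (fun k => lambdaExt (t k) F) (lambdaExt (cochainSum t) F) := by
  intro r α
  filter_upwards [Filter.eventually_gt_atTop (r + α.degree)] with N hN
  simp only [wcoeff_sum, wcoeff_lambdaExt]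
  rw [Finset.sum_comm]
  refine Finset.sum_congr rfl fun x hx => ?_
  rw [Finset.HasAntidiagonal.mem_antidiagonal] at hx
  rw [wcoeff_cochainSum_eq_sum (N := N) hh (by omega)]

/-- If the coefficients of `F` below order `m` vanish, the coefficient of `λ^m p^0` in the image
comes from `π*` alone and is the `m`-th coefficient of `F`. -/
theorem lambdaExt_cochainSum_eq_zero (h0 : t 0 = piStar n) {F : PowerSeries (Smooth n)}
    (hF : lambdaExt (cochainSum t) F = 0) : F = 0 := by
  ext1 m
  rw [map_zero]
  induction m using Nat.strong_induction_on with
  | _ m ih =>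
    have h := congrArg (wcoeff m 0) hF
    rw [wcoeff_zero, wcoeff_lambdaExt, Finset.sum_eq_single (m, 0)] at h
    · rwa [wcoeff_cochainSum, map_zero, zero_add, h0, wcoeff_piStar, if_pos ⟨rfl, rfl⟩] at h
    · rintro ⟨a, b⟩ hx hne
      rw [Finset.HasAntidiagonal.mem_antidiagonal] at hx
      have ha : a < m := by
        by_contra hlt
        exact hne (Prod.ext (by simp only at hx ⊢; omega) (by simp only at hx ⊢; omega))
      rw [ih a ha, map_zero, wcoeff_zero]
    · intro h
      simp at h

/-! ### Multiplicativity of the summed map -/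

theorem degIn_of_wcoeff {N : ℕ} {a : W n} (h : ∀ r α, r + α.degree < N → wcoeff r α a = 0) :
    DegIn (Set.Ici (N : ℤ)) a := fun r α hr => h r α (by
  rw [Set.mem_Ici, not_le] at hr
  exact_mod_cast hr)

theorem DegIn.wcoeff_eq_zero {N : ℕ} {a : W n} (h : DegIn (Set.Ici (N : ℤ)) a) {r : ℕ}
    {α : Fin n →₀ ℕ} (hr : r + α.degree < N) : wcoeff r α a = 0 :=
  h r α (by
    rw [Set.mem_Ici, not_le]
    exact_mod_cast hr)

/-- Truncation after degree `k = r + |α|` does not matter, since the Weyl product is graded and no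
degrees are negative. -/
theorem wcoeff_weylMul_cochainSum (hh : ∀ k f, Homog k (t k f)) (r : ℕ) (α : Fin n →₀ ℕ)
    (f g : Smooth n) :
    wcoeff r α (weylMul (cochainSum t f) (cochainSum t g)) =
      wcoeff r α (∑ x ∈ Finset.HasAntidiagonal.antidiagonal (r + α.degree),
        weylMul (t x.1 f) (t x.2 g)) := by
  set k := r + α.degree with hk
  let p : Smooth n → W n := fun f => ∑ i ∈ Finset.range (k + 1), t i f
  have hrest : ∀ f, DegIn (Set.Ici ((k + 1 : ℕ) : ℤ)) (cochainSum t f - p f) := fun f =>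
    degIn_of_wcoeff fun r α h => by
      rw [wcoeff_sub, wcoeff_cochainSum_eq_sum hh h, wcoeff_sum, sub_self]
  have hall : ∀ a : W n, DegIn (Set.Ici ((0 : ℕ) : ℤ)) a := fun a =>
    degIn_of_wcoeff fun r α h => absurd h (Nat.not_lt_zero _)
  have e : weylMul (cochainSum t f) (cochainSum t g) = weylMul (p f) (p g) +
      (weylMul (p f) (cochainSum t g - p g) +
        weylMul (cochainSum t f - p f) (cochainSum t g)) := by
    simp only [weylMul_sub, sub_weylMul]
    abel
  have z1 : wcoeff r α (weylMul (p f) (cochainSum t g - p g)) = 0 := by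
    refine DegIn.wcoeff_eq_zero (N := k + 1) (DegIn.weylMul ?_ (hall _) (hrest g)) (by omega)
    intro i hi j hj
    rw [Set.mem_Ici] at hi hj ⊢
    push_cast at hi hj ⊢
    omega
  have z2 : wcoeff r α (weylMul (cochainSum t f - p f) (cochainSum t g)) = 0 := by
    refine DegIn.wcoeff_eq_zero (N := k + 1) (DegIn.weylMul ?_ (hrest f) (hall _)) (by omega)
    intro i hi j hj
    rw [Set.mem_Ici] at hi hj ⊢
    push_cast at hi hj ⊢
    omega
  have hsum : weylMul (p f) (p g) = ∑ i ∈ Finset.range (k + 1), ∑ j ∈ Finset.range (k + 1),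
      weylMul (t i f) (t j g) := by
    simp only [p]
    rw [sum_weylMul]
    exact Finset.sum_congr rfl fun i _ =>
      map_sum (AddMonoidHom.mk' (weylMul (t i f)) (weylMul_add _)) _ _
  rw [e, wcoeff_add, wcoeff_add, z1, z2, add_zero, add_zero, hsum, wcoeff_sum, wcoeff_sum,
    Finset.Nat.sum_antidiagonal_eq_sum_range_succ fun i j => wcoeff r α (weylMul (t i f) (t j g))]
  refine Finset.sum_congr rfl fun i hi => ?_
  rw [Finset.mem_range] at hi
  rw [wcoeff_sum, Finset.sum_eq_single (k - i)]
  · intro j _ hj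
    exact homog_iff.1 ((hh i f).weylMul (hh j g)) r α (by omega)
  · intro h
    exact absurd (Finset.mem_range.2 (by omega)) h

theorem lambdaExt_cochainSum_C_mul_C (hh : ∀ k f, Homog k (t k f))
    (ho : ∀ k f g, obst S t k f g = 0) (f g : Smooth n) :
    lambdaExt (cochainSum t) (S.mul (PowerSeries.C f) (PowerSeries.C g)) =
      weylMul (cochainSum t f) (cochainSum t g) := by
  refine wcoeff_ext fun r α => ?_
  rw [wcoeff_weylMul_cochainSum hh, sub_eq_zero.1 (ho (r + α.degree) f g), wcoeff_lambdaExt,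
    wcoeff_sum]
  simp only [S.coeff_C_mul_C, wcoeff_cochainSum, wcoeff_X_pow_mul]
  rw [Finset.Nat.sum_antidiagonal_eq_sum_range_succ fun i j =>
      wcoeff j α (t (j + α.degree) (S.C i f g)),
    Finset.Nat.sum_antidiagonal_eq_sum_range_succ fun i j =>
      if i ≤ r then wcoeff (r - i) α (t j (S.C i f g)) else 0]
  -- Terms with a factor `λ^i`, `i > r`, do not reach the coefficient of `λ^r`.
  rw [← Finset.sum_subset (Finset.range_subset_range.2 (show r + 1 ≤ (r + α.degree) + 1 by omega))]
  · refine Finset.sum_congr rfl fun i hi => ?_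
    rw [Finset.mem_range] at hi
    rw [if_pos (by omega), Nat.sub_add_comm (by omega)]
  · intro i _ hi
    rw [Finset.mem_range] at hi
    rw [if_neg (by omega)]

theorem lambdaExt_C (T : Smooth n →ₗ[ℂ] W n) (f : Smooth n) :
    lambdaExt T (PowerSeries.C f) = T f := by
  rw [lambdaExt_eq_xsum, xsum_eq_of_zero, PowerSeries.coeff_zero_C]
  intro r
  rw [PowerSeries.coeff_C, if_neg (Nat.succ_ne_zero r), map_zero]

theorem lambdaExt_cochainSum_mul (hh : ∀ k f, Homog k (t k f))
    (ho : ∀ k f g, obst S t k f g = 0) (F G : PowerSeries (Smooth n)) :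
    lambdaExt (cochainSum t) (S.mul F G) =
      weylMul (lambdaExt (cochainSum t) F) (lambdaExt (cochainSum t) G) := by
  refine bilin_ext (β := fun F G => lambdaExt (cochainSum t) (S.mul F G))
    (γ := fun F G => weylMul (lambdaExt (cochainSum t) F) (lambdaExt (cochainSum t) G))
    ?_ ?_ ?_ ?_ ?_ ?_ ?_ ?_ ?_ F G
  · intro a b c
    rw [S.add_mul, lambdaExt_add]
  · intro a b c
    rw [S.mul_add, lambdaExt_add]
  · intro a b c
    rw [lambdaExt_add, add_weylMul]
  · intro a b c
    rw [lambdaExt_add, weylMul_add]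
  · intro a b
    rw [S.X_mul_mul, lambdaExt_X_mul]
  · intro a b
    rw [S.mul_X_mul, lambdaExt_X_mul]
  · intro a b
    rw [lambdaExt_X_mul, X_mul_weylMul]
  · intro a b
    rw [lambdaExt_X_mul, weylMul_X_mul]
  · intro f g
    rw [lambdaExt_C, lambdaExt_C]
    exact lambdaExt_cochainSum_C_mul_C hh ho f g

/-- An idempotent whose component of degree `0` is the unit is the unit. -/
theorem eq_one_of_weylMul_self {e : W n} (he : weylMul e e = e) (h0 : wcoeff 0 0 e = 1) :
    e = 1 := by
  -- The difference `x = e - 1` satisfies `x = -x ⋆ x`, so once it has positive lowest degree, that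
  -- degree can be raised without bound.
  have hx : e - 1 = -weylMul (e - 1) (e - 1) := by
    rw [sub_weylMul, weylMul_sub, he, one_weylMul, weylMul_one]
    abel
  have hone : wcoeff 0 0 (1 : W n) = 1 := by
    rw [← piStar_one, wcoeff_piStar, if_pos ⟨rfl, rfl⟩]
  have hN : ∀ N : ℕ, DegIn (Set.Ici ((N + 1 : ℕ) : ℤ)) (e - 1) := fun N => by
    induction N with
    | zero =>
      refine degIn_of_wcoeff fun r α h => ?_
      have hr : r = 0 := by omega
      have hα : α = 0 := (Finsupp.degree_eq_zero_iff α).1 (by omega)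
      rw [hr, hα, wcoeff_sub, h0, hone, sub_self]
    | succ N ih =>
      rw [hx]
      refine (DegIn.weylMul (fun i hi j hj => ?_) ih ih).neg
      rw [Set.mem_Ici] at hi hj ⊢
      push_cast at hi hj ⊢
      omega
  refine sub_eq_zero.1 (wcoeff_ext fun r α => ?_)
  rw [wcoeff_zero]
  exact (hN (r + α.degree)).wcoeff_eq_zero (by omega)

variable (S) in
theorem exists_isRealization :
    ∃ (t : ℕ → Smooth n →ₗ[ℂ] W n) (τ : PowerSeries (Smooth n) →ₗ[PowerSeries ℂ] W n),
      IsRealization S t τ ∧ (S.IsHermitian → ∀ F, τ (conjFormal F) = conjW (τ F)) := by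
  obtain ⟨t, h0, ht⟩ := exists_cochains S
  have hh : ∀ k f, Homog k (t k f) := fun k => (ht k).homog
  have ho : ∀ k f g, obst S t k f g = 0 := fun k => (ht k).obst
  refine ⟨t, lambdaExtLin (cochainSum t), ⟨h0, fun k _ => isDiffCochain_iff.2 (ht k).coeffIn,
    fun k _ f => (hh k f).degMap, hasFormalSum_cochainSum hh, ?_, lambdaExt_cochainSum_mul hh ho,
    ?_⟩, ?_⟩
  · rw [← LinearMap.ker_eq_bot, LinearMap.ker_eq_bot']
    exact fun F hF => lambdaExt_cochainSum_eq_zero h0 hF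
  · intro E hE
    -- A unit is idempotent, hence so is its image; the component of degree zero is `1` because `⋆`
    -- is the pointwise product at order `λ^0`.
    refine eq_one_of_weylMul_self ?_ ?_
    · exact (lambdaExt_cochainSum_mul hh ho E E).symm.trans
        (congrArg (lambdaExt (cochainSum t)) (hE E).1)
    · have h1 := congrArg (PowerSeries.coeff 0) (hE 1).1
      rw [S.coeff_zero_mul, PowerSeries.coeff_zero_one, mul_one] at h1
      change wcoeff 0 0 (lambdaExt (cochainSum t) E) = 1
      rw [wcoeff_lambdaExt, Finset.Nat.antidiagonal_zero, Finset.sum_singleton, h1,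
        wcoeff_cochainSum, map_zero, zero_add, h0, wcoeff_piStar, if_pos ⟨rfl, rfl⟩]
  · intro hS F
    change lambdaExt (cochainSum t) (conjFormal F) = conjW (lambdaExt (cochainSum t) F)
    refine wcoeff_ext fun r α => ?_
    rw [wcoeff_conjW, wcoeff_lambdaExt, wcoeff_lambdaExt, star_sum]
    refine Finset.sum_congr rfl fun x _ => ?_
    rw [wcoeff_cochainSum, wcoeff_cochainSum, ← wcoeff_conjW, ← (ht _).real hS, conjFormal,
      PowerSeries.coeff_map]
    rfl

end

end FormalStar

end

theorem mainTheorem2 (n : ℕ) (P : FormalStar.PoissonStructure n) (S : FormalStar.StarProduct P) :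
    (∃ (t : ℕ → FormalStar.Smooth n →ₗ[ℂ] FormalStar.W n)
      (τ : PowerSeries (FormalStar.Smooth n) →ₗ[PowerSeries ℂ] FormalStar.W n),
      FormalStar.IsRealization S t τ) ∧
    (S.IsHermitian →
      ∃ (t : ℕ → FormalStar.Smooth n →ₗ[ℂ] FormalStar.W n)
        (τ : PowerSeries (FormalStar.Smooth n) →ₗ[PowerSeries ℂ] FormalStar.W n),
        FormalStar.IsRealization S t τ ∧
          ∀ F, τ (FormalStar.conjFormal F) = FormalStar.conjW (τ F)) := by
  obtain ⟨t, τ, h, hr⟩ := FormalStar.exists_isRealization S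
  exact ⟨⟨t, τ, h⟩, fun hS => ⟨t, τ, h, hr hS⟩⟩
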